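/- Let $\mathbb H$ be the quaternions, $S^3\subset\mathbb H$ the group of unit quaternions, and $Q^k=(S^3)^k$. Let $P\subset\mathbb R^n$ be an $n$-dimensional simple convex polytope with $m$ facets, $P=\{x : \langle a_i,x\rangle+b_i\ge 0,\ i=1,\dots,m\}$, where each inequality defines a facet and different inequalities define different facets. The quaternionic moment–angle manifold of $P$ is $$\mathcal Z^{\mathbb H}_P=\{(h,x)\in\mathbb H^m\times P : |h_i|^2=\langle a_i,x\rangle+b_i \text{ for } i=1,\dots,m\},$$ on which $Q^m$ acts by $q\cdot(h,x)=((q_1h_1,\dots,q_mh_m),x)$. A quoric manifold over $P$ is a $4n$-dimensional topological manifold $X$ with a continuous effective $Q^n$-action in which every point has an invariant open neighbourhood equivariantly homeomorphic to $\mathbb H^n$ with the action by coordinatewise left multiplication, together with a continuous surjection $X\to P$ whose fibres are precisely the $Q^n$-orbits. A quoric quotient of $\mathcal Z^{\mathbb H}_P$ is a quoric manifold over $P$ whose underlying space is the quotient $X=\mathcal Z^{\mathbb H}_P/K$ by a closed subgroup $K\subset Q^m$ that is isomorphic to $Q^{m-n}$ and acts freely on $\mathcal Z^{\mathbb H}_P$,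 such that the projection $\mathcal Z^{\mathbb H}_P\to P$ is the composite $\mathcal Z^{\mathbb H}_P\to X\to P$. A continuous action of a topological group $G$ on a space $N$ is locally linear if for every $y\in N$, with isotropy group $G_y$, there are a finite-dimensional continuous real representation $V$ of $G_y$ and a $G$-equivariant open embedding $G\times_{G_y}V\to N$ that takes $[1,0]$ to $y$. A $G$-homotopy is a homotopy through $G$-equivariant maps. A $G$-equivariant homotopy equivalence is a continuous $G$-equivariant map that has a continuous $G$-equivariant inverse up to $G$-homotopy. **Theorem 5.3.** Suppose that $\mathcal Z^{\mathbb H}_P$ has a quoric quotient $X$ of dimension $4$. Let $Z$ be a closed topological manifold with a continuous locally linear $Q^m$-action, and let $f:Z\to\mathcal Z^{\mathbb H}_P$ be a $Q^m$-equivariant homotopy equivalence. Then $f$ is $Q^m$-homotopic to a $Q^m$-equivariant homeomorphism $Z\to\mathcal Z^{\mathbb H}_P$. In particular, $Z$ is $Q^m$-equivariantly homeomorphic to $\mathcal Z^{\mathbb H}_P$. -/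

import Mathlib

open scoped Quaternion

noncomputable section

namespace QuaternionicMA

/-! ### Quaternionic tori -/

/-- The quaternionic torus `Q^m = (S³)^m`, where `S³` is the group of unit quaternions. -/
abbrev QTorus (m : ℕ) : Type := Fin m → Metric.sphere (0 : ℍ[ℝ]) 1

/-- The standard action of `Q^m` on `ℍ^m`: coordinatewise left multiplication. -/
def stdAct {m : ℕ} (q : QTorus m) (h : Fin m → ℍ[ℝ]) : Fin m → ℍ[ℝ] :=
  fun i => (q i : ℍ[ℝ]) * h i

/-! ### Simple polytopes -/

/-- A simple `n`-dimensional convex polytope in `ℝⁿ` with `m` facets, given by its facet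
inequalities `⟪aᵢ, x⟫ + bᵢ ≥ 0`, `i = 1, …, m`. -/
structure SimplePolytope (n m : ℕ) where
  /-- the normal vectors `aᵢ` -/
  normal : Fin m → EuclideanSpace ℝ (Fin n)
  /-- the constants `bᵢ` -/
  offset : Fin m → ℝ
  /-- `P` is bounded. -/
  bounded : Bornology.IsBounded {x | ∀ i, 0 ≤ inner ℝ (normal i) x + offset i}
  /-- `P` has an interior point. -/
  full_dim : ∃ x, ∀ i, 0 < inner ℝ (normal i) x + offset i
  /-- Every inequality defines a facet, and different inequalities define different facets:
  on each of the `m` bounding hyperplanes there is a point of `P` that lies on no other one. -/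
  irredundant : ∀ i, ∃ x, inner ℝ (normal i) x + offset i = 0 ∧
    ∀ j, j ≠ i → 0 < inner ℝ (normal j) x + offset j
  /-- Exactly `n` facets meet at each vertex. -/
  simple : ∀ v ∈ Set.extremePoints ℝ {x | ∀ i, 0 ≤ inner ℝ (normal i) x + offset i},
    {i | inner ℝ (normal i) v + offset i = 0}.ncard = n

namespace SimplePolytope

variable {n m : ℕ} (P : SimplePolytope n m)

/-- The `i`-th coordinate of the embedding `i_P : P → ℝ^m_{≥0}` given by the facet
inequalities. -/
def slack (i : Fin m) (x : EuclideanSpace ℝ (Fin n)) : ℝ :=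
  inner ℝ (P.normal i) x + P.offset i

/-- The underlying point set of the polytope. -/
def carrier : Set (EuclideanSpace ℝ (Fin n)) := {x | ∀ i, 0 ≤ P.slack i x}

end SimplePolytope

/-! ### Quaternionic moment-angle manifolds -/

/-- The quaternionic moment-angle manifold of `P` (pullback model):
`{(h, x) ∈ ℍ^m × P | (|h₁|², …, |h_m|²) = i_P(x)}`, with the subspace topology. -/
abbrev MomentAngle {n m : ℕ} (P : SimplePolytope n m) : Type :=
  {p : (Fin m → ℍ[ℝ]) × EuclideanSpace ℝ (Fin n) //
    p.2 ∈ P.carrier ∧ ∀ i, ‖p.1 i‖ ^ 2 = P.slack i p.2}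

/-- `Q^m` acts on the moment-angle manifold through the standard action on `ℍ^m`. -/
instance {n m : ℕ} (P : SimplePolytope n m) : MulAction (QTorus m) (MomentAngle P) where
  smul q z := ⟨(stdAct q z.1.1, z.1.2), z.2.1, fun i => by
    simpa [stdAct] using z.2.2 i⟩
  one_smul z := Subtype.ext (Prod.ext (funext fun i => one_mul (z.1.1 i)) rfl)
  mul_smul q r z := Subtype.ext (Prod.ext
    (funext fun i => mul_assoc (q i : ℍ[ℝ]) (r i : ℍ[ℝ]) (z.1.1 i)) rfl)

/-! ### Quoric manifolds and quoric quotients -/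

/-- `X`, with its `Q^n`-action and the map `π`, is a quoric manifold of dimension `d` over the
simple polytope `P` of dimension `n`. -/
structure IsQuoricManifold {n m : ℕ} (P : SimplePolytope n m) (d : ℕ)
    (X : Type) [TopologicalSpace X] [MulAction (QTorus n) X]
    (π : X → EuclideanSpace ℝ (Fin n)) : Prop where
  /-- A quoric manifold over an `n`-dimensional polytope has dimension `4n`. -/
  dim_eq : d = 4 * n
  t2 : T2Space X
  secondCountable : SecondCountableTopology X
  manifold : Nonempty (ChartedSpace (EuclideanSpace ℝ (Fin d)) X)
  continuous_smul : ContinuousSMul (QTorus n) X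
  /-- The action is effective. -/
  effective : FaithfulSMul (QTorus n) X
  /-- Every point has a regular chart: an equivariant homeomorphism from an invariant open
  neighbourhood onto `ℍ^n` with the standard action. -/
  regular_chart : ∀ x : X, ∃ φ : OpenPartialHomeomorph X (Fin n → ℍ[ℝ]),
    x ∈ φ.source ∧ φ.target = Set.univ ∧
      ∀ (q : QTorus n), ∀ y ∈ φ.source, q • y ∈ φ.source ∧ φ (q • y) = stdAct q (φ y)
  /-- `π` is a continuous projection onto `P` whose fibres are precisely the orbits. -/
  continuous_proj : Continuous π
  range_proj : Set.range π = P.carrier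
  fibres : ∀ x y : X, π x = π y ↔ ∃ q : QTorus n, q • x = y

/-- The subgroup `K ⊆ Q^m` is a closed copy of `Q^{m-n}` that acts freely on the moment-angle
manifold of `P`, and the quotient by `K` is a quoric manifold of dimension `d` over `P`, such
that the orbit map of the moment-angle manifold factors through the one of the quotient. -/
structure IsQuoricQuotient {n m : ℕ} (P : SimplePolytope n m) (K : Subgroup (QTorus m))
    (d : ℕ) : Prop where
  closed : IsClosed (K : Set (QTorus m))
  iso : Nonempty (K ≃ₜ* QTorus (m - n))
  free : ∀ k ∈ K, ∀ z : MomentAngle P, k • z = z → k = 1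
  quoric : ∃ (_ : MulAction (QTorus n) (MulAction.orbitRel.Quotient K (MomentAngle P)))
    (π : MulAction.orbitRel.Quotient K (MomentAngle P) → EuclideanSpace ℝ (Fin n)),
    (∀ z : MomentAngle P, π (Quotient.mk _ z) = z.1.2) ∧
    IsQuoricManifold P d (MulAction.orbitRel.Quotient K (MomentAngle P)) π

/-! ### Locally linear actions -/

section Twisted

variable {G V : Type*} [Group G] [AddCommGroup V] [Module ℝ V]

/-- The relation `(g h, v) ∼ (g, h v)`, `h ∈ H`, on `G × V`. -/
def twistedSetoid (H : Subgroup G) (ρ : Representation ℝ H V) : Setoid (G × V) where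
  r p q := ∃ h : H, p.1 = q.1 * (h : G) ∧ q.2 = ρ h p.2
  iseqv :=
    { refl := fun p => ⟨1, by simp, by simp⟩
      symm := by
        rintro p q ⟨h, h1, h2⟩
        refine ⟨h⁻¹, by simp [h1], ?_⟩
        rw [h2, ← Module.End.mul_apply, ← map_mul]
        simp
      trans := by
        rintro p q r ⟨h, h1, h2⟩ ⟨k, k1, k2⟩
        exact ⟨k * h, by simp [h1, k1, mul_assoc], by rw [k2, h2, map_mul]; rfl⟩ }

/-- The twisted product `G ×_H V`; it carries the quotient topology. -/
abbrev TwistedProduct (H : Subgroup G) (ρ : Representation ℝ H V) : Type _ :=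
  Quotient (twistedSetoid H ρ)

end Twisted

/-- The action of `G` on `N` is locally linear: around each point `y` there is a linear tube,
that is, a finite-dimensional real continuous representation `V` of the isotropy group `G_y` and
an open `G`-equivariant embedding `G ×_{G_y} V → N` that takes the class of `(1, 0)` to `y`. -/
def IsLocallyLinear (G N : Type*) [Group G] [TopologicalSpace G] [TopologicalSpace N]
    [MulAction G N] : Prop :=
  ∀ y : N, ∃ (k : ℕ)
    (ρ : Representation ℝ (MulAction.stabilizer G y) (EuclideanSpace ℝ (Fin k)))
    (φ : TwistedProduct (MulAction.stabilizer G y) ρ → N),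
    (Continuous fun p : MulAction.stabilizer G y × EuclideanSpace ℝ (Fin k) => ρ p.1 p.2) ∧
    Topology.IsOpenEmbedding φ ∧
    (∀ (a g : G) (v : EuclideanSpace ℝ (Fin k)),
      φ (Quotient.mk _ (a * g, v)) = a • φ (Quotient.mk _ (g, v))) ∧
    φ (Quotient.mk _ (1, 0)) = y

/-! ### Equivariant homotopy theory -/

section Equivariant

variable (G : Type*) {X Y : Type*} [Group G] [TopologicalSpace X] [TopologicalSpace Y]
  [MulAction G X] [MulAction G Y]

/-- `f` is `G`-equivariant. -/
def IsEquivariant (f : X → Y) : Prop := ∀ (a : G) (x : X), f (a • x) = a • f x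

/-- `f` and `g` are `G`-homotopic: there is a homotopy from `f` to `g` through `G`-equivariant
maps. -/
def EquivHomotopic (f g : C(X, Y)) : Prop :=
  ∃ F : ContinuousMap.Homotopy f g, ∀ t, IsEquivariant G fun x => F (t, x)

/-- `f` is a `G`-equivariant homotopy equivalence: it is equivariant and has an equivariant
inverse up to `G`-homotopy. -/
def IsEquivHomotopyEquiv (f : C(X, Y)) : Prop :=
  IsEquivariant G f ∧ ∃ g : C(Y, X), IsEquivariant G g ∧
    EquivHomotopic G (g.comp f) (ContinuousMap.id X) ∧
    EquivHomotopic G (f.comp g) (ContinuousMap.id Y)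

end Equivariant

end QuaternionicMA

end

open QuaternionicMA

/-! A quoric quotient of dimension 4 forces n = 1, so P is a segment with m = 2, and rescaling the
coordinates identifies its moment-angle manifold with the unit sphere of ℍ²
(`exists_homeomorph_sphere`). There the orbit space is an interval: interior orbits are free, and
over the two ends the isotropy groups are the two factors of Q². The proof finds the same structure
on Z and then compares sections of the orbit maps.

Let g be an equivariant homotopy inverse of f. If g' is homotopic to g, then g' ∘ f is homotopic to
the identity of a closed manifold, hence surjective (`surjective_of_homotopy_id`), so g' is
surjective. This fixes the slices of Z. At a free orbit the slice has dimension 1: dimension 0 would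
make the orbit all of the connected space Z, which has singular orbits, and in dimension at least 2
the map g, which traces only a curve in the slice, could be pushed off an orbit
(`IsFreeTube.exists_homotopic_not_surjective`). At a singular orbit in the closure of the free ones,
the isotropy group is therefore transitive on the directions of the slice (`exists_eq_smul_apply`),
and the orbit space is locally a half-line. With such charts an arc joining two singular orbits
meets every orbit (`exists_arc`), which yields a section s with the isotropy of the standard one
(`exists_section`).

An equivariant homotopy is determined by its values along s (`exists_equivariant_homotopy`). The
path f ∘ s runs from one coordinate axis of the sphere to the other, and since ℍ has dimension 4
there is room to straighten it to a projected segment while its ends stay on the axes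
(`exists_homotopyWith_sectionMap`). The equivariant extension of this deformation ends at a
bijection of compact Hausdorff spaces.

Surjectivity rests on a mod 2 degree that counts the simplices of a fine Kuhn triangulation whose
images surround a generic point near 0. It is invariant because the Kuhn simplices form a mod 2
cycle (`finsum_kuhnFace`) and because the number of facets around 0 is even for a generic
(d+1)-simplex mapped to dimension d (`sum_hullInd_compl`). Local homeomorphisms have odd degree
(`degree_openPartialHomeomorph`), so transverse zeros on a manifold can be counted mod 2, and this
parity survives small moves (`exists_transverse_close`). -/

namespace ModTwo

open Set Function

/-! ### The mod 2 chain of Kuhn simplices of the integer lattice is a cycle -/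

/-- The `j`-th vertex of the Kuhn simplex with base vertex `v` and direction order `π`. -/
def kuhnVertex {k : ℕ} (v : Fin k → ℤ) (π : Equiv.Perm (Fin k)) (j : Fin (k + 1)) : Fin k → ℤ :=
  fun c => v c + if (π.symm c : ℕ) < j then 1 else 0

lemma kuhnVertex_base_injective {k : ℕ} (π : Equiv.Perm (Fin k)) (j : Fin (k + 1)) :
    Injective fun v => kuhnVertex v π j := by
  intro v v' h
  funext c
  have := congrFun h c
  simpa [kuhnVertex] using this

lemma kuhnVertex_injective {k : ℕ} (v : Fin k → ℤ) (π : Equiv.Perm (Fin k)) :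
    Injective (kuhnVertex v π) := by
  have key : ∀ i j : Fin (k + 1), i < j → kuhnVertex v π i ≠ kuhnVertex v π j := by
    intro i j hij h
    have hik : (i : ℕ) < k := by omega
    have := congrFun h (π ⟨i, hik⟩)
    simp [kuhnVertex] at this
    omega
  intro i j h
  by_contra hne
  rcases lt_or_gt_of_ne hne with h' | h'
  · exact key _ _ h' h
  · exact key _ _ h' h.symm

/-- The codimension one faces of a Kuhn simplex, as tuples of vertices. -/
def kuhnFace {n : ℕ} (v : Fin (n + 1) → ℤ) (π : Equiv.Perm (Fin (n + 1))) (j : Fin (n + 2)) :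
    Fin (n + 1) → Fin (n + 1) → ℤ :=
  fun i => kuhnVertex v π (j.succAbove i)

/-- Vertex `i + 1` is the only one that sees in which order the directions at positions `i` and `i +
1` are added; once it is dropped, they may be exchanged. -/
lemma kuhnFace_swap {n : ℕ} (v : Fin (n + 1) → ℤ) (π : Equiv.Perm (Fin (n + 1))) (i : Fin n) :
    kuhnFace v (π * Equiv.swap i.castSucc i.succ) i.castSucc.succ =
      kuhnFace v π i.castSucc.succ := by
  funext l c
  simp only [kuhnFace, kuhnVertex, add_right_inj]
  have hl : ((i.castSucc.succ.succAbove l : Fin (n + 2)) : ℕ) ≠ i + 1 := by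
    intro h
    exact Fin.succAbove_ne i.castSucc.succ l (Fin.ext (by simpa using h))
  have hx : (π * Equiv.swap i.castSucc i.succ).symm c
      = Equiv.swap i.castSucc i.succ (π.symm c) := by
    rw [← Equiv.Perm.inv_def, mul_inv_rev]
    simp [Equiv.Perm.inv_def]
  rw [hx]
  generalize π.symm c = x
  generalize ((i.castSucc.succ.succAbove l : Fin (n + 2)) : ℕ) = m at hl
  congr 1
  rw [Equiv.swap_apply_def]
  split_ifs with h1 h2
  · subst h1; simp; omega
  · subst h2; simp; omega
  · rfl

/-- Dropping the first vertex gives a face of the next simplex, which starts one step along the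
first direction and adds that direction last. -/
lemma kuhnFace_rotate {n : ℕ} (v : Fin (n + 1) → ℤ) (π : Equiv.Perm (Fin (n + 1))) :
    kuhnFace (v + Pi.single (π 0) 1) (π * finRotate (n + 1)) (Fin.last _) = kuhnFace v π 0 := by
  funext l c
  have hx : (π * finRotate (n + 1)).symm c = (finRotate (n + 1)).symm (π.symm c) := by
    rw [← Equiv.Perm.inv_def, mul_inv_rev]
    simp [Equiv.Perm.inv_def]
  simp only [kuhnFace, kuhnVertex, hx]
  obtain ⟨x, rfl⟩ := π.surjective c
  simp only [Equiv.symm_apply_apply, Fin.succAbove_last, Fin.val_castSucc, Pi.add_apply,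
    Fin.zero_succAbove, Fin.val_succ]
  obtain ⟨z, rfl⟩ := (finRotate (n + 1)).surjective x
  simp only [Equiv.symm_apply_apply]
  have hl := l.2
  rcases eq_or_ne z (Fin.last n) with rfl | hz
  · simp; omega
  · have hz' : ((finRotate (n + 1) z : Fin (n + 1)) : ℕ) = z + 1 := coe_finRotate_of_ne_last hz
    have hne : π (finRotate (n + 1) z) ≠ π 0 := by
      intro h
      have := congrArg Fin.val (π.injective h)
      rw [hz'] at this
      simp at this
    rw [Pi.single_eq_of_ne hne, hz', add_zero]
    simp only [add_lt_add_iff_right]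

/-- Each face belongs to two simplices: `kuhnFace_swap` pairs the faces that omit an intermediate
vertex, and `kuhnFace_rotate` pairs first faces with last faces. Finite support is what allows the
sums to be exchanged. -/
theorem finsum_kuhnFace {n : ℕ} (w : (Fin (n + 1) → Fin (n + 1) → ℤ) → ZMod 2)
    (hw : ∀ π j, (support fun v => w (kuhnFace v π j)).Finite) :
    ∑ᶠ v, ∑ π, ∑ j, w (kuhnFace v π j) = 0 := by
  classical
  have h1 : ∑ᶠ v, ∑ π, ∑ j, w (kuhnFace v π j) = ∑ j, ∑ π, ∑ᶠ v, w (kuhnFace v π j) := by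
    rw [finsum_sum_comm]
    · rw [Finset.sum_comm]
      refine Finset.sum_congr rfl fun π _ => ?_
      rw [finsum_sum_comm]
      intro j _
      exact hw π j
    · intro π _
      have : (⋃ j, support fun v => w (kuhnFace v π j)).Finite := Set.finite_iUnion fun j => hw π j
      refine this.subset ?_
      intro v hv
      by_contra h
      simp only [mem_iUnion, mem_support, not_exists, not_not] at h
      exact hv (Finset.sum_eq_zero fun j _ => h j)
  rw [h1, Fin.sum_univ_succ, Fin.sum_univ_castSucc]
  have hmid : ∑ i : Fin n, ∑ π, ∑ᶠ v, w (kuhnFace v π i.castSucc.succ) = 0 := by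
    refine Finset.sum_eq_zero fun i _ => ?_
    refine Finset.sum_involution (fun π _ => π * Equiv.swap i.castSucc i.succ) ?_ ?_ ?_ ?_
    · intro π _
      simp only [kuhnFace_swap]
      exact CharTwo.add_self_eq_zero _
    · intro π _ _ h
      have := mul_eq_left.1 h
      have h2 := congrArg (fun e : Equiv.Perm _ => e i.castSucc) this
      simp at h2
      exact absurd h2 (by simp [Fin.ext_iff])
    · simp
    · intro π _
      simp [mul_assoc]
  have hends : ∑ π, ∑ᶠ v, w (kuhnFace v π 0) = ∑ π, ∑ᶠ v, w (kuhnFace v π (Fin.last n).succ) := by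
    rw [← Equiv.sum_comp (Equiv.mulRight (finRotate (n + 1)))
      (fun π => ∑ᶠ v, w (kuhnFace v π (Fin.last n).succ))]
    refine Finset.sum_congr rfl fun π _ => ?_
    rw [finsum_eq_of_bijective (fun v => v + Pi.single (π 0) (1 : ℤ))
      (Equiv.addRight _).bijective]
    intro v
    simp only [Equiv.coe_mulRight, Fin.succ_last]
    rw [kuhnFace_rotate]
  rw [hmid, zero_add, hends]
  exact CharTwo.add_self_eq_zero _

/-! ### The hull cocycle -/

section Hull

variable {E : Type*} [AddCommGroup E] [Module ℝ E]

open Classical in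
/-- The mod 2 indicator of `0` lying in the convex hull of `S`. -/
noncomputable def hullInd (S : Set E) : ZMod 2 := if 0 ∈ convexHull ℝ S then 1 else 0

lemma hullInd_of_mem {S : Set E} (h : 0 ∈ convexHull ℝ S) : hullInd S = 1 := if_pos h

lemma hullInd_of_notMem {S : Set E} (h : 0 ∉ convexHull ℝ S) : hullInd S = 0 := if_neg h

lemma mem_convexHull_image_iff {ι : Type*} [Fintype ι] (p : ι → E) (S : Set ι) (x : E) :
    x ∈ convexHull ℝ (p '' S) ↔
      ∃ w : ι → ℝ, (∀ i, 0 ≤ w i) ∧ ∑ i, w i = 1 ∧ ∑ i, w i • p i = x ∧ ∀ i, i ∉ S → w i = 0 := by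
  classical
  constructor
  · intro h
    have hsub : convexHull ℝ (p '' S) ⊆ {x | ∃ w : ι → ℝ, (∀ i, 0 ≤ w i) ∧ ∑ i, w i = 1 ∧
        ∑ i, w i • p i = x ∧ ∀ i, i ∉ S → w i = 0} := by
      refine convexHull_min ?_ ?_
      · rintro _ ⟨i, hi, rfl⟩
        refine ⟨Pi.single i 1, fun j => ?_, by simp, ?_, fun j hj => ?_⟩
        · by_cases h : j = i
          · subst h; simp
          · simp [h]
        · simp [Pi.single_apply]
        · exact Pi.single_eq_of_ne (fun h => hj (by rwa [h])) _
      · rintro _ ⟨u, hu0, hu1, rfl, hu2⟩ _ ⟨w, hw0, hw1, rfl, hw2⟩ a b ha hb hab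
        refine ⟨fun i => a * u i + b * w i, fun i => ?_, ?_, ?_, fun i hi => ?_⟩
        · have := hu0 i
          have := hw0 i
          positivity
        · rw [Finset.sum_add_distrib, ← Finset.mul_sum, ← Finset.mul_sum, hu1, hw1]
          simpa using hab
        · simp [add_smul, mul_smul, Finset.sum_add_distrib, Finset.smul_sum]
        · simp [hu2 i hi, hw2 i hi]
    exact hsub h
  · rintro ⟨w, h0, h1, rfl, h2⟩
    have h3 : ∑ i, w i • p i = ∑ i ∈ Finset.univ.filter (· ∈ S), w i • p i := by
      rw [Finset.sum_filter]
      refine Finset.sum_congr rfl fun i _ => ?_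
      split_ifs with h
      · rfl
      · simp [h2 i h]
    rw [h3]
    refine (convex_convexHull ℝ _).sum_mem (fun i _ => h0 i) ?_ ?_
    · rw [← h1, Finset.sum_filter]
      refine Finset.sum_congr rfl fun i _ => ?_
      split_ifs with h
      · rfl
      · simp [h2 i h]
    · intro i hi
      exact subset_convexHull ℝ _ ⟨i, by simpa using hi, rfl⟩

/-- The ratio test of linear programming: move from `w` along `μ` until the first coordinate reaches
zero. -/
lemma exists_hit {ι : Type*} [Fintype ι] (w μ : ι → ℝ) (hw : ∀ i, 0 ≤ w i) (hμ : ∃ i, μ i < 0) :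
    ∃ t : ℝ, 0 ≤ t ∧ (∀ i, 0 ≤ w i + t * μ i) ∧ ∃ i, μ i < 0 ∧ w i + t * μ i = 0 := by
  classical
  have hne : (Finset.univ.filter fun i => μ i < 0).Nonempty := by
    obtain ⟨i, hi⟩ := hμ
    exact ⟨i, by simpa using hi⟩
  obtain ⟨i, hi, hmin⟩ := Finset.exists_min_image _ (fun i => w i / (-μ i)) hne
  simp only [Finset.mem_filter, Finset.mem_univ, true_and] at hi hmin
  refine ⟨w i / (-μ i), div_nonneg (hw i) (by linarith), fun j => ?_, i, hi, ?_⟩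
  · rcases lt_or_ge (μ j) 0 with hj | hj
    · have h1 := hmin j hj
      rw [le_div_iff₀ (by linarith)] at h1
      linarith
    · have : 0 ≤ w i / (-μ i) := div_nonneg (hw i) (by linarith)
      have := hw j
      positivity
  · have : μ i ≠ 0 := hi.ne
    field_simp
    ring

/-- The ways to write 0 as a convex combination of the points form a compact convex set. In general
position it is empty or a segment, each end has exactly one vanishing weight, and the two vanishing
weights differ. So zero or two of the facets contain 0. -/
theorem sum_hullInd_compl [FiniteDimensional ℝ E] {ι : Type*} [Fintype ι] [DecidableEq ι]
    (p : ι → E) (hcard : Module.finrank ℝ E + 2 = Fintype.card ι)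
    (hgen : ∀ i j, i ≠ j → 0 ∉ convexHull ℝ (p '' {i, j}ᶜ)) :
    ∑ j, hullInd (p '' {j}ᶜ) = 0 := by
  have gen : ∀ w : ι → ℝ, (∀ i, 0 ≤ w i) → ∑ i, w i = 1 → ∑ i, w i • p i = 0 →
      ∀ i j, w i = 0 → w j = 0 → i = j := by
    intro w h0 h1 h2 i j hi hj
    by_contra hij
    refine hgen i j hij ((mem_convexHull_image_iff p _ 0).2 ⟨w, h0, h1, h2, fun l hl => ?_⟩)
    simp only [mem_compl_iff, not_not, mem_insert_iff, mem_singleton_iff] at hl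
    rcases hl with rfl | rfl <;> assumption
  have hJ : ∀ j, 0 ∈ convexHull ℝ (p '' {j}ᶜ) ↔ ∃ w : ι → ℝ, (∀ i, 0 ≤ w i) ∧ ∑ i, w i = 1 ∧
      ∑ i, w i • p i = 0 ∧ w j = 0 := by
    intro j
    rw [mem_convexHull_image_iff]
    simp
  have move : ∀ (w μ : ι → ℝ) (t : ℝ), ∑ i, w i = 1 → ∑ i, w i • p i = 0 → ∑ i, μ i = 0 →
      ∑ i, μ i • p i = 0 → ∑ i, (w i + t * μ i) = 1 ∧ ∑ i, (w i + t * μ i) • p i = 0 := by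
    intro w μ t h1 h2 h3 h4
    constructor
    · rw [Finset.sum_add_distrib, ← Finset.mul_sum, h1, h3]; simp
    · simp only [add_smul, mul_smul]
      rw [Finset.sum_add_distrib, ← Finset.smul_sum, h2, h4]; simp
  have neg : ∀ μ : ι → ℝ, μ ≠ 0 → ∑ i, μ i = 0 → ∃ i, μ i < 0 := by
    intro μ h h'
    by_contra! hc
    refine h (funext fun i => ?_)
    exact (Finset.sum_eq_zero_iff_of_nonneg fun i _ => hc i).1 h' i (Finset.mem_univ i)
  -- Once a facet contains 0, an affine dependency that vanishes at its missing index is trivial: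
  -- moving along it would make a second weight vanish. Hence the dependencies form a line.
  have ker : ∀ w : ι → ℝ, (∀ i, 0 ≤ w i) → ∑ i, w i = 1 → ∑ i, w i • p i = 0 → ∀ a, w a = 0 →
      ∀ μ : ι → ℝ, ∑ i, μ i = 0 → ∑ i, μ i • p i = 0 → μ a = 0 → μ = 0 := by
    intro w h0 h1 h2 a ha μ h3 h4 hμa
    by_contra hne
    obtain ⟨t, -, ht, i, hi, hti⟩ := exists_hit w μ h0 (neg μ hne h3)
    obtain ⟨m1, m2⟩ := move w μ t h1 h2 h3 h4
    have := gen (fun i => w i + t * μ i) ht m1 m2 i a hti (by simp [ha, hμa])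
    subst this
    linarith
  obtain ⟨μ, hμ1, hμ2, hμ⟩ : ∃ μ : ι → ℝ, ∑ i, μ i = 0 ∧ ∑ i, μ i • p i = 0 ∧ μ ≠ 0 := by
    let T : (ι → ℝ) →ₗ[ℝ] ℝ × E :=
      { toFun := fun w => (∑ i, w i, ∑ i, w i • p i)
        map_add' := fun u w => by simp [Finset.sum_add_distrib, add_smul]
        map_smul' := fun c u => by simp [Finset.mul_sum, Finset.smul_sum, mul_smul] }
    have : T.ker ≠ ⊥ := LinearMap.ker_ne_bot_of_finrank_lt (by simp; omega)
    obtain ⟨μ, hμ, h0⟩ := Submodule.exists_mem_ne_zero_of_ne_bot this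
    have h1 : (∑ i, μ i, ∑ i, μ i • p i) = ((0 : ℝ), (0 : E)) := hμ
    exact ⟨μ, (Prod.ext_iff.1 h1).1, (Prod.ext_iff.1 h1).2, h0⟩
  classical
  have hsum : ∑ j, hullInd (p '' {j}ᶜ)
      = ((Finset.univ.filter fun j => (0 : E) ∈ convexHull ℝ (p '' {j}ᶜ)).card : ZMod 2) := by
    rw [Finset.card_filter]
    push_cast
    refine Finset.sum_congr rfl fun j _ => ?_
    unfold hullInd
    split_ifs <;> simp
  rw [hsum]
  set J := Finset.univ.filter fun j => (0 : E) ∈ convexHull ℝ (p '' {j}ᶜ) with hJdef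
  have memJ : ∀ j, j ∈ J ↔ ∃ w : ι → ℝ, (∀ i, 0 ≤ w i) ∧ ∑ i, w i = 1 ∧
      ∑ i, w i • p i = 0 ∧ w j = 0 := fun j => by rw [← hJ]; simp [hJdef]
  rcases J.eq_empty_or_nonempty with h | ⟨a, ha⟩
  · simp [h]
  obtain ⟨wa, a0, a1, a2, a3⟩ := (memJ a).1 ha
  -- The other end of the segment: leave `wa` in the direction that makes the weight at `a` positive
  -- and stop at the next vanishing weight.
  have hb : ∃ b ∈ J, b ≠ a := by
    have hμa : μ a ≠ 0 := fun h => hμ (ker wa a0 a1 a2 a a3 μ hμ1 hμ2 h)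
    obtain ⟨ν, hν1, hν2, hνa⟩ : ∃ ν : ι → ℝ, ∑ i, ν i = 0 ∧ ∑ i, ν i • p i = 0 ∧ 0 < ν a := by
      rcases lt_or_gt_of_ne hμa with h | h
      · exact ⟨fun i => -μ i, by simp [hμ1], by simp [hμ2], by simpa using h⟩
      · exact ⟨μ, hμ1, hμ2, h⟩
    obtain ⟨t, -, ht, i, hi, hti⟩ := exists_hit wa ν a0
      (neg ν (fun h => by simp [h] at hνa) hν1)
    obtain ⟨m1, m2⟩ := move wa ν t a1 a2 hν1 hν2
    refine ⟨i, (memJ i).2 ⟨_, ht, m1, m2, hti⟩, ?_⟩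
    rintro rfl
    linarith
  obtain ⟨b, hb, hba⟩ := hb
  obtain ⟨wb, b0, b1, b2, b3⟩ := (memJ b).1 hb
  have hJab : J = {a, b} := by
    refine Finset.Subset.antisymm (fun c hc => ?_) (by
      intro x hx; simp only [Finset.mem_insert, Finset.mem_singleton] at hx
      rcases hx with rfl | rfl <;> assumption)
    by_contra hcab
    simp only [Finset.mem_insert, Finset.mem_singleton, not_or] at hcab
    obtain ⟨wc, c0, c1, c2, c3⟩ := (memJ c).1 hc
    have pos : ∀ w : ι → ℝ, (∀ i, 0 ≤ w i) → ∑ i, w i = 1 → ∑ i, w i • p i = 0 →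
        ∀ i, w i = 0 → ∀ j, j ≠ i → 0 < w j := by
      intro w h0 h1 h2 i hi j hj
      exact lt_of_le_of_ne (h0 j) fun h => hj (gen w h0 h1 h2 j i h.symm hi)
    have hba' := pos wb b0 b1 b2 b b3 a hba.symm
    have hca' := pos wc c0 c1 c2 c c3 a (Ne.symm hcab.1)
    -- The combination of the two differences that vanishes at `a`, so it vanishes everywhere. Its
    -- values at `b` and at `c` then give opposite signs to `wb a - wc a`.
    have hz := ker wa a0 a1 a2 a a3 (fun i => wc a * (wb i - wa i) - wb a * (wc i - wa i))
      (by simp only [Finset.sum_sub_distrib, ← Finset.mul_sum, a1, b1, c1]; ring)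
      (by simp only [sub_smul, mul_smul, Finset.sum_sub_distrib, ← Finset.smul_sum, a2, b2, c2]
          simp)
      (by simp [a3]; ring)
    have hzb := congrFun hz b
    have hzc := congrFun hz c
    have hab' := pos wa a0 a1 a2 a a3 b hba
    have hac' := pos wa a0 a1 a2 a a3 c hcab.1
    have hbc' := pos wb b0 b1 b2 b b3 c hcab.2
    have hcb' := pos wc c0 c1 c2 c c3 b (Ne.symm hcab.2)
    simp only [b3, c3, Pi.zero_apply] at hzb hzc
    rcases le_total (wc a) (wb a) with h | h
    · nlinarith [mul_pos hca' hbc', mul_nonneg (sub_nonneg.2 h) hac'.le]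
    · nlinarith [mul_pos hba' hcb', mul_nonneg (sub_nonneg.2 h) hab'.le]
  rw [hJab, Finset.card_pair hba.symm]
  decide

end Hull

end ModTwo

namespace ModTwo

open Set Function Filter Topology MeasureTheory
open scoped Pointwise

/-! ### Invariance of the count of simplices around the origin -/

section Count

variable {n : ℕ}

/-- The Euclidean space of dimension `n + 1`. -/
abbrev Euc (n : ℕ) : Type := EuclideanSpace ℝ (Fin (n + 1))

/-- The origin is not a convex combination of at most `n + 1` points of `Q`. -/
def Generic (Q : Set (Euc n)) : Prop :=
  ∀ T : Finset (Euc n), ↑T ⊆ Q → T.card ≤ n + 1 → (0 : Euc n) ∉ convexHull ℝ (T : Set (Euc n))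

lemma Generic.mono {Q R : Set (Euc n)} (h : Generic R) (hQR : Q ⊆ R) : Generic Q :=
  fun T hT => h T (hT.trans hQR)

/-- Whether the image of a Kuhn simplex under the vertex map `a` surrounds the origin. -/
noncomputable def cell (a : (Fin (n + 1) → ℤ) → Euc n) (v : Fin (n + 1) → ℤ)
    (π : Equiv.Perm (Fin (n + 1))) : ZMod 2 :=
  hullInd (range fun j => a (kuhnVertex v π j))

lemma cell_congr {a b : (Fin (n + 1) → ℤ) → Euc n} {v : Fin (n + 1) → ℤ}
    {π : Equiv.Perm (Fin (n + 1))} (h : ∀ j, a (kuhnVertex v π j) = b (kuhnVertex v π j)) :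
    cell a v π = cell b v π := by
  unfold cell
  simp only [h]

lemma finite_touching {X : Set (Fin (n + 1) → ℤ)} (hX : X.Finite) :
    {v | ∃ π j, kuhnVertex v π j ∈ X}.Finite := by
  have : {v | ∃ π j, kuhnVertex v π j ∈ X} = ⋃ π, ⋃ j, (fun v => kuhnVertex v π j) ⁻¹' X := by
    ext v; simp
  rw [this]
  exact finite_iUnion fun π => finite_iUnion fun j =>
    hX.preimage (kuhnVertex_base_injective π j).injOn

lemma support_cell_add_finite {a b : (Fin (n + 1) → ℤ) → Euc n} (hab : {v | a v ≠ b v}.Finite) :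
    (support fun v => ∑ π, (cell a v π + cell b v π)).Finite := by
  refine (finite_touching hab).subset fun v hv => ?_
  by_contra hc
  simp only [mem_ofPred_eq, not_exists, not_not] at hc
  refine hv (Finset.sum_eq_zero fun π _ => ?_)
  rw [cell_congr fun j => hc π j]
  exact CharTwo.add_self_eq_zero _

/-- For a simplex with vertex `u`, add the new position `b u` to its `n + 2` image points. By
`sum_hullInd_compl` the change of its indicator is the sum over its faces through `u`, each coned
off to `b u`; these contributions cancel globally by `finsum_kuhnFace`. -/
lemma finsum_cell_add_of_ne_at {a b : (Fin (n + 1) → ℤ) → Euc n} (u : Fin (n + 1) → ℤ)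
    (hab : ∀ v, v ≠ u → a v = b v) (hgen : Generic (range a ∪ range b)) :
    ∑ᶠ v, ∑ π, (cell a v π + cell b v π) = 0 := by
  classical
  -- Only faces through `u` count; the opposite face, coned off to `b u`, is the image of the
  -- simplex under `b`.
  let w : (Fin (n + 1) → Fin (n + 1) → ℤ) → ZMod 2 := fun c =>
    if u ∈ range c then hullInd (insert (b u) (a '' range c)) else 0
  have hw : ∀ π j, (support fun v => w (kuhnFace v π j)).Finite := by
    intro π j
    refine (finite_touching (finite_singleton u)).subset fun v hv => ?_
    by_contra hc
    simp only [mem_ofPred_eq, not_exists, mem_singleton_iff] at hc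
    refine hv (if_neg ?_)
    rintro ⟨i, hi⟩
    exact hc π _ hi
  rw [← finsum_kuhnFace w hw]
  congr 1
  funext v
  refine Finset.sum_congr rfl fun π _ => ?_
  by_cases hu : ∃ j0, kuhnVertex v π j0 = u
  · obtain ⟨j0, hj0⟩ := hu
    let p : Option (Fin (n + 2)) → Euc n := fun o => o.elim (b u) fun j => a (kuhnVertex v π j)
    have hD := sum_hullInd_compl p (by simp) (by
      intro i j hij
      have hcard : ((({i, j} : Finset (Option (Fin (n + 2))))ᶜ).image p).card ≤ n + 1 := by
        refine Finset.card_image_le.trans ?_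
        rw [Finset.card_compl, Finset.card_pair hij]
        simp
      have := hgen _ (by
        intro x hx
        simp only [Finset.coe_image, mem_image] at hx
        obtain ⟨o, -, rfl⟩ := hx
        cases o with
        | none => exact Or.inr ⟨u, rfl⟩
        | some j => exact Or.inl ⟨_, rfl⟩) hcard
      rwa [Finset.coe_image, Finset.coe_compl, Finset.coe_pair] at this)
    rw [Fintype.sum_option] at hD
    have h0 : p '' {none}ᶜ = range fun j => a (kuhnVertex v π j) := by
      ext x
      constructor
      · rintro ⟨o, ho, rfl⟩
        cases o with
        | none => exact absurd rfl ho
        | some j => exact ⟨j, rfl⟩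
      · rintro ⟨j, rfl⟩
        exact ⟨some j, by simp, rfl⟩
    have h1 : ∀ j, p '' {some j}ᶜ = insert (b u) (a '' range (kuhnFace v π j)) := by
      intro j
      ext x
      constructor
      · rintro ⟨o, ho, rfl⟩
        cases o with
        | none => exact Or.inl rfl
        | some i =>
          have hij : i ≠ j := by simpa using ho
          obtain ⟨l, rfl⟩ := Fin.exists_succAbove_eq hij
          exact Or.inr ⟨_, ⟨l, rfl⟩, rfl⟩
      · rintro (rfl | ⟨_, ⟨l, rfl⟩, rfl⟩)
        · exact ⟨none, by simp, rfl⟩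
        · exact ⟨some (j.succAbove l), by simp [Fin.succAbove_ne], rfl⟩
    have h2 : hullInd (p '' {some j0}ᶜ) = cell b v π := by
      rw [h1, cell]
      congr 1
      ext x
      constructor
      · rintro (rfl | ⟨_, ⟨l, rfl⟩, rfl⟩)
        · exact ⟨j0, by simp only [hj0]⟩
        · refine ⟨j0.succAbove l, (hab _ fun h => ?_).symm⟩
          exact Fin.succAbove_ne j0 l (kuhnVertex_injective v π (h.trans hj0.symm))
      · rintro ⟨j, rfl⟩
        by_cases hj : j = j0
        · left; simp only [hj, hj0]
        · obtain ⟨l, rfl⟩ := Fin.exists_succAbove_eq hj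
          refine Or.inr ⟨_, ⟨l, rfl⟩, hab _ fun h => ?_⟩
          exact Fin.succAbove_ne j0 l (kuhnVertex_injective v π (h.trans hj0.symm))
    have h3 : w (kuhnFace v π j0) = 0 := by
      refine if_neg ?_
      rintro ⟨l, hl⟩
      exact Fin.succAbove_ne j0 l (kuhnVertex_injective v π (hl.trans hj0.symm))
    have h4 : ∀ j, j ≠ j0 → w (kuhnFace v π j) = hullInd (p '' {some j}ᶜ) := by
      intro j hj
      rw [h1]
      refine if_pos ?_
      obtain ⟨l, hl⟩ := Fin.exists_succAbove_eq hj.symm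
      exact ⟨l, by rw [← hj0, ← hl]; rfl⟩
    rw [← Finset.add_sum_erase _ _ (Finset.mem_univ j0), h2, h0] at hD
    rw [← Finset.add_sum_erase _ _ (Finset.mem_univ j0), h3, zero_add]
    rw [Finset.sum_congr rfl fun j hj => h4 j (Finset.ne_of_mem_erase hj)]
    rw [← add_assoc, add_eq_zero_iff_eq_neg, CharTwo.neg_eq] at hD
    exact hD
  · push Not at hu
    rw [cell_congr fun j => hab _ (hu j), CharTwo.add_self_eq_zero]
    symm
    refine Finset.sum_eq_zero fun j _ => if_neg ?_
    rintro ⟨l, hl⟩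
    exact hu _ hl

/-- Pass from `a` to `b` one vertex at a time; every intermediate map takes its values among those
of `a` and `b`, so genericity persists. -/
theorem finsum_cell_add {a b : (Fin (n + 1) → ℤ) → Euc n} (hab : {v | a v ≠ b v}.Finite)
    (hgen : Generic (range a ∪ range b)) : ∑ᶠ v, ∑ π, (cell a v π + cell b v π) = 0 := by
  classical
  let c : Finset (Fin (n + 1) → ℤ) → (Fin (n + 1) → ℤ) → Euc n := fun X v =>
    if v ∈ X then b v else a v
  have hcr : ∀ X, range (c X) ⊆ range a ∪ range b := by
    rintro X _ ⟨v, rfl⟩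
    by_cases h : v ∈ X
    · right; exact ⟨v, by simp [c, h]⟩
    · left; exact ⟨v, by simp [c, h]⟩
  have key : ∀ X, ∑ᶠ v, ∑ π, (cell a v π + cell (c X) v π) = 0 := by
    intro X
    induction X using Finset.induction_on with
    | empty =>
      have : c ∅ = a := by funext v; simp [c]
      simp [this, CharTwo.add_self_eq_zero]
    | insert u X hu ih =>
      have h1 : ∑ᶠ v, ∑ π, (cell (c X) v π + cell (c (insert u X)) v π) = 0 := by
        refine finsum_cell_add_of_ne_at u (fun v hv => ?_)
          (hgen.mono (union_subset (hcr _) (hcr _)))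
        simp [c, hv]
      have h2 := finsum_add_distrib (f := fun v => ∑ π, (cell a v π + cell (c X) v π))
        (g := fun v => ∑ π, (cell (c X) v π + cell (c (insert u X)) v π))
        (support_cell_add_finite (X.finite_toSet.subset fun v hv => by
          by_contra h
          exact hv (by simp [c, show v ∉ X from h])))
        (support_cell_add_finite ((finite_singleton u).subset fun v hv => by
          by_contra h
          exact hv (by simp [c, show v ≠ u from h])))
      rw [h1, ih, add_zero] at h2
      rw [← h2]
      congr 1
      funext v
      rw [← Finset.sum_add_distrib]
      refine Finset.sum_congr rfl fun π _ => ?_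
      rw [add_assoc, ← add_assoc (cell (c X) v π), CharTwo.add_self_eq_zero, zero_add]
  have := key hab.toFinset
  have hc : c hab.toFinset = b := by
    funext v
    by_cases h : a v = b v
    · simp [c, h]
    · simp [c, h]
  rwa [hc] at this

open Classical in
/-- The number mod 2 of Kuhn simplices with all vertices in `X` whose image under `a` surrounds
the origin. -/
noncomputable def cellCount (a : (Fin (n + 1) → ℤ) → Euc n) (X : Set (Fin (n + 1) → ℤ)) :
    ZMod 2 :=
  ∑ᶠ v, ∑ π, if ∀ j, kuhnVertex v π j ∈ X then cell a v π else 0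

open Classical in
lemma support_cellCount_finite (a : (Fin (n + 1) → ℤ) → Euc n) {X : Set (Fin (n + 1) → ℤ)}
    (hX : X.Finite) :
    (support fun v => ∑ π, if ∀ j, kuhnVertex v π j ∈ X then cell a v π else 0).Finite := by
  refine (finite_touching hX).subset fun v hv => ?_
  by_contra hc
  simp only [mem_ofPred_eq, not_exists] at hc
  refine hv (Finset.sum_eq_zero fun π _ => if_neg fun h => hc π 0 (h 0))

/-- Replace `a` by `b` on the deep set `Y` only. This changes finitely many vertices and no simplex
that leaves `X`, while simplices of `X` that leave `Y` contribute nothing for `a`, for `b` or for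
the mixture. -/
theorem cellCount_eq_of_deep {a b : (Fin (n + 1) → ℤ) → Euc n} {X Y : Set (Fin (n + 1) → ℤ)}
    (hX : X.Finite) (hgen : Generic (range a ∪ range b))
    (hYX : ∀ v π, (∃ j, kuhnVertex v π j ∈ Y) → ∀ j, kuhnVertex v π j ∈ X)
    (havoid : ∀ v π, (∀ j, kuhnVertex v π j ∈ X) → (∃ j, kuhnVertex v π j ∉ Y) →
      (0 : Euc n) ∉ convexHull ℝ ((range fun j => a (kuhnVertex v π j)) ∪
        range fun j => b (kuhnVertex v π j))) :
    cellCount a X = cellCount b X := by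
  classical
  let c : (Fin (n + 1) → ℤ) → Euc n := fun v => if v ∈ Y then b v else a v
  have hYX' : Y ⊆ X := by
    intro v hv
    have hv0 : kuhnVertex v 1 0 = v := by funext i; simp [kuhnVertex]
    have := hYX v 1 ⟨0, by rwa [hv0]⟩ 0
    rwa [hv0] at this
  have hac : {v | a v ≠ c v}.Finite := hX.subset fun v hv => by
    by_contra h
    exact hv (by simp only [c, if_neg fun h' => h (hYX' h')])
  have hcr : range c ⊆ range a ∪ range b := by
    rintro _ ⟨v, rfl⟩
    by_cases h : v ∈ Y
    · right; exact ⟨v, by simp [c, h]⟩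
    · left; exact ⟨v, by simp [c, h]⟩
  have h1 := finsum_cell_add hac (hgen.mono (union_subset subset_union_left hcr))
  have h2 := finsum_add_distrib (support_cellCount_finite a hX) (support_cellCount_finite b hX)
  have h3 : ∀ v π, cell a v π + cell c v π = (if ∀ j, kuhnVertex v π j ∈ X then cell a v π else 0)
      + if ∀ j, kuhnVertex v π j ∈ X then cell b v π else 0 := by
    intro v π
    by_cases hs : ∀ j, kuhnVertex v π j ∈ X
    · rw [if_pos hs, if_pos hs]
      congr 1
      by_cases hY : ∀ j, kuhnVertex v π j ∈ Y
      · exact cell_congr fun j => by simp [c, hY j]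
      · push Not at hY
        have h0 := havoid v π hs hY
        have hb : cell b v π = 0 :=
          hullInd_of_notMem fun h => h0 (convexHull_mono subset_union_right h)
        have hc : cell c v π = 0 := by
          refine hullInd_of_notMem fun h => h0 (convexHull_mono ?_ h)
          rintro _ ⟨j, rfl⟩
          by_cases hj : kuhnVertex v π j ∈ Y
          · right; exact ⟨j, by simp [c, hj]⟩
          · left; exact ⟨j, by simp [c, hj]⟩
        rw [hb, hc]
    · rw [if_neg hs, if_neg hs, add_zero]
      have : ∀ j, a (kuhnVertex v π j) = c (kuhnVertex v π j) := by
        intro j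
        have : kuhnVertex v π j ∉ Y := fun h => hs (hYX v π ⟨j, h⟩)
        simp [c, this]
      rw [cell_congr this, CharTwo.add_self_eq_zero]
  simp only [h3, Finset.sum_add_distrib] at h1
  rw [h1] at h2
  have h4 : cellCount a X + cellCount b X = 0 := h2.symm
  rwa [add_eq_zero_iff_eq_neg, CharTwo.neg_eq] at h4

/-! ### Generic translations -/

lemma volume_convexHull_eq_zero (T : Finset (Euc n)) (hT : T.card ≤ n + 1) :
    volume (convexHull ℝ (T : Set (Euc n))) = 0 := by
  refine measure_mono_null (convexHull_subset_affineSpan _) ?_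
  refine Measure.addHaar_affineSubspace _ _ fun h => ?_
  have h1 : vectorSpan ℝ (T : Set (Euc n)) = ⊤ := by
    rw [← direction_affineSpan, h, AffineSubspace.direction_top]
  rcases T.eq_empty_or_nonempty with rfl | hne
  · simp at h1
  · have h2 := finrank_vectorSpan_image_finset_le ℝ (id : Euc n → Euc n) T
      (n := T.card - 1) (by have := hne.card_pos; omega)
    rw [Finset.coe_image, image_id, h1] at h2
    simp at h2
    have := hne.card_pos
    omega

/-- Bad translations lie in countably many hulls of at most `n + 1` points, each null because it
spans a proper affine subspace. -/
lemma ae_generic {Q : Set (Euc n)} (hQ : Q.Countable) :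
    ∀ᵐ y : Euc n, Generic ((fun x => x - y) '' Q) := by
  classical
  have hc : {T : Finset (Euc n) | ↑T ⊆ Q}.Countable := by
    have : Countable Q := hQ
    have h2 : (range fun T : Finset Q => T.map (Embedding.subtype _)).Countable :=
      countable_range _
    refine h2.mono fun T hT => ?_
    exact ⟨T.subtype (· ∈ Q), Finset.subtype_map_of_mem fun x hx => hT hx⟩
  have h1 : ∀ᵐ y : Euc n, ∀ T ∈ {T : Finset (Euc n) | ↑T ⊆ Q}, T.card ≤ n + 1 →
      y ∉ convexHull ℝ (T : Set (Euc n)) := by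
    rw [ae_ball_iff hc]
    intro T _
    by_cases hT : T.card ≤ n + 1
    · filter_upwards [measure_eq_zero_iff_ae_notMem.1 (volume_convexHull_eq_zero T hT)] with y hy _
      exact hy
    · exact Eventually.of_forall fun y h => absurd h hT
  filter_upwards [h1] with y hy T hT hcard h0
  refine hy (T.image (· + y)) ?_ (Finset.card_image_le.trans hcard) ?_
  · intro x hx
    simp only [Finset.coe_image, mem_image] at hx
    obtain ⟨z, hz, rfl⟩ := hx
    obtain ⟨q, hq, rfl⟩ := hT hz
    simpa using hq
  · have : ((T.image (· + y) : Finset (Euc n)) : Set (Euc n)) = y +ᵥ (T : Set (Euc n)) := by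
      rw [Finset.coe_image, ← image_vadd]
      refine image_congr fun x _ => ?_
      rw [vadd_eq_add, add_comm]
    rw [this, convexHull_vadd]
    exact ⟨0, h0, by simp⟩

end Count

end ModTwo

namespace ModTwo

open Set Function Filter Topology MeasureTheory
open scoped Pointwise

/-! ### The mod 2 degree on open subsets of Euclidean space -/

section Degree

variable {n : ℕ}

/-- The points of the cubical grid of mesh `h`. -/
noncomputable def gridPt (h : ℝ) (v : Fin (n + 1) → ℤ) : Euc n := WithLp.toLp 2 fun i => h * v i

/-- The number mod 2 of Kuhn simplices of mesh `h` inside `Ω` whose image under `g` surrounds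
the point `y`. -/
noncomputable def count (g : Euc n → Euc n) (Ω : Set (Euc n)) (h : ℝ) (y : Euc n) : ZMod 2 :=
  cellCount (fun v => g (gridPt h v) - y) (gridPt h ⁻¹' Ω)

lemma dist_gridPt_kuhnVertex_le {h : ℝ} (hh : 0 < h) (v : Fin (n + 1) → ℤ)
    (π : Equiv.Perm (Fin (n + 1))) (i j : Fin (n + 2)) :
    dist (gridPt h (kuhnVertex v π i)) (gridPt h (kuhnVertex v π j)) ≤ h * (n + 1) := by
  have hc : ∀ c, dist ((gridPt h (kuhnVertex v π i)) c) ((gridPt h (kuhnVertex v π j)) c) ^ 2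
      ≤ h ^ 2 := by
    intro c
    refine pow_le_pow_left₀ dist_nonneg ?_ 2
    simp only [gridPt, kuhnVertex, Real.dist_eq]
    rw [abs_le]
    push_cast
    split_ifs <;> constructor <;> nlinarith
  rw [EuclideanSpace.dist_eq]
  refine Real.sqrt_le_iff.2 ⟨by positivity, ?_⟩
  refine (Finset.sum_le_sum fun c _ => hc c).trans ?_
  simp only [Finset.sum_const, Finset.card_univ, Fintype.card_fin, nsmul_eq_mul]
  push_cast
  have : (0 : ℝ) ≤ n := Nat.cast_nonneg n
  nlinarith [mul_nonneg (sq_nonneg h) this, mul_nonneg (mul_nonneg (sq_nonneg h) this) this]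

lemma finite_gridPt_preimage {h : ℝ} (hh : 0 < h) {Ω : Set (Euc n)} (hΩ : Bornology.IsBounded Ω) :
    (gridPt h ⁻¹' Ω).Finite := by
  obtain ⟨C, hC⟩ := hΩ.exists_norm_le
  refine (Set.finite_Icc (fun _ : Fin (n + 1) => -⌈C / h⌉) (fun _ => ⌈C / h⌉)).subset ?_
  intro v hv
  have h1 : ∀ i, |(v i : ℝ)| ≤ ⌈C / h⌉ := by
    intro i
    have h2 := (PiLp.norm_apply_le (gridPt h v) i).trans (hC _ hv)
    simp only [gridPt, Real.norm_eq_abs, abs_mul, abs_of_pos hh] at h2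
    refine le_trans ?_ (Int.le_ceil _)
    rw [le_div_iff₀ hh]
    linarith
  constructor
  · intro i
    have := (abs_le.1 (h1 i)).1
    exact_mod_cast this
  · intro i
    have := (abs_le.1 (h1 i)).2
    exact_mod_cast this

/-- The ball around `x` is connected; if it missed the frontier, the interior and the exterior of
`Ω` would separate `x` from `z`. -/
lemma exists_frontier_dist_lt {Ω : Set (Euc n)} {x z : Euc n} {r : ℝ} (hx : x ∈ Ω) (hz : z ∉ Ω)
    (hxz : dist z x < r) : ∃ x0 ∈ frontier Ω, dist x x0 < r := by
  have hr : 0 < r := dist_nonneg.trans_lt hxz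
  have hconn : IsPreconnected (Metric.ball x r) := (convex_ball x r).isPreconnected
  by_contra! hc
  have hfr : ∀ y ∈ Metric.ball x r, y ∉ frontier Ω := fun y hy hyf =>
    absurd (hc y hyf) (by rw [not_le, dist_comm]; exact hy)
  obtain ⟨y, -, hy1, hy2⟩ := hconn (interior Ω) (closure Ω)ᶜ isOpen_interior
    isClosed_closure.isOpen_compl (fun y hy => by
      by_contra h
      rw [mem_union, not_or, mem_compl_iff, not_not] at h
      exact hfr y hy ⟨h.2, h.1⟩)
    ⟨x, Metric.mem_ball_self hr, by
      by_contra h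
      exact hfr x (Metric.mem_ball_self hr) ⟨subset_closure hx, h⟩⟩
    ⟨z, hxz, fun h => hfr z hxz ⟨h, fun h' => hz (interior_subset h')⟩⟩
  exact hy2 (subset_closure (interior_subset hy1))

lemma zero_notMem_convexHull_of_ball {S : Set (Euc n)} {c : Euc n} {r : ℝ}
    (hS : ∀ x ∈ S, dist x c < r) (hr : r ≤ ‖c‖) : (0 : Euc n) ∉ convexHull ℝ S := by
  intro h
  have : (0 : Euc n) ∈ Metric.ball c r := convexHull_min (fun x hx => hS x hx) (convex_ball c r) h
  rw [Metric.mem_ball, dist_zero_left] at this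
  linarith

/-- Near the frontier the values of `g` and `g'` on a simplex lie in one ball that misses 0, so such
simplices do not count and `cellCount_eq_of_deep` applies. Half of the margin `μ` pays for the
oscillation, the other half for the shift by `y`. -/
theorem count_eq_of_close {g g' : Euc n → Euc n} {Ω : Set (Euc n)} (hΩ : Bornology.IsBounded Ω)
    {ρ μ : ℝ} (hclose : ∀ x ∈ frontier Ω, ‖g x - g' x‖ + μ ≤ ‖g x‖)
    (hg : ∀ x ∈ Ω, ∀ x0 ∈ frontier Ω, dist x x0 < 2 * ρ → dist (g x) (g x0) < μ / 2)
    (hg' : ∀ x ∈ Ω, ∀ x0 ∈ frontier Ω, dist x x0 < 2 * ρ → dist (g' x) (g' x0) < μ / 2)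
    {h : ℝ} (hh : 0 < h) (hhρ : h * (n + 1) < ρ) {y : Euc n} (hy : ‖y‖ ≤ μ / 2)
    (hgen : Generic (range (fun v => g (gridPt h v) - y) ∪ range fun v => g' (gridPt h v) - y)) :
    count g Ω h y = count g' Ω h y := by
  refine cellCount_eq_of_deep (Y := {v | Metric.ball (gridPt h v) ρ ⊆ Ω})
    (finite_gridPt_preimage hh hΩ) hgen ?_ ?_
  · rintro v π ⟨j, hj⟩ i
    exact hj ((dist_gridPt_kuhnVertex_le hh v π i j).trans_lt hhρ)
  · rintro v π hX ⟨j, hj⟩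
    obtain ⟨z, hz, hzΩ⟩ := not_subset.1 hj
    obtain ⟨x0, hx0, hjx0⟩ := exists_frontier_dist_lt (hX j) hzΩ hz
    have hdist : ∀ i, dist (gridPt h (kuhnVertex v π i)) x0 < 2 * ρ := by
      intro i
      have h1 := dist_triangle (gridPt h (kuhnVertex v π i)) (gridPt h (kuhnVertex v π j)) x0
      have h2 := dist_gridPt_kuhnVertex_le hh v π i j
      linarith
    refine zero_notMem_convexHull_of_ball (c := g x0) (r := ‖g x0 - g' x0‖ + μ) ?_ (hclose x0 hx0)
    rintro _ (⟨i, rfl⟩ | ⟨i, rfl⟩)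
    · have h1 := hg _ (hX i) x0 hx0 (hdist i)
      have h2 := norm_sub_le (g (gridPt h (kuhnVertex v π i)) - g x0) y
      rw [dist_eq_norm] at h1
      have h3 := norm_nonneg (g x0 - g' x0)
      rw [dist_eq_norm, sub_right_comm]
      linarith
    · have h1 := hg' _ (hX i) x0 hx0 (hdist i)
      have h2 := norm_sub_le (g' (gridPt h (kuhnVertex v π i)) - g' x0 - (g x0 - g' x0)) y
      have h3 := norm_sub_le (g' (gridPt h (kuhnVertex v π i)) - g' x0) (g x0 - g' x0)
      rw [dist_eq_norm] at h1
      rw [dist_eq_norm]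
      have h4 : g' (gridPt h (kuhnVertex v π i)) - y - g x0
          = g' (gridPt h (kuhnVertex v π i)) - g' x0 - (g x0 - g' x0) - y := by abel
      rw [h4]
      linarith

/-- `g` is continuous on the closure of the bounded open set `Ω` without zeros on the frontier. -/
structure Admissible (g : Euc n → Euc n) (Ω : Set (Euc n)) : Prop where
  isOpen : IsOpen Ω
  bounded : Bornology.IsBounded Ω
  cont : ContinuousOn g (closure Ω)
  ne_zero : ∀ x ∈ frontier Ω, g x ≠ 0

lemma isCompact_frontier_of_bounded {Ω : Set (Euc n)} (h : Bornology.IsBounded Ω) :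
    IsCompact (frontier Ω) :=
  h.isCompact_closure.of_isClosed_subset isClosed_frontier frontier_subset_closure

lemma exists_modulus {g : Euc n → Euc n} {Ω : Set (Euc n)} (hΩ : Bornology.IsBounded Ω)
    (hg : ContinuousOn g (closure Ω)) {ε : ℝ} (hε : 0 < ε) :
    ∃ ρ > 0, ∀ x ∈ closure Ω, ∀ x0 ∈ closure Ω, dist x x0 < ρ → dist (g x) (g x0) < ε :=
  Metric.uniformContinuousOn_iff.1 (hΩ.isCompact_closure.uniformContinuousOn_of_continuous hg) ε hε

/-- Almost every point near the origin. -/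
noncomputable def nearZero (n : ℕ) : Filter (Euc n) := 𝓝 0 ⊓ ae volume

instance : (nearZero n).NeBot := by
  rw [nearZero, inf_neBot_iff]
  intro s hs t ht
  have h1 : (volume : Measure (Euc n)) s ≠ 0 := (Measure.measure_pos_of_mem_nhds volume hs).ne'
  by_contra h
  rw [not_nonempty_iff_eq_empty] at h
  have hst : s ⊆ tᶜ := fun x hx hxt => by
    have : x ∈ s ∩ t := ⟨hx, hxt⟩
    rw [h] at this
    exact this
  exact h1 (measure_mono_null hst (mem_ae_iff.1 ht))

lemma eventually_norm_le_nearZero {μ : ℝ} (hμ : 0 < μ) : ∀ᶠ y in nearZero n, ‖y‖ ≤ μ := by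
  refine Filter.Eventually.filter_mono inf_le_left ?_
  filter_upwards [Metric.closedBall_mem_nhds (0 : Euc n) hμ] with y hy
  simpa using hy

lemma ae_generic_grid (g g' : Euc n → Euc n) (h : ℝ) : ∀ᵐ y : Euc n,
    Generic (range (fun v => g (gridPt h v) - y) ∪ range fun v => g' (gridPt h v) - y) := by
  filter_upwards [ae_generic (((countable_range fun v => g (gridPt h v))).union
    (countable_range fun v => g' (gridPt h v)))] with y hy
  refine hy.mono ?_
  rintro _ (⟨v, rfl⟩ | ⟨v, rfl⟩)
  · exact ⟨_, Or.inl ⟨v, rfl⟩, rfl⟩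
  · exact ⟨_, Or.inr ⟨v, rfl⟩, rfl⟩

lemma zero_mem_convexHull_sub_iff {ι : Type*} (q : ι → Euc n) (y : Euc n) :
    (0 : Euc n) ∈ convexHull ℝ (range fun j => q j - y) ↔ y ∈ convexHull ℝ (range q) := by
  have : (range fun j => q j - y) = (-y) +ᵥ range q := by
    rw [← image_vadd, ← range_comp]
    congr 1
    funext j
    simp [sub_eq_neg_add]
  rw [this, convexHull_vadd, mem_vadd_set_iff_neg_vadd_mem]
  simp

/-- Needed for the exchange of quantifiers in `Admissible.exists_count_eq`. -/
lemma measurable_count (g : Euc n → Euc n) {Ω : Set (Euc n)} (hΩ : Bornology.IsBounded Ω)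
    {h : ℝ} (hh : 0 < h) : MeasurableSet {y | count g Ω h y = 1} := by
  classical
  let _ : MeasurableSpace (ZMod 2) := ⊤
  have : DiscreteMeasurableSpace (ZMod 2) := ⟨fun _ => trivial⟩
  have hfin := finite_touching (finite_gridPt_preimage hh hΩ)
  have h1 : ∀ y, count g Ω h y = ∑ v ∈ hfin.toFinset, ∑ π,
      if ∀ j, kuhnVertex v π j ∈ gridPt h ⁻¹' Ω then
        cell (fun v => g (gridPt h v) - y) v π else 0 := by
    intro y
    refine finsum_eq_finsetSum_of_support_subset _ fun v hv => ?_
    by_contra hc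
    simp only [Finite.coe_toFinset, mem_ofPred_eq, not_exists] at hc
    refine hv (Finset.sum_eq_zero fun π _ => if_neg fun h => hc π 0 (h 0))
  have h2 : Measurable fun y => count g Ω h y := by
    simp only [h1]
    refine Finset.measurable_sum _ fun v _ => Finset.measurable_sum _ fun π _ => ?_
    split_ifs
    · unfold cell hullInd
      refine Measurable.ite ?_ measurable_const measurable_const
      simp only [zero_mem_convexHull_sub_iff]
      exact ((finite_range _).isClosed_convexHull ℝ).measurableSet
    · exact measurable_const
  exact h2 (measurableSet_singleton (1 : ZMod 2))

lemma zmod_two_eq_iff {a b : ZMod 2} : a = b ↔ (a = 1 ↔ b = 1) := by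
  revert a b; decide

/-- Counting at `y + c` is counting at `y` for `g - c`, which is close to `g`. The exceptional null
set of `y` depends on `c`, so Fubini is used to find one `y0` that compares with almost all nearby
points. -/
theorem Admissible.exists_count_eq {g : Euc n → Euc n} {Ω : Set (Euc n)} (hg : Admissible g Ω) :
    ∀ᶠ h in 𝓝[>] (0 : ℝ), ∃ c, ∀ᶠ y in nearZero n, count g Ω h y = c := by
  obtain ⟨m, hm0, hm⟩ := (isCompact_frontier_of_bounded hg.bounded).exists_forall_le'
    (f := fun x => ‖g x‖) ((hg.cont.mono frontier_subset_closure).norm)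
    (a := 0) fun x hx => norm_pos_iff.2 (hg.ne_zero x hx)
  set μ := m / 2 with hμdef
  have hμ : 0 < μ := by positivity
  obtain ⟨ρ', hρ', hmod⟩ := exists_modulus hg.bounded hg.cont (half_pos hμ)
  set ρ := ρ' / 2 with hρdef
  have hρ : 0 < ρ := by positivity
  have hsmall : ∀ᶠ h in 𝓝[>] (0 : ℝ), h * (n + 1) < ρ := by
    refine Filter.Eventually.filter_mono nhdsWithin_le_nhds ?_
    have : Tendsto (fun h : ℝ => h * (n + 1)) (𝓝 0) (𝓝 (0 * (n + 1))) := by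
      exact tendsto_id.mul_const _
    rw [zero_mul] at this
    exact this.eventually_lt_const hρ
  filter_upwards [hsmall, self_mem_nhdsWithin] with h hhρ hh
  have hh : 0 < h := hh
  have hshift : ∀ c : Euc n, ∀ᵐ y : Euc n, ‖c‖ ≤ μ → ‖y‖ ≤ μ / 2 →
      (count g Ω h y = 1 ↔ count g Ω h (y + c) = 1) := by
    intro c
    filter_upwards [ae_generic_grid g (fun x => g x - c) h] with y hgen hc hy
    have h1 : count g Ω h y = count (fun x => g x - c) Ω h y := by
      refine count_eq_of_close hg.bounded (ρ := ρ) (μ := μ) ?_ ?_ ?_ hh hhρ hy hgen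
      · intro x hx
        have := hm x hx
        simp only [sub_sub_cancel]
        linarith
      · intro x hx x0 hx0 hd
        exact hmod x (subset_closure hx) x0 (frontier_subset_closure hx0) (by linarith)
      · intro x hx x0 hx0 hd
        rw [dist_sub_right]
        exact hmod x (subset_closure hx) x0 (frontier_subset_closure hx0) (by linarith)
    have h2 : count (fun x => g x - c) Ω h y = count g Ω h (y + c) := by
      unfold count
      congr 1
      funext v
      rw [sub_sub, add_comm c]
    rw [h1, h2]
  have hS := measurable_count g hg.bounded hh
  have hmeas : MeasurableSet {q : Euc n × Euc n | ‖q.1‖ ≤ μ → ‖q.2‖ ≤ μ / 2 →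
      (count g Ω h q.2 = 1 ↔ count g Ω h (q.2 + q.1) = 1)} := by
    have m1 : MeasurableSet {q : Euc n × Euc n | ‖q.1‖ ≤ μ} :=
      measurableSet_le (by fun_prop) measurable_const
    have m2 : MeasurableSet {q : Euc n × Euc n | ‖q.2‖ ≤ μ / 2} :=
      measurableSet_le (by fun_prop) measurable_const
    have m3 : MeasurableSet {q : Euc n × Euc n | count g Ω h q.2 = 1} := measurable_snd hS
    have m4 : MeasurableSet {q : Euc n × Euc n | count g Ω h (q.2 + q.1) = 1} :=
      (measurable_snd.add measurable_fst) hS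
    exact m1.imp (m2.imp (m3.iff m4))
  -- From "for every shift, almost every point" to "for almost every point, almost every shift".
  have hswap := (Measure.ae_ae_comm (μ := (volume : Measure (Euc n)))
    (ν := (volume : Measure (Euc n))) (p := fun c y => ‖c‖ ≤ μ → ‖y‖ ≤ μ / 2 →
      (count g Ω h y = 1 ↔ count g Ω h (y + c) = 1)) hmeas).1 (Eventually.of_forall hshift)
  obtain ⟨y0, hy0, hy0'⟩ := Filter.Eventually.exists (f := nearZero n)
    ((hswap.filter_mono inf_le_right).and (eventually_norm_le_nearZero (half_pos hμ)))
  refine ⟨count g Ω h y0, ?_⟩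
  have hz : ∀ᵐ z : Euc n, ‖z + -y0‖ ≤ μ → (count g Ω h y0 = 1 ↔ count g Ω h z = 1) := by
    have := (measurePreserving_add_right (volume : Measure (Euc n)) (-y0)).quasiMeasurePreserving.ae
      hy0
    filter_upwards [this] with z hz hzn
    have := hz hzn hy0'
    rwa [add_neg_cancel_comm_assoc] at this
  filter_upwards [hz.filter_mono inf_le_right,
    eventually_norm_le_nearZero (n := n) (half_pos hμ)] with z h1 h2
  rw [eq_comm, zmod_two_eq_iff]
  refine h1 ((norm_add_le _ _).trans ?_)
  rw [norm_neg]
  linarith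

/-- A choice of infinitely fine meshes. -/
noncomputable def meshes : Ultrafilter ℝ := Ultrafilter.of (𝓝[>] (0 : ℝ))

lemma eventually_meshes {p : ℝ → Prop} (h : ∀ᶠ x in 𝓝[>] (0 : ℝ), p x) :
    ∀ᶠ x in (meshes : Filter ℝ), p x := h.filter_mono (Ultrafilter.of_le _)

open Classical in
/-- The mod 2 degree of `g` over `Ω` at the value `0`. -/
noncomputable def degree (g : Euc n → Euc n) (Ω : Set (Euc n)) : ZMod 2 :=
  if ∀ᶠ h in (meshes : Filter ℝ), ∀ᶠ y in nearZero n, count g Ω h y = 1 then 1 else 0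

/-- The ultrafilter decides which of the two values occurs for fine meshes, so independence of the
mesh is not needed. -/
theorem Admissible.eventually_count {g : Euc n → Euc n} {Ω : Set (Euc n)} (hg : Admissible g Ω) :
    ∀ᶠ h in (meshes : Filter ℝ), ∀ᶠ y in nearZero n, count g Ω h y = degree g Ω := by
  have h0 := eventually_meshes hg.exists_count_eq
  unfold degree
  split_ifs with h1
  · exact h1
  · rw [← Ultrafilter.eventually_not] at h1
    filter_upwards [h0, h1] with h ⟨c, hc⟩ hne
    have : c = 0 := by
      by_contra hc0
      have : c = 1 := (show ∀ a : ZMod 2, a ≠ 0 → a = 1 by decide) c hc0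
      exact hne (this ▸ hc)
    exact this ▸ hc

theorem degree_eq_of_eventually {g g' : Euc n → Euc n} {Ω Ω' : Set (Euc n)}
    (hg : Admissible g Ω) (hg' : Admissible g' Ω')
    (h : ∀ᶠ h in 𝓝[>] (0 : ℝ), ∀ᶠ y in nearZero n, count g Ω h y = count g' Ω' h y) :
    degree g Ω = degree g' Ω' := by
  obtain ⟨t, h1, h2, h3⟩ :=
    (hg.eventually_count.and (hg'.eventually_count.and (eventually_meshes h))).exists
  obtain ⟨y, h1, h2, h3⟩ := (h1.and (h2.and h3)).exists
  rw [← h1, ← h2, h3]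

lemma eventually_mesh_small {ρ : ℝ} (hρ : 0 < ρ) :
    ∀ᶠ h in 𝓝[>] (0 : ℝ), 0 < h ∧ h * (n + 1) < ρ := by
  have hsmall : ∀ᶠ h in 𝓝[>] (0 : ℝ), h * (n + 1) < ρ := by
    refine Filter.Eventually.filter_mono nhdsWithin_le_nhds ?_
    have : Tendsto (fun h : ℝ => h * (n + 1)) (𝓝 0) (𝓝 (0 * (n + 1))) := by
      exact tendsto_id.mul_const _
    rw [zero_mul] at this
    exact this.eventually_lt_const hρ
  filter_upwards [hsmall, self_mem_nhdsWithin] with h h1 h2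
  exact ⟨h2, h1⟩

theorem Admissible.of_close {g g' : Euc n → Euc n} {Ω : Set (Euc n)} (hg : Admissible g Ω)
    (hg' : ContinuousOn g' (closure Ω)) (hclose : ∀ x ∈ frontier Ω, ‖g x - g' x‖ < ‖g x‖) :
    Admissible g' Ω :=
  ⟨hg.isOpen, hg.bounded, hg', fun x hx h => by simpa [h] using hclose x hx⟩

/-- A Rouché theorem: compactness of the frontier turns strict domination into a uniform margin for
`count_eq_of_close`. -/
theorem degree_eq_of_close {g g' : Euc n → Euc n} {Ω : Set (Euc n)} (hg : Admissible g Ω)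
    (hg' : ContinuousOn g' (closure Ω)) (hclose : ∀ x ∈ frontier Ω, ‖g x - g' x‖ < ‖g x‖) :
    degree g Ω = degree g' Ω := by
  refine degree_eq_of_eventually hg (hg.of_close hg' hclose) ?_
  obtain ⟨μ, hμ, hm⟩ := (isCompact_frontier_of_bounded hg.bounded).exists_forall_le'
    (f := fun x => ‖g x‖ - ‖g x - g' x‖)
    ((hg.cont.mono frontier_subset_closure).norm.sub
      ((hg.cont.mono frontier_subset_closure).sub (hg'.mono frontier_subset_closure)).norm)
    (a := 0) fun x hx => sub_pos.2 (hclose x hx)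
  obtain ⟨ρ₁, hρ₁, hmod₁⟩ := exists_modulus hg.bounded hg.cont (half_pos hμ)
  obtain ⟨ρ₂, hρ₂, hmod₂⟩ := exists_modulus hg.bounded hg' (half_pos hμ)
  have hρ : 0 < min ρ₁ ρ₂ / 2 := by positivity
  filter_upwards [eventually_mesh_small (n := n) hρ] with h ⟨hh, hhρ⟩
  filter_upwards [(ae_generic_grid g g' h).filter_mono inf_le_right,
    eventually_norm_le_nearZero (n := n) (half_pos hμ)] with y hgen hy
  refine count_eq_of_close hg.bounded (μ := μ) ?_ ?_ ?_ hh hhρ hy hgen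
  · intro x hx
    have := hm x hx
    linarith
  · intro x hx x0 hx0 hd
    refine hmod₁ x (subset_closure hx) x0 (frontier_subset_closure hx0) (hd.trans_le ?_)
    have := min_le_left ρ₁ ρ₂
    linarith
  · intro x hx x0 hx0 hd
    refine hmod₂ x (subset_closure hx) x0 (frontier_subset_closure hx0) (hd.trans_le ?_)
    have := min_le_right ρ₁ ρ₂
    linarith

end Degree

end ModTwo

namespace ModTwo

open Set Function Filter Topology MeasureTheory
open scoped Pointwise

section DegreeProperties

variable {n : ℕ}

/-! ### Additivity -/

/-- A simplex with vertices inside and outside `W` is close to the frontier of `W`, where `g` is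
bounded away from 0, so its image cannot surround 0. -/
lemma cell_ne_zero_subset {g : Euc n → Euc n} {Ω W : Set (Euc n)} {ρ μ : ℝ}
    (hne : ∀ x ∈ frontier W, x ∈ closure Ω → μ ≤ ‖g x‖)
    (hg : ∀ x ∈ closure Ω, ∀ x0 ∈ closure Ω, dist x x0 < 2 * ρ → dist (g x) (g x0) < μ / 2)
    (hW : W ⊆ Ω) {h : ℝ} (hh : 0 < h) (hhρ : h * (n + 1) < ρ) {y : Euc n} (hy : ‖y‖ ≤ μ / 2)
    {v : Fin (n + 1) → ℤ} {π : Equiv.Perm (Fin (n + 1))}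
    (hcell : cell (fun v => g (gridPt h v) - y) v π ≠ 0)
    (hΩ : ∀ j, gridPt h (kuhnVertex v π j) ∈ Ω) {j : Fin (n + 2)}
    (hj : gridPt h (kuhnVertex v π j) ∈ W) (i : Fin (n + 2)) :
    gridPt h (kuhnVertex v π i) ∈ W := by
  by_contra hi
  obtain ⟨x0, hx0, hd⟩ := exists_frontier_dist_lt hj hi
    ((dist_gridPt_kuhnVertex_le hh v π i j).trans_lt hhρ)
  have hx0' : x0 ∈ closure Ω := closure_mono hW (frontier_subset_closure hx0)
  refine hcell (hullInd_of_notMem (zero_notMem_convexHull_of_ball (c := g x0) (r := μ) ?_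
    (hne x0 hx0 hx0')))
  rintro _ ⟨l, rfl⟩
  have h1 := dist_triangle (gridPt h (kuhnVertex v π l)) (gridPt h (kuhnVertex v π j)) x0
  have h2 := dist_gridPt_kuhnVertex_le hh v π l j
  have h3 := hg _ (subset_closure (hΩ l)) x0 hx0' (by linarith)
  have h4 := norm_sub_le (g (gridPt h (kuhnVertex v π l)) - g x0) y
  rw [dist_eq_norm] at h3
  rw [dist_eq_norm, sub_right_comm]
  linarith

lemma Admissible.sub_family {ι : Type*} {s : Finset ι} {g : Euc n → Euc n} {Ω : Set (Euc n)}
    {W : ι → Set (Euc n)} (hg : Admissible g Ω) (hW : ∀ i ∈ s, IsOpen (W i))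
    (hWΩ : ∀ i ∈ s, W i ⊆ Ω) (hdisj : ∀ i ∈ s, ∀ j ∈ s, i ≠ j → Disjoint (W i) (W j))
    (hne : ∀ x ∈ closure Ω, (∀ i ∈ s, x ∉ W i) → g x ≠ 0) {i : ι} (hi : i ∈ s) :
    Admissible g (W i) where
  isOpen := hW i hi
  bounded := hg.bounded.subset (hWΩ i hi)
  cont := hg.cont.mono (closure_mono (hWΩ i hi))
  ne_zero x hx := by
    refine hne x (closure_mono (hWΩ i hi) (frontier_subset_closure hx)) fun j hj hxj => ?_
    by_cases hij : i = j
    · subst hij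
      rw [(hW i hi).frontier_eq] at hx
      exact hx.2 hxj
    · obtain ⟨z, hz1, hz2⟩ := mem_closure_iff.1 (frontier_subset_closure hx) _ (hW j hj) hxj
      exact (hdisj i hi j hj hij).le_bot ⟨hz2, hz1⟩

/-- On the compact remainder `g` is bounded away from 0, so a small simplex that counts has all its
vertices in exactly one of the sets `W i`. -/
theorem degree_eq_sum {ι : Type*} {s : Finset ι} {g : Euc n → Euc n} {Ω : Set (Euc n)}
    {W : ι → Set (Euc n)} (hg : Admissible g Ω) (hW : ∀ i ∈ s, IsOpen (W i))
    (hWΩ : ∀ i ∈ s, W i ⊆ Ω) (hdisj : ∀ i ∈ s, ∀ j ∈ s, i ≠ j → Disjoint (W i) (W j))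
    (hne : ∀ x ∈ closure Ω, (∀ i ∈ s, x ∉ W i) → g x ≠ 0) :
    degree g Ω = ∑ i ∈ s, degree g (W i) := by
  classical
  set K := closure Ω \ ⋃ i ∈ s, W i with hK
  have hKc : IsCompact K := hg.bounded.isCompact_closure.diff (isOpen_biUnion hW)
  obtain ⟨μ, hμ, hm⟩ := hKc.exists_forall_le' (f := fun x => ‖g x‖)
    ((hg.cont.mono sdiff_subset).norm) (a := 0) fun x hx => norm_pos_iff.2
      (hne x hx.1 fun i hi hxi => hx.2 (mem_biUnion hi hxi))
  have hfr : ∀ i ∈ s, ∀ x ∈ frontier (W i), x ∈ K := by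
    intro i hi x hx
    refine ⟨closure_mono (hWΩ i hi) (frontier_subset_closure hx), fun hxU => ?_⟩
    obtain ⟨j, hj, hxj⟩ := mem_iUnion₂.1 hxU
    by_cases hij : i = j
    · subst hij
      rw [(hW i hi).frontier_eq] at hx
      exact hx.2 hxj
    · obtain ⟨z, hz1, hz2⟩ := mem_closure_iff.1 (frontier_subset_closure hx) _ (hW j hj) hxj
      exact (hdisj i hi j hj hij).le_bot ⟨hz2, hz1⟩
  obtain ⟨ρ', hρ', hmod⟩ := exists_modulus hg.bounded hg.cont (half_pos hμ)
  have hρ : 0 < ρ' / 2 := by positivity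
  have key : ∀ᶠ h in 𝓝[>] (0 : ℝ), ∀ᶠ y in nearZero n,
      count g Ω h y = ∑ i ∈ s, count g (W i) h y := by
    filter_upwards [eventually_mesh_small (n := n) hρ] with h ⟨hh, hhρ⟩
    filter_upwards [eventually_norm_le_nearZero (n := n) (half_pos hμ)] with y hy
    unfold count cellCount
    rw [← finsum_sum_comm _ _ fun i hi => support_cellCount_finite _
      (finite_gridPt_preimage hh (hg.bounded.subset (hWΩ i hi)))]
    congr 1
    funext v
    rw [Finset.sum_comm]
    refine Finset.sum_congr rfl fun π _ => ?_
    by_cases hc : cell (fun v => g (gridPt h v) - y) v π = 0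
    · simp [hc]
    simp only [mem_preimage]
    by_cases hΩ : ∀ j, gridPt h (kuhnVertex v π j) ∈ Ω
    · rw [if_pos hΩ]
      have hex : ∃ i ∈ s, gridPt h (kuhnVertex v π 0) ∈ W i := by
        by_contra! hno
        have hx0 : gridPt h (kuhnVertex v π 0) ∈ K :=
          ⟨subset_closure (hΩ 0), fun hU => by
            obtain ⟨j, hj, hxj⟩ := mem_iUnion₂.1 hU
            exact hno j hj hxj⟩
        refine hc (hullInd_of_notMem (zero_notMem_convexHull_of_ball
          (c := g (gridPt h (kuhnVertex v π 0))) (r := μ) ?_ (hm _ hx0)))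
        rintro _ ⟨l, rfl⟩
        have h3 := hmod _ (subset_closure (hΩ l)) _ hx0.1
          ((dist_gridPt_kuhnVertex_le hh v π l 0).trans_lt (by linarith))
        have h4 := norm_sub_le (g (gridPt h (kuhnVertex v π l))
          - g (gridPt h (kuhnVertex v π 0))) y
        rw [dist_eq_norm] at h3
        rw [dist_eq_norm, sub_right_comm]
        linarith
      obtain ⟨i, hi, hi0⟩ := hex
      have hall := cell_ne_zero_subset (ρ := ρ' / 2) (fun x hx _ => hm x (hfr i hi x hx))
        (fun x hx x0 hx0 hd => hmod x hx x0 hx0 (by linarith)) (hWΩ i hi) hh hhρ hy hc hΩ hi0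
      rw [Finset.sum_eq_single_of_mem i hi]
      · rw [if_pos hall]
      · intro j hj hji
        refine if_neg fun h' => ?_
        exact (hdisj i hi j hj hji.symm).le_bot ⟨hall 0, h' 0⟩
    · rw [if_neg hΩ]
      symm
      refine Finset.sum_eq_zero fun i hi => if_neg fun h' => hΩ fun j => hWΩ i hi (h' j)
  have hev : ∀ i ∈ s, ∀ᶠ h in (meshes : Filter ℝ), ∀ᶠ y in nearZero n,
      count g (W i) h y = degree g (W i) := fun i hi =>
    (hg.sub_family hW hWΩ hdisj hne hi).eventually_count
  have hev' := (Finset.eventually_all s).2 hev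
  obtain ⟨t, h1, h2, h3⟩ := (hg.eventually_count.and ((eventually_meshes key).and hev')).exists
  have h3' := (Finset.eventually_all s).2 h3
  obtain ⟨y, h1, h2, h3⟩ := (h1.and (h2.and h3')).exists
  rw [← h1, h2]
  exact Finset.sum_congr rfl fun i hi => h3 i hi

theorem degree_eq_of_subset {g : Euc n → Euc n} {Ω W : Set (Euc n)} (hg : Admissible g Ω)
    (hW : IsOpen W) (hWΩ : W ⊆ Ω) (hne : ∀ x ∈ closure Ω, x ∉ W → g x ≠ 0) :
    degree g Ω = degree g W := by
  have := degree_eq_sum (s := {()}) (W := fun _ => W) hg (fun _ _ => hW) (fun _ _ => hWΩ)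
    (fun i _ j _ h => absurd rfl h) (fun x hx h => hne x hx (h () (Finset.mem_singleton_self _)))
  simpa using this

/-! ### Linear changes of the target -/

/-- Linear isomorphisms commute with convex hulls and preserve null sets, so the count at `y`
becomes the count at `A.symm y`. -/
theorem degree_linear_comp (A : Euc n ≃L[ℝ] Euc n) {g : Euc n → Euc n} {Ω : Set (Euc n)}
    (hg : Admissible g Ω) : degree (fun x => A (g x)) Ω = degree g Ω := by
  have hA : Admissible (fun x => A (g x)) Ω := ⟨hg.isOpen, hg.bounded,
    A.continuous.comp_continuousOn hg.cont, fun x hx h => hg.ne_zero x hx (by simpa using h)⟩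
  have hcount : ∀ h y, count (fun x => A (g x)) Ω h y = count g Ω h (A.symm y) := by
    intro h y
    unfold count cellCount
    congr 1
    funext v
    refine Finset.sum_congr rfl fun π _ => ?_
    congr 1
    unfold cell hullInd
    congr 1
    rw [zero_mem_convexHull_sub_iff (fun j => A (g (gridPt h (kuhnVertex v π j)))),
      zero_mem_convexHull_sub_iff (fun j => g (gridPt h (kuhnVertex v π j)))]
    have : (range fun j => A (g (gridPt h (kuhnVertex v π j))))
        = A.toLinearEquiv.toLinearMap '' range fun j => g (gridPt h (kuhnVertex v π j)) := by
      rw [← range_comp]; rfl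
    rw [this, ← LinearMap.image_convexHull]
    refine propext ⟨?_, fun hy => ⟨_, hy, by simp⟩⟩
    rintro ⟨z, hz, rfl⟩
    simpa using hz
  have htend : Tendsto A.symm (nearZero n) (nearZero n) := by
    refine tendsto_inf.2 ⟨?_, ?_⟩
    · have := A.symm.continuous.tendsto 0
      rw [map_zero] at this
      exact this.mono_left inf_le_left
    · refine Tendsto.mono_left ?_ inf_le_right
      intro t ht
      rw [mem_map, mem_ae_iff, ← preimage_compl]
      rw [mem_ae_iff] at ht
      have := Measure.addHaar_preimage_continuousLinearEquiv (volume : Measure (Euc n)) A.symm tᶜ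
      rw [this, ht, mul_zero]
  obtain ⟨t, h1, h2⟩ := (hA.eventually_count.and hg.eventually_count).exists
  obtain ⟨y, h1, h2⟩ := (h1.and (htend.eventually h2)).exists
  rw [← h1, ← h2, hcount]

/-! ### The identity -/

lemma sum_tail_telescope (F : ℕ → ℝ) (i : ℕ) : ∀ m, i + 1 ≤ m →
    ∑ j ∈ Finset.range m, (F j - F (j + 1)) * (if i < j then 1 else 0) = F (i + 1) - F m := by
  intro m hm
  induction m, hm using Nat.le_induction with
  | base =>
    rw [sub_self]
    refine Finset.sum_eq_zero fun j hj => ?_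
    have := Finset.mem_range.1 hj
    rw [if_neg (by omega), mul_zero]
  | succ m hm ih =>
    rw [Finset.sum_range_succ, ih, if_pos (by omega)]
    ring

/-- Sort the fractional parts in decreasing order; the barycentric coordinates are their successive
differences. -/
lemma exists_kuhn_weights (z : Fin (n + 1) → ℝ) : ∃ (π : Equiv.Perm (Fin (n + 1)))
    (w : Fin (n + 2) → ℝ), (∀ j, 0 ≤ w j) ∧ ∑ j, w j = 1 ∧
      ∀ c, ∑ j, w j * (kuhnVertex (fun i => ⌊z i⌋) π j c : ℝ) = z c := by
  let f : Fin (n + 1) → ℝ := fun i => Int.fract (z i)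
  let π := Tuple.sort fun i => -f i
  have hπ : Monotone ((fun i => -f i) ∘ π) := Tuple.monotone_sort _
  -- The sorted fractional parts at indices `1, …, n + 1`, framed by 1 at index 0 and by 0 from
  -- index `n + 2` on.
  let F : ℕ → ℝ := fun j => if j = 0 then 1 else
    if h : j - 1 < n + 1 then f (π ⟨j - 1, h⟩) else 0
  have hF0 : F 0 = 1 := by simp [F]
  have hFs : ∀ i : Fin (n + 1), F (i + 1) = f (π i) := by
    intro i
    simp [F]
    intro h
    omega
  have hFl : F (n + 2) = 0 := by simp [F]
  have hanti : ∀ j : Fin (n + 2), 0 ≤ F j - F (j + 1) := by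
    intro j
    rcases Nat.eq_zero_or_pos (j : ℕ) with h0 | h0
    · rw [h0, hF0]
      have := hFs 0
      simp only [Fin.val_zero] at this
      rw [this]
      exact sub_nonneg.2 (Int.fract_lt_one _).le
    · obtain ⟨a, ha⟩ := Nat.exists_eq_succ_of_ne_zero h0.ne'
      have hj := j.2
      have h1 := hFs ⟨a, by omega⟩
      simp only at h1
      rw [ha, Nat.succ_eq_add_one, h1]
      by_cases hlast : a + 1 < n + 1
      · have h2 := hFs ⟨a + 1, hlast⟩
        simp only at h2
        rw [h2]
        have := hπ (show (⟨a, by omega⟩ : Fin (n + 1)) ≤ ⟨a + 1, hlast⟩ from by simp)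
        simp only [comp_apply] at this
        linarith
      · have : a + 1 + 1 = n + 2 := by omega
        rw [this, hFl, sub_zero]
        exact Int.fract_nonneg _
  refine ⟨π, fun j => F j - F (j + 1), hanti, ?_, fun c => ?_⟩
  · rw [Fin.sum_univ_eq_sum_range (fun j => F j - F (j + 1)), Finset.sum_range_sub', hF0, hFl]
    simp
  · have h1 : ∑ j : Fin (n + 2), (F j - F (j + 1)) = 1 := by
      rw [Fin.sum_univ_eq_sum_range (fun j => F j - F (j + 1)), Finset.sum_range_sub', hF0, hFl]
      simp
    have h2 : ∀ j : Fin (n + 2), (F j - F (j + 1)) * (kuhnVertex (fun i => ⌊z i⌋) π j c : ℝ)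
        = (F j - F (j + 1)) * ⌊z c⌋ +
          (F j - F (j + 1)) * (if (π.symm c : ℕ) < (j : ℕ) then 1 else 0) := by
      intro j
      simp only [kuhnVertex]
      push_cast
      rw [mul_add]
    rw [Finset.sum_congr rfl fun j _ => h2 j, Finset.sum_add_distrib, ← Finset.sum_mul, h1,
      Fin.sum_univ_eq_sum_range
        (fun j => (F j - F (j + 1)) * (if (π.symm c : ℕ) < j then 1 else 0)),
      sum_tail_telescope F _ _ (by omega), hFs, hFl]
    rw [one_mul, sub_zero, Equiv.apply_symm_apply]
    exact Int.floor_add_fract _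

/-- The coordinate `z (π i)` exceeds `v (π i)` by the sum of the weights after index `i`. These
tails lie in `[0, 1)` and strictly decrease, so they are the fractional parts in sorted order. -/
lemma kuhn_unique {z : Fin (n + 1) → ℝ} {v : Fin (n + 1) → ℤ} {π : Equiv.Perm (Fin (n + 1))}
    {w : Fin (n + 2) → ℝ} (h0 : ∀ j, 0 < w j) (h1 : ∑ j, w j = 1)
    (h2 : ∀ c, ∑ j, w j * (kuhnVertex v π j c : ℝ) = z c) :
    v = (fun i => ⌊z i⌋) ∧ StrictAnti fun i => Int.fract (z (π i)) := by
  have h3 : ∀ c, z c = v c + ∑ j, w j * (if (π.symm c : ℕ) < (j : ℕ) then 1 else 0) := by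
    intro c
    rw [← h2 c]
    have : ∀ j, w j * (kuhnVertex v π j c : ℝ)
        = w j * v c + w j * (if (π.symm c : ℕ) < (j : ℕ) then 1 else 0) := by
      intro j
      simp only [kuhnVertex]
      push_cast
      rw [mul_add]
    rw [Finset.sum_congr rfl fun j _ => this j, Finset.sum_add_distrib, ← Finset.sum_mul, h1,
      one_mul]
  set T : Fin (n + 1) → ℝ := fun i => ∑ j, w j * (if (i : ℕ) < (j : ℕ) then 1 else 0) with hT
  have hTanti : ∀ i i', i < i' → T i' < T i := by
    intro i i' hii
    refine Finset.sum_lt_sum (fun j _ => ?_) ⟨i'.castSucc, Finset.mem_univ _, ?_⟩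
    · have hlt : (i : ℕ) < i' := hii
      have := (h0 j).le
      split_ifs
      · exact le_rfl
      · omega
      · linarith
      · exact le_rfl
    · have hlt : (i : ℕ) < i' := hii
      simp [hii, h0]
  have hT0 : ∀ i, 0 ≤ T i := fun i => Finset.sum_nonneg fun j _ => by
    have := (h0 j).le
    split_ifs <;> linarith
  have hT1 : ∀ i, T i < 1 := by
    intro i
    rw [← h1]
    refine Finset.sum_lt_sum (fun j _ => ?_) ⟨0, Finset.mem_univ _, ?_⟩
    · have := (h0 j).le
      split_ifs <;> linarith
    · simp [h0]
  have hv : v = fun i => ⌊z i⌋ := by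
    funext c
    symm
    rw [Int.floor_eq_iff]
    have := h3 c
    have a := hT0 (π.symm c)
    have b := hT1 (π.symm c)
    simp only [hT] at a b
    constructor <;> linarith
  refine ⟨hv, fun i i' hii => ?_⟩
  have hfr : ∀ i, Int.fract (z (π i)) = T i := by
    intro i
    rw [Int.fract, ← congrFun hv (π i), h3 (π i)]
    simp [hT]
  simp only [hfr]
  exact hTanti i i' hii

lemma strictAnti_perm_unique {f : Fin (n + 1) → ℝ} {π π' : Equiv.Perm (Fin (n + 1))}
    (h : StrictAnti fun i => f (π i)) (h' : StrictAnti fun i => f (π' i)) : π = π' := by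
  have hm : ∀ {σ : Equiv.Perm (Fin (n + 1))}, (StrictAnti fun i => f (σ i)) →
      Monotone ((fun i => -f i) ∘ σ) := fun hσ i j hij => neg_le_neg (hσ.antitone hij)
  have := Tuple.unique_monotone (hm h) (hm h')
  ext i
  congr 1
  have hi := congrFun this i
  simp only [comp_apply, neg_inj] at hi
  have hinj : Injective f := by
    intro a b hab
    obtain ⟨a, rfl⟩ := π.surjective a
    obtain ⟨b, rfl⟩ := π.surjective b
    rw [h.injective hab]
  exact hinj hi

/-- A generic point close to `x0` lies in exactly one Kuhn simplex, and for a fine mesh this simplex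
has its vertices in `Ω`. -/
theorem degree_sub_const {Ω : Set (Euc n)} (hΩ : IsOpen Ω) (hb : Bornology.IsBounded Ω)
    {x0 : Euc n} (hx0 : x0 ∈ Ω) : degree (fun x => x - x0) Ω = 1 := by
  classical
  have hadm : Admissible (fun x => x - x0) Ω := ⟨hΩ, hb, by fun_prop, fun x hx h => by
    rw [sub_eq_zero] at h
    subst h
    rw [hΩ.frontier_eq] at hx
    exact hx.2 hx0⟩
  obtain ⟨r, hr, hball⟩ := Metric.isOpen_iff.1 hΩ x0 hx0
  have hρ : 0 < r / 2 := by positivity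
  suffices key : ∀ᶠ h in 𝓝[>] (0 : ℝ), ∀ᶠ y in nearZero n,
      count (fun x => x - x0) Ω h y = 1 by
    obtain ⟨t, h1, h2⟩ := (hadm.eventually_count.and (eventually_meshes key)).exists
    obtain ⟨y, h1, h2⟩ := (h1.and h2).exists
    rw [← h1, h2]
  filter_upwards [eventually_mesh_small (n := n) hρ] with h ⟨hh, hhρ⟩
  filter_upwards [eventually_norm_le_nearZero (n := n) (half_pos hρ),
    (ae_generic_grid (fun x => x - x0) (fun x => x - x0) h).filter_mono inf_le_right] with y hy hgen
  set p : (Fin (n + 1) → ℤ) → Equiv.Perm (Fin (n + 1)) → Fin (n + 2) → Euc n :=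
    fun v π j => gridPt h (kuhnVertex v π j) - x0 - y with hp
  let z : Fin (n + 1) → ℝ := fun c => (x0 c + y c) / h
  have hzero : ∀ v π (w : Fin (n + 2) → ℝ), ∑ j, w j = 1 → (∑ j, w j • p v π j = 0 ↔
      ∀ c, ∑ j, w j * (kuhnVertex v π j c : ℝ) = z c) := by
    intro v π w hw
    have hcoord : ∀ c, (∑ j, w j • p v π j) c
        = h * (∑ j, w j * (kuhnVertex v π j c : ℝ)) - (x0 c + y c) := by
      intro c
      rw [Finset.mul_sum, ← one_mul (x0 c + y c), ← hw, Finset.sum_mul, ← Finset.sum_sub_distrib]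
      simp only [WithLp.ofLp_sum, Finset.sum_apply, hp]
      refine Finset.sum_congr rfl fun j _ => ?_
      simp [gridPt]
      ring
    constructor
    · intro h0 c
      have := hcoord c
      rw [h0] at this
      simp only [z]
      rw [eq_div_iff hh.ne']
      simp only [PiLp.zero_apply] at this
      linarith
    · intro h0
      ext c
      rw [hcoord c, h0 c]
      simp only [z]
      field_simp
      simp
  have hmem : ∀ v π, (0 : Euc n) ∈ convexHull ℝ (range (p v π)) ↔ ∃ w : Fin (n + 2) → ℝ,
      (∀ j, 0 ≤ w j) ∧ ∑ j, w j = 1 ∧ ∑ j, w j • p v π j = 0 := by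
    intro v π
    rw [← image_univ, mem_convexHull_image_iff]
    simp
  obtain ⟨π₀, w₀, hw0, hw1, hw2⟩ := exists_kuhn_weights z
  have hmem₀ : (0 : Euc n) ∈ convexHull ℝ (range (p (fun i => ⌊z i⌋) π₀)) :=
    (hmem _ _).2 ⟨w₀, hw0, hw1, (hzero _ _ _ hw1).2 hw2⟩
  have huniq : ∀ v π, (0 : Euc n) ∈ convexHull ℝ (range (p v π)) →
      v = (fun i => ⌊z i⌋) ∧ StrictAnti fun i => Int.fract (z (π i)) := by
    intro v π h0
    obtain ⟨w, a0, a1, a2⟩ := (hmem v π).1 h0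
    refine kuhn_unique (fun j => lt_of_le_of_ne (a0 j) fun hj => ?_) a1 ((hzero _ _ _ a1).1 a2)
    -- A vanishing weight would put 0 in the hull of only `n + 1` of the points.
    refine hgen ((Finset.univ.erase j).image (p v π)) ?_ ?_ ?_
    · intro x hx
      simp only [Finset.coe_image, mem_image] at hx
      obtain ⟨l, -, rfl⟩ := hx
      exact Or.inl ⟨_, rfl⟩
    · refine Finset.card_image_le.trans ?_
      simp
    · rw [Finset.coe_image, mem_convexHull_image_iff]
      refine ⟨w, a0, a1, a2, fun i hi => ?_⟩
      simp at hi
      rw [hi, hj]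
  have hin : ∀ j, gridPt h (kuhnVertex (fun i => ⌊z i⌋) π₀ j) ∈ Ω := by
    intro j
    refine hball ?_
    have h1 : (0 : Euc n) ∈ Metric.closedBall (p (fun i => ⌊z i⌋) π₀ j) (h * (n + 1)) := by
      refine convexHull_min ?_ (convex_closedBall _ _) hmem₀
      rintro _ ⟨l, rfl⟩
      rw [Metric.mem_closedBall]
      simp only [hp, dist_sub_right]
      exact dist_gridPt_kuhnVertex_le hh _ _ _ _
    rw [Metric.mem_closedBall, dist_zero_left] at h1
    rw [Metric.mem_ball, dist_eq_norm]
    have h2 := norm_add_le (p (fun i => ⌊z i⌋) π₀ j) y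
    simp only [hp, sub_add_cancel] at h2
    simp only [hp] at h1
    linarith
  unfold count cellCount
  rw [finsum_eq_single _ (fun i => ⌊z i⌋)]
  · rw [Finset.sum_eq_single π₀]
    · simp only [mem_preimage]
      rw [if_pos hin]
      exact hullInd_of_mem hmem₀
    · intro π _ hπ
      have : cell (fun v => gridPt h v - x0 - y) (fun i => ⌊z i⌋) π = 0 :=
        hullInd_of_notMem fun h0 => hπ (strictAnti_perm_unique (huniq _ _ h0).2
          (huniq _ _ hmem₀).2 (f := fun i => Int.fract (z i)))
      simp [this]
    · simp
  · intro v hv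
    refine Finset.sum_eq_zero fun π _ => ?_
    have : cell (fun v => gridPt h v - x0 - y) v π = 0 :=
      hullInd_of_notMem fun h0 => hv (huniq _ _ h0).1
    simp [this]

end DegreeProperties

end ModTwo

namespace ModTwo

open Set Function Filter Topology MeasureTheory
open scoped Pointwise ContDiff

section Regular

variable {n : ℕ}

/-! ### Approximation by maps with regular zeros -/

/-- Extend by Tietze, smooth, and subtract a small regular value supplied by Sard's theorem in equal
dimensions. -/
theorem exists_regular_approx {φ : Euc n → Euc n} {K : Set (Euc n)} (hK : IsClosed K)
    (hφ : ContinuousOn φ K) {ε : ℝ} (hε : 0 < ε) :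
    ∃ ψ : Euc n → Euc n, ContDiff ℝ 1 ψ ∧ (∀ x ∈ K, ‖ψ x - φ x‖ < ε) ∧
      ∀ x, ψ x = 0 → (fderiv ℝ ψ x).det ≠ 0 := by
  obtain ⟨Φ, hΦ⟩ := ContinuousMap.exists_restrict_eq hK ⟨K.domRestrict φ, hφ.domRestrict⟩
  have hΦ' : ∀ x ∈ K, Φ x = φ x := fun x hx =>
    congrArg (fun f : C(K, Euc n) => f ⟨x, hx⟩) hΦ
  obtain ⟨g, hg, hgφ, -⟩ := Φ.continuous.exists_contDiff_approx 1 (ε := fun _ => ε / 2)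
    continuous_const fun _ => half_pos hε
  have hg1 : ContDiff ℝ 1 g := by exact_mod_cast hg
  have hd : Differentiable ℝ g := hg1.differentiable one_ne_zero
  have hnull : volume (g '' {x | (fderiv ℝ g x).det = 0}) = 0 :=
    addHaar_image_eq_zero_of_det_fderivWithin_eq_zero (f' := fun x => fderiv ℝ g x) volume
      (fun x _ => (hd x).hasFDerivAt.hasFDerivWithinAt) fun x hx => hx
  obtain ⟨c, hc1, hc2⟩ := Filter.Eventually.exists (f := nearZero n)
    (((measure_eq_zero_iff_ae_notMem.1 hnull).filter_mono inf_le_right).and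
      (eventually_norm_le_nearZero (μ := ε / 4) (by positivity)))
  refine ⟨fun x => g x - c, hg1.sub contDiff_const, fun x hx => ?_, fun x hx hdet => ?_⟩
  · have h1 := hgφ x
    rw [dist_eq_norm, hΦ' x hx] at h1
    have h2 := norm_sub_le (g x - φ x) c
    rw [sub_right_comm]
    linarith
  · rw [fderiv_sub_const] at hdet
    exact hc1 ⟨x, hdet, sub_eq_zero.1 hx⟩

/-- An invertible derivative is bounded below, so near `u` it beats the error of first-order
approximation; this feeds `degree_eq_of_close`. -/
lemma exists_linear_dominates {ψ : Euc n → Euc n} {A : Euc n ≃L[ℝ] Euc n} {u : Euc n}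
    (hA : HasFDerivAt ψ (A : Euc n →L[ℝ] Euc n) u) (hu : ψ u = 0) :
    ∀ᶠ y in 𝓝 u, y ≠ u → ‖A (y - u) - ψ y‖ < ‖A (y - u)‖ := by
  set C := ‖(A.symm : Euc n →L[ℝ] Euc n)‖ + 1 with hC
  have hCpos : 0 < C := by positivity
  have hlow : ∀ v, ‖v‖ ≤ C * ‖A v‖ := by
    intro v
    have h1 := (A.symm : Euc n →L[ℝ] Euc n).le_opNorm (A v)
    simp only [ContinuousLinearEquiv.coe_coe, ContinuousLinearEquiv.symm_apply_apply] at h1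
    have := norm_nonneg (A v)
    simp only [hC]
    linarith
  have h1 := hA.isLittleO.def (c := 1 / (2 * C)) (by positivity)
  filter_upwards [h1] with y hy hne
  rw [hu, sub_zero] at hy
  have h2 := hlow (y - u)
  have h3 : 0 < ‖y - u‖ := norm_pos_iff.2 (sub_ne_zero.2 hne)
  have h4 : 0 < ‖A (y - u)‖ := by
    by_contra h
    nlinarith [norm_nonneg (A (y - u))]
  rw [norm_sub_rev]
  refine lt_of_le_of_lt hy ?_
  rw [div_mul_eq_mul_div, one_mul, div_lt_iff₀ (by positivity)]
  nlinarith

lemma finite_of_isolated {X : Type*} [TopologicalSpace X] {K : Set X} (hK : IsCompact K)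
    (h : ∀ x ∈ K, ∃ U ∈ 𝓝 x, U ∩ K ⊆ {x}) : K.Finite := by
  choose! U hU hUK using h
  obtain ⟨t, ht, hKt⟩ := hK.elim_nhds_subcover U hU
  refine t.finite_toSet.subset fun x hx => ?_
  obtain ⟨y, hy, hxy⟩ := mem_iUnion₂.1 (hKt hx)
  have : x = y := hUK y (ht y hy) ⟨hxy, hx⟩
  rwa [this]

/-! ### A local homeomorphism has odd degree -/

/-- Multiplicativity in disguise. Let `ψ` approximate `e.symm - x` with regular zeros. Then `ψ ∘ e`
is close to `z ↦ z - x` and has degree 1. By additivity this degree is also a sum over the zeros of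
`ψ`; near each zero `ψ` may be replaced by its derivative, and every term equals the degree of `e`.
A sum of copies of the degree of `e` equals 1, so that degree is not 0. -/
theorem degree_openPartialHomeomorph (e : OpenPartialHomeomorph (Euc n) (Euc n)) {x : Euc n}
    (hxe : e x = 0) {W : Set (Euc n)} (hW : IsOpen W) (hWb : Bornology.IsBounded W) (hxW : x ∈ W)
    (hWe : closure W ⊆ e.source) : degree e W = 1 := by
  classical
  have hWe' : W ⊆ e.source := subset_closure.trans hWe
  have hxs : x ∈ e.source := hWe' hxW
  have h0t : (0 : Euc n) ∈ e.target := hxe ▸ e.map_source hxs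
  have hsx : e.symm 0 = x := by rw [← hxe, e.left_inv hxs]
  have hadm : Admissible e W := ⟨hW, hWb, e.continuousOn.mono hWe, fun z hz hz0 => by
    have : z = x := e.injOn (hWe (frontier_subset_closure hz)) hxs (hz0.trans hxe.symm)
    subst this
    rw [hW.frontier_eq] at hz
    exact hz.2 hxW⟩
  have himg : IsOpen (e '' W) := e.isOpen_image_of_subset_source hW hWe'
  obtain ⟨ρ, hρ, hball⟩ := Metric.nhds_basis_closedBall.mem_iff.1
    (himg.mem_nhds ⟨x, hxW, hxe⟩)
  have hKt : Metric.closedBall (0 : Euc n) ρ ⊆ e.target := by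
    rintro u hu
    obtain ⟨w, hw, rfl⟩ := hball hu
    exact e.map_source (hWe' hw)
  have hKW : ∀ u ∈ Metric.closedBall (0 : Euc n) ρ, e.symm u ∈ W := by
    intro u hu
    obtain ⟨w, hw, rfl⟩ := hball hu
    rwa [e.left_inv (hWe' hw)]
  let V : Euc n → ℝ → Set (Euc n) := fun q r => e.symm '' Metric.ball q r
  have hVopen : ∀ q r, Metric.closedBall q r ⊆ Metric.closedBall (0 : Euc n) ρ →
      IsOpen (V q r) := fun q r hq => e.symm.isOpen_image_of_subset_source Metric.isOpen_ball
        (Metric.ball_subset_closedBall.trans (hq.trans hKt))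
  have hVcl : ∀ q r, Metric.closedBall q r ⊆ Metric.closedBall (0 : Euc n) ρ →
      closure (V q r) ⊆ e.symm '' Metric.closedBall q r := by
    intro q r hq
    refine closure_minimal (image_mono Metric.ball_subset_closedBall) (IsCompact.isClosed ?_)
    exact (isCompact_closedBall q r).image_of_continuousOn
      (e.symm.continuousOn.mono (hq.trans hKt))
  have hVfr : ∀ q r, Metric.closedBall q r ⊆ Metric.closedBall (0 : Euc n) ρ →
      ∀ z ∈ frontier (V q r), ∃ u ∈ Metric.closedBall q r, e.symm u = z ∧ ‖u - q‖ = r := by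
    intro q r hq z hz
    obtain ⟨u, hu, rfl⟩ := hVcl q r hq (frontier_subset_closure hz)
    refine ⟨u, hu, rfl, ?_⟩
    rw [(hVopen q r hq).frontier_eq] at hz
    rw [← dist_eq_norm]
    refine le_antisymm hu ?_
    by_contra h
    exact hz.2 ⟨u, not_le.1 h, rfl⟩
  have hVW : ∀ q r, Metric.closedBall q r ⊆ Metric.closedBall (0 : Euc n) ρ → V q r ⊆ W := by
    rintro q r hq _ ⟨u, hu, rfl⟩
    exact hKW u (hq (Metric.ball_subset_closedBall hu))
  have heV : ∀ u ∈ Metric.closedBall (0 : Euc n) ρ, e (e.symm u) = u := fun u hu =>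
    e.right_inv (hKt hu)
  set Ω := V 0 ρ with hΩdef
  have hΩopen := hVopen 0 ρ subset_rfl
  have hΩW := hVW 0 ρ subset_rfl
  have hΩb : Bornology.IsBounded Ω := hWb.subset hΩW
  have hΩsrc : closure Ω ⊆ e.source := (closure_mono hΩW).trans hWe
  have hΩfr := hVfr 0 ρ subset_rfl
  have hxΩ : x ∈ Ω := ⟨0, Metric.mem_ball_self hρ, hsx⟩
  have hD : degree e W = degree e Ω := degree_eq_of_subset hadm hΩopen hΩW
    fun z hz hzΩ h0 => hzΩ (by
      rwa [e.injOn (hWe hz) hxs (h0.trans hxe.symm)])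
  have hadmΩ : Admissible e Ω := ⟨hΩopen, hΩb, e.continuousOn.mono hΩsrc, fun z hz h0 => by
    obtain ⟨u, hu, rfl, hur⟩ := hΩfr z hz
    rw [heV u hu] at h0
    rw [h0, sub_zero, norm_zero] at hur
    exact hρ.ne hur⟩
  rw [hD]
  set K := Metric.closedBall (0 : Euc n) ρ with hK
  have hcont : ContinuousOn (fun u => e.symm u - x) K :=
    (e.symm.continuousOn.mono hKt).sub continuousOn_const
  -- The admissible error: smaller than the distance from `e.symm u` to `x` for all `u` on the
  -- bounding sphere.
  obtain ⟨ε, hε, hεm⟩ := (isCompact_sphere (0 : Euc n) ρ).exists_forall_le'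
    (f := fun u => ‖e.symm u - x‖) (hcont.mono Metric.sphere_subset_closedBall).norm (a := 0)
    fun u hu => norm_pos_iff.2 (sub_ne_zero.2 fun h => by
      have h1 := heV u (Metric.sphere_subset_closedBall hu)
      rw [h, hxe] at h1
      rw [← h1] at hu
      simp at hu
      exact hρ.ne hu)
  obtain ⟨ψ, hψ, hψε, hψreg⟩ := exists_regular_approx Metric.isClosed_closedBall hcont hε
  have hψsphere : ∀ u ∈ Metric.sphere (0 : Euc n) ρ, ψ u ≠ 0 := by
    intro u hu h0
    have h1 := hψε u (Metric.sphere_subset_closedBall hu)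
    rw [h0, zero_sub, norm_neg] at h1
    exact absurd (hεm u hu) (not_le.2 h1)
  have hψcont : ContinuousOn (fun z => ψ (e z)) (closure Ω) :=
    hψ.continuous.comp_continuousOn (e.continuousOn.mono hΩsrc)
  have hidadm : Admissible (fun z : Euc n => z - x) Ω := ⟨hΩopen, hΩb, by fun_prop,
    fun z hz h0 => by
      rw [sub_eq_zero] at h0
      subst h0
      rw [hΩopen.frontier_eq] at hz
      exact hz.2 hxΩ⟩
  have hclose1 : ∀ z ∈ frontier Ω, ‖(z - x) - ψ (e z)‖ < ‖z - x‖ := by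
    intro z hz
    obtain ⟨u, hu, rfl, hur⟩ := hΩfr z hz
    rw [heV u hu, norm_sub_rev]
    exact (hψε u hu).trans_le (hεm u (by simpa using hur))
  have hone : degree (fun z => ψ (e z)) Ω = 1 := by
    rw [← degree_eq_of_close hidadm hψcont hclose1]
    exact degree_sub_const hΩopen hΩb hxΩ
  have hψadm : Admissible (fun z => ψ (e z)) Ω := hidadm.of_close hψcont hclose1
  let A : ∀ u, ψ u = 0 → (Euc n ≃L[ℝ] Euc n) := fun u hu =>
    (fderiv ℝ ψ u).toContinuousLinearEquivOfDetNeZero (hψreg u hu)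
  have hA : ∀ u (hu : ψ u = 0), HasFDerivAt ψ (A u hu : Euc n →L[ℝ] Euc n) u := fun u hu => by
    simp only [A, ContinuousLinearMap.coe_toContinuousLinearEquivOfDetNeZero]
    exact (hψ.differentiable one_ne_zero u).hasFDerivAt
  have hdom : ∀ u (hu : ψ u = 0), ∃ r > 0, ∀ y, dist y u ≤ r → y ≠ u →
      ‖A u hu (y - u) - ψ y‖ < ‖A u hu (y - u)‖ := fun u hu => by
    obtain ⟨r, hr, h⟩ := Metric.nhds_basis_closedBall.eventually_iff.1
      (exists_linear_dominates (hA u hu) hu)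
    exact ⟨r, hr, fun y hy => h hy⟩
  choose R hR hRdom using hdom
  set Z := {u ∈ K | ψ u = 0} with hZ
  have hZfin : Z.Finite := by
    refine finite_of_isolated ?_ ?_
    · exact (isCompact_closedBall (0 : Euc n) ρ).inter_right
        (isClosed_singleton.preimage hψ.continuous)
    · rintro u ⟨hu, hu0⟩
      refine ⟨Metric.closedBall u (R u hu0), Metric.closedBall_mem_nhds _ (hR u hu0), ?_⟩
      rintro y ⟨hy, -, hy0⟩
      by_contra hne
      have := hRdom u hu0 y hy hne
      rw [hy0, sub_zero] at this
      exact lt_irrefl _ this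
  have hZball : ∀ u ∈ Z, ‖u‖ < ρ := by
    rintro u ⟨hu, hu0⟩
    refine lt_of_le_of_ne (by simpa [hK] using hu) fun h => hψsphere u (by simpa using h) hu0
  -- The factor 2 makes the balls around distinct zeros disjoint; the second bound keeps them inside
  -- the ball of radius `ρ`.
  obtain ⟨r, hr, hrR, hrρ⟩ : ∃ r : ℝ, 0 < r ∧ (∀ u (hu : u ∈ Z), 2 * r < R u hu.2) ∧
      ∀ u ∈ Z, ‖u‖ + r < ρ := by
    have h1 : ∀ᶠ r in 𝓝[>] (0 : ℝ), ∀ u ∈ hZfin.toFinset, (∀ hu : u ∈ Z, 2 * r < R u hu.2) ∧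
        ‖u‖ + r < ρ := by
      refine (Finset.eventually_all _).2 fun u hu => ?_
      have hu : u ∈ Z := by simpa using hu
      have h2 : ∀ᶠ r in 𝓝[>] (0 : ℝ), r < min (R u hu.2 / 2) (ρ - ‖u‖) :=
        (eventually_lt_nhds (lt_min (half_pos (hR u hu.2))
          (sub_pos.2 (hZball u hu)))).filter_mono nhdsWithin_le_nhds
      filter_upwards [h2] with r hr
      rw [lt_min_iff] at hr
      exact ⟨fun _ => by linarith [hr.1], by linarith [hr.2]⟩
    obtain ⟨r, h2, h3⟩ := (h1.and self_mem_nhdsWithin).exists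
    exact ⟨r, h3, fun u hu => (h2 u (by simpa using hu)).1 hu,
      fun u hu => (h2 u (by simpa using hu)).2⟩
  have hsubK : ∀ u ∈ Z, Metric.closedBall u r ⊆ K := by
    intro u hu y hy
    rw [hK, Metric.mem_closedBall, dist_zero_right]
    have h1 := norm_add_le u (y - u)
    rw [Metric.mem_closedBall, dist_eq_norm] at hy
    rw [add_sub_cancel] at h1
    linarith [hrρ u hu]
  have hsubΩ : ∀ u ∈ Z, V u r ⊆ Ω := by
    rintro u hu _ ⟨y, hy, rfl⟩
    refine ⟨y, ?_, rfl⟩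
    rw [Metric.mem_ball, dist_zero_right]
    have h1 := norm_add_le u (y - u)
    rw [Metric.mem_ball, dist_eq_norm] at hy
    rw [add_sub_cancel] at h1
    linarith [hrρ u hu]
  have hsum := degree_eq_sum (s := hZfin.toFinset) (W := fun u => V u r) hψadm
    (fun u hu => hVopen u r (hsubK u (by simpa using hu)))
    (fun u hu => hsubΩ u (by simpa using hu))
    (by
      intro u hu u' hu' hne
      have hu : u ∈ Z := by simpa using hu
      have hu' : u' ∈ Z := by simpa using hu'
      rw [Set.disjoint_left]
      rintro _ ⟨y, hy, rfl⟩ ⟨y', hy', hyy⟩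
      have hyy' : y' = y := e.symm.injOn (hKt (hsubK u' hu' (Metric.ball_subset_closedBall hy')))
        (hKt (hsubK u hu (Metric.ball_subset_closedBall hy))) hyy
      subst hyy'
      have h1 := dist_triangle_left u' u y'
      rw [Metric.mem_ball] at hy hy'
      have h2 := hRdom u hu.2 u' (by linarith [hrR u hu]) hne.symm
      rw [hu'.2, sub_zero] at h2
      exact lt_irrefl _ h2)
    (by
      intro z hz hzn h0
      obtain ⟨u, hu, rfl⟩ := hVcl 0 ρ subset_rfl hz
      rw [heV u hu] at h0
      exact hzn u (by simpa using ⟨hu, h0⟩) ⟨u, Metric.mem_ball_self hr, rfl⟩)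
  have heach : ∀ u ∈ hZfin.toFinset, degree (fun z => ψ (e z)) (V u r) = degree e Ω := by
    intro u hu
    have hu : u ∈ Z := by simpa using hu
    have hfr := hVfr u r (hsubK u hu)
    have hsrc : closure (V u r) ⊆ e.source := (closure_mono (hsubΩ u hu)).trans hΩsrc
    have hshift : Admissible (fun z => e z - u) Ω := ⟨hΩopen, hΩb,
      (e.continuousOn.mono hΩsrc).sub continuousOn_const, fun z hz h0 => by
        obtain ⟨w, hw, rfl, hwr⟩ := hΩfr z hz
        rw [heV w hw, sub_eq_zero] at h0
        rw [h0, sub_zero] at hwr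
        exact (hZball u hu).ne hwr⟩
    have hshiftV : Admissible (fun z => e z - u) (V u r) := ⟨hVopen u r (hsubK u hu),
      hΩb.subset (hsubΩ u hu), (e.continuousOn.mono hsrc).sub continuousOn_const,
      fun z hz h0 => by
        obtain ⟨w, hw, rfl, hwr⟩ := hfr z hz
        rw [heV w (hsubK u hu hw)] at h0
        rw [h0, norm_zero] at hwr
        exact hr.ne hwr⟩
    have h1 : degree (fun z => A u hu.2 (e z - u)) (V u r) = degree (fun z => ψ (e z)) (V u r) := by
      refine degree_eq_of_close ⟨hshiftV.isOpen, hshiftV.bounded,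
        (A u hu.2).continuous.comp_continuousOn hshiftV.cont, fun z hz h0 =>
          hshiftV.ne_zero z hz ((A u hu.2).map_eq_zero_iff.1 h0)⟩ (hψcont.mono (closure_mono (hsubΩ u hu))) ?_
      intro z hz
      obtain ⟨w, hw, rfl, hwr⟩ := hfr z hz
      rw [heV w (hsubK u hu hw)]
      refine hRdom u hu.2 w ?_ ?_
      · rw [dist_eq_norm, hwr]
        linarith [hrR u hu]
      · rintro rfl
        rw [sub_self, norm_zero] at hwr
        exact hr.ne hwr
    have h2 := degree_linear_comp (A u hu.2) hshiftV
    have h3 : degree (fun z => e z - u) Ω = degree (fun z => e z - u) (V u r) := by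
      refine degree_eq_of_subset hshift hshiftV.isOpen (hsubΩ u hu) ?_
      intro z hz hzV h0
      rw [sub_eq_zero] at h0
      refine hzV ⟨u, Metric.mem_ball_self hr, ?_⟩
      rw [← h0, e.left_inv (hΩsrc hz)]
    -- On the frontier `e` has norm `ρ`, which exceeds the norm of the shift `u`.
    have h4 : degree e Ω = degree (fun z => e z - u) Ω := by
      refine degree_eq_of_close hadmΩ hshift.cont ?_
      intro z hz
      obtain ⟨w, hw, rfl, hwr⟩ := hΩfr z hz
      rw [heV w hw, sub_sub_cancel]
      rw [sub_zero] at hwr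
      rw [hwr]
      exact hZball u hu
    rw [← h1, h2, ← h3, ← h4]
  rw [hone, Finset.sum_congr rfl heach, Finset.sum_const] at hsum
  by_contra hne
  have h0 : degree e Ω = 0 := (show ∀ a : ZMod 2, a ≠ 1 → a = 0 by decide) _ hne
  rw [h0, smul_zero] at hsum
  exact one_ne_zero hsum

end Regular

end ModTwo

namespace ModTwo

open Set Function Filter Topology MeasureTheory
open scoped Pointwise ContDiff

/-! ### Counting zeros in a chart of a manifold -/

section Manifold

variable {n : ℕ}

lemma degree_congr {g g' : Euc n → Euc n} {Ω : Set (Euc n)} (h : EqOn g g' Ω) :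
    degree g Ω = degree g' Ω := by
  classical
  have : ∀ t y, count g Ω t y = count g' Ω t y := by
    intro t y
    unfold count cellCount
    congr 1
    funext v
    refine Finset.sum_congr rfl fun π _ => ?_
    split_ifs with hX
    · exact cell_congr fun j => by rw [h (hX j)]
    · rfl
  unfold degree
  simp only [this]

variable {M : Type*} [TopologicalSpace M]

/-- Near `x` the map `g` is a homeomorphism onto an open set. -/
def LocHomeoAt (g : M → Euc n) (x : M) : Prop :=
  ∃ e : OpenPartialHomeomorph M (Euc n), x ∈ e.source ∧ ∀ y ∈ e.source, e y = g y

lemma LocHomeoAt.congr {g g' : M → Euc n} {x : M} (h : LocHomeoAt g x) {U : Set M} (hU : IsOpen U)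
    (hx : x ∈ U) (hUg : EqOn g g' U) : LocHomeoAt g' x := by
  obtain ⟨e, hxe, he⟩ := h
  refine ⟨e.restrOpen U hU, ⟨hxe, hx⟩, ?_⟩
  rintro y ⟨hy, hyU⟩
  rw [← hUg hyU, ← he y hy]
  rfl

lemma LocHomeoAt.isolated {g : M → Euc n} {x : M} (h : LocHomeoAt g x) :
    ∃ U ∈ 𝓝 x, ∀ y ∈ U, g y = g x → y = x := by
  obtain ⟨e, hxe, he⟩ := h
  refine ⟨e.source, e.open_source.mem_nhds hxe, fun y hy hxy => e.injOn hy hxe ?_⟩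
  rw [he y hy, he x hxe, hxy]

/-- Cut the degree down to small balls around the finitely many zeros; each contributes 1 by
`degree_openPartialHomeomorph`. -/
theorem degree_chart_eq_ncard [T2Space M] (ψ : OpenPartialHomeomorph M (Euc n)) {O : Set M}
    (hO : IsOpen O) (hOc : IsCompact (closure O)) (hOψ : closure O ⊆ ψ.source) {g : M → Euc n}
    (hg : Continuous g) (hfr : ∀ x ∈ frontier O, g x ≠ 0) (hfin : {x ∈ O | g x = 0}.Finite)
    (hloc : ∀ x ∈ O, g x = 0 → LocHomeoAt g x) :
    Admissible (fun z => g (ψ.symm z)) (ψ '' O) ∧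
      degree (fun z => g (ψ.symm z)) (ψ '' O) = ({x ∈ O | g x = 0}.ncard : ZMod 2) := by
  classical
  have hOψ' : O ⊆ ψ.source := subset_closure.trans hOψ
  have hopen : IsOpen (ψ '' O) := ψ.isOpen_image_of_subset_source hO hOψ'
  have hcpt : IsCompact (ψ '' closure O) := hOc.image_of_continuousOn (ψ.continuousOn.mono hOψ)
  have hcl : closure (ψ '' O) ⊆ ψ '' closure O :=
    closure_minimal (image_mono subset_closure) hcpt.isClosed
  have hcltgt : closure (ψ '' O) ⊆ ψ.target := hcl.trans (by
    rintro _ ⟨x, hx, rfl⟩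
    exact ψ.map_source (hOψ hx))
  have hadm : Admissible (fun z => g (ψ.symm z)) (ψ '' O) := by
    refine ⟨hopen, hcpt.isBounded.subset (image_mono subset_closure),
      hg.comp_continuousOn (ψ.symm.continuousOn.mono hcltgt), ?_⟩
    intro z hz
    obtain ⟨x, hx, rfl⟩ := hcl (frontier_subset_closure hz)
    rw [hopen.frontier_eq] at hz
    rw [ψ.left_inv (hOψ hx)]
    refine hfr x ?_
    rw [hO.frontier_eq]
    exact ⟨hx, fun hxO => hz.2 ⟨x, hxO, rfl⟩⟩
  refine ⟨hadm, ?_⟩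
  set T := {x ∈ O | g x = 0} with hT
  have hR : ∀ x ∈ T, ∃ r > 0, ∃ e : OpenPartialHomeomorph (Euc n) (Euc n), e (ψ x) = 0 ∧
      Metric.closedBall (ψ x) r ⊆ e.source ∧ Metric.closedBall (ψ x) r ⊆ ψ '' O ∧
      ∀ z ∈ e.source, e z = g (ψ.symm z) := by
    rintro x ⟨hxO, hx0⟩
    obtain ⟨e, hxe, he⟩ := hloc x hxO hx0
    have hsrc : ψ x ∈ (ψ.symm.trans e).source := by
      rw [OpenPartialHomeomorph.trans_source]
      exact ⟨ψ.map_source (hOψ' hxO), by simpa [ψ.left_inv (hOψ' hxO)] using hxe⟩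
    obtain ⟨r, hr, hball⟩ := Metric.nhds_basis_closedBall.mem_iff.1
      (((ψ.symm.trans e).open_source.inter hopen).mem_nhds ⟨hsrc, x, hxO, rfl⟩)
    have hval : ∀ z ∈ (ψ.symm.trans e).source, (ψ.symm.trans e) z = g (ψ.symm z) := by
      intro z hz
      rw [OpenPartialHomeomorph.trans_source] at hz
      exact he _ hz.2
    refine ⟨r, hr, ψ.symm.trans e, ?_, hball.trans inter_subset_left,
      hball.trans inter_subset_right, hval⟩
    rw [hval _ hsrc, ψ.left_inv (hOψ' hxO), hx0]
  have : Nonempty (OpenPartialHomeomorph (Euc n) (Euc n)) := ⟨OpenPartialHomeomorph.refl _⟩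
  choose! R hR0 E hE0 hEsrc hRO hEval using hR
  obtain ⟨r, hr, hrR⟩ : ∃ r : ℝ, 0 < r ∧ ∀ x ∈ T, 2 * r < R x := by
    have h1 : ∀ᶠ r in 𝓝[>] (0 : ℝ), ∀ x ∈ hfin.toFinset, 2 * r < R x := by
      refine (Finset.eventually_all _).2 fun x hx => ?_
      have hx : x ∈ T := by simpa using hx
      have h2 : ∀ᶠ r in 𝓝[>] (0 : ℝ), r < R x / 2 :=
        (eventually_lt_nhds (half_pos (hR0 x hx))).filter_mono nhdsWithin_le_nhds
      filter_upwards [h2] with r hr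
      linarith
    obtain ⟨r, h2, h3⟩ := (h1.and self_mem_nhdsWithin).exists
    exact ⟨r, h3, fun x hx => h2 x (by simpa using hx)⟩
  have hsub : ∀ x ∈ T, Metric.closedBall (ψ x) r ⊆ Metric.closedBall (ψ x) (R x) := fun x hx =>
    Metric.closedBall_subset_closedBall (by linarith [hrR x hx])
  have hsum := degree_eq_sum (s := hfin.toFinset) (W := fun x => Metric.ball (ψ x) r) hadm
    (fun _ _ => Metric.isOpen_ball)
    (fun x hx => by
      have hx : x ∈ T := by simpa using hx
      exact Metric.ball_subset_closedBall.trans ((hsub x hx).trans (hRO x hx)))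
    (by
      intro x hx x' hx' hne
      have hx : x ∈ T := by simpa using hx
      have hx' : x' ∈ T := by simpa using hx'
      rw [Set.disjoint_left]
      intro z hz hz'
      have h1 := dist_triangle_left (ψ x') (ψ x) z
      rw [Metric.mem_ball] at hz hz'
      have h2 : ψ x' ∈ Metric.closedBall (ψ x) (R x) := by
        rw [Metric.mem_closedBall]
        linarith [hrR x hx]
      have h3 : E x (ψ x') = 0 := by
        rw [hEval x hx _ (hEsrc x hx h2), ψ.left_inv (hOψ' hx'.1), hx'.2]
      have h4 := (E x).injOn (hEsrc x hx h2)
        (hEsrc x hx (Metric.mem_closedBall_self (hR0 x hx).le)) (h3.trans (hE0 x hx).symm)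
      exact hne (ψ.injOn (hOψ' hx.1) (hOψ' hx'.1) h4.symm))
    (by
      intro z hz hzn h0
      obtain ⟨x, hx, rfl⟩ := hcl hz
      rw [ψ.left_inv (hOψ hx)] at h0
      have hxO : x ∈ O := by
        by_contra hxO
        refine hfr x ?_ h0
        rw [hO.frontier_eq]
        exact ⟨hx, hxO⟩
      exact hzn x (by simpa using ⟨hxO, h0⟩) (Metric.mem_ball_self hr))
  rw [hsum, Finset.sum_congr rfl (g := fun _ => (1 : ZMod 2))]
  · rw [Finset.sum_const, ncard_eq_toFinset_card _ hfin]
    simp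
  · intro x hx
    have hx : x ∈ T := by simpa using hx
    have hball : closure (Metric.ball (ψ x) r) ⊆ (E x).source :=
      Metric.closure_ball_subset_closedBall.trans ((hsub x hx).trans (hEsrc x hx))
    rw [← degree_openPartialHomeomorph (E x) (hE0 x hx) Metric.isOpen_ball Metric.isBounded_ball
      (Metric.mem_ball_self hr) hball]
    exact degree_congr fun z hz => (hEval x hx z (hball (subset_closure hz))).symm

theorem ncard_zeros_eq_of_close [T2Space M] (ψ : OpenPartialHomeomorph M (Euc n)) {O : Set M}
    (hO : IsOpen O) (hOc : IsCompact (closure O)) (hOψ : closure O ⊆ ψ.source) {g g' : M → Euc n}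
    (hg : Continuous g) (hg' : Continuous g') (hfr : ∀ x ∈ frontier O, ‖g x - g' x‖ < ‖g x‖)
    (hfin : {x ∈ O | g x = 0}.Finite) (hloc : ∀ x ∈ O, g x = 0 → LocHomeoAt g x)
    (hfin' : {x ∈ O | g' x = 0}.Finite) (hloc' : ∀ x ∈ O, g' x = 0 → LocHomeoAt g' x) :
    ({x ∈ O | g x = 0}.ncard : ZMod 2) = {x ∈ O | g' x = 0}.ncard := by
  obtain ⟨h1, h2⟩ := degree_chart_eq_ncard ψ hO hOc hOψ hg
    (fun x hx h => by have := hfr x hx; simp [h] at this; exact absurd this (norm_nonneg _).not_gt)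
    hfin hloc
  obtain ⟨h1', h2'⟩ := degree_chart_eq_ncard ψ hO hOc hOψ hg'
    (fun x hx h => by simpa [h] using hfr x hx) hfin' hloc'
  rw [← h2, ← h2']
  refine degree_eq_of_close h1 h1'.cont ?_
  intro z hz
  have hOψ' : O ⊆ ψ.source := subset_closure.trans hOψ
  have hcl : closure (ψ '' O) ⊆ ψ '' closure O := closure_minimal (image_mono subset_closure)
    (hOc.image_of_continuousOn (ψ.continuousOn.mono hOψ)).isClosed
  obtain ⟨x, hx, rfl⟩ := hcl (frontier_subset_closure hz)
  rw [h1.isOpen.frontier_eq] at hz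
  rw [ψ.left_inv (hOψ hx)]
  refine hfr x ?_
  rw [hO.frontier_eq]
  exact ⟨hx, fun hxO => hz.2 ⟨x, hxO, rfl⟩⟩

/-! ### Maps to a punctured space and their positive zeros -/

/-- The points that `v` maps to the open positive half of the last axis. -/
def posZeros (v : M → Euc n × ℝ) : Set M := {x | (v x).1 = 0 ∧ 0 < (v x).2}

/-- `v` has no zeros and is a local homeomorphism, up to the last coordinate, at its positive
zeros. -/
structure Transverse (v : C(M, Euc n × ℝ)) : Prop where
  ne_zero : ∀ x, v x ≠ 0
  loc : ∀ x ∈ posZeros v, LocHomeoAt (fun y => (v y).1) x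

/-- As `v` has no zeros, the strict inequality may be replaced by a weak one. -/
lemma isClosed_posZeros {v : C(M, Euc n × ℝ)} (hv : ∀ x, v x ≠ 0) : IsClosed (posZeros v) := by
  have : posZeros v = {x | (v x).1 = 0} ∩ {x | 0 ≤ (v x).2} := by
    ext x
    refine ⟨fun h => ⟨h.1, h.2.le⟩, fun h => ⟨h.1, lt_of_le_of_ne h.2 fun h' => hv x ?_⟩⟩
    exact Prod.ext h.1 h'.symm
  rw [this]
  exact (isClosed_eq (by fun_prop) continuous_const).inter (isClosed_le continuous_const
    (by fun_prop))

lemma Transverse.finite [CompactSpace M] {v : C(M, Euc n × ℝ)} (hv : Transverse v) :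
    (posZeros v).Finite := by
  refine finite_of_isolated (isClosed_posZeros hv.ne_zero).isCompact fun x hx => ?_
  obtain ⟨U, hU, h⟩ := (hv.loc x hx).isolated
  exact ⟨U, hU, fun y hy => h y hy.1 (hy.2.1.trans hx.1.symm)⟩

lemma locHomeoAt_comp_chart (ψ : OpenPartialHomeomorph M (Euc n)) {x : M} (hx : x ∈ ψ.source)
    {φ : Euc n → Euc n} (hφ : ContDiff ℝ 1 φ) (hdet : (fderiv ℝ φ (ψ x)).det ≠ 0) :
    LocHomeoAt (fun y => φ (ψ y)) x := by
  have hs : HasStrictFDerivAt φ (((fderiv ℝ φ (ψ x)).toContinuousLinearEquivOfDetNeZero hdet :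
      Euc n ≃L[ℝ] Euc n) : Euc n →L[ℝ] Euc n) (ψ x) := by
    rw [ContinuousLinearMap.coe_toContinuousLinearEquivOfDetNeZero]
    exact hφ.contDiffAt.hasStrictFDerivAt one_ne_zero
  refine ⟨ψ.trans (hs.toOpenPartialHomeomorph φ), ?_, fun y _ => rfl⟩
  rw [OpenPartialHomeomorph.trans_source]
  exact ⟨hx, hs.mem_toOpenPartialHomeomorph_source⟩

variable [CompactSpace M] [T2Space M]

/-- Within one chart, replace the first component of `u` by a regular approximation, blended in by a
cutoff. In the blending region there are no positive zeros to disturb, away from it nothing changes,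
and in the chart the parity is kept by `ncard_zeros_eq_of_close`. -/
theorem exists_transverse_move (ψ : OpenPartialHomeomorph M (Euc n)) {K : Set M}
    (hK : IsClosed K) (hKψ : K ⊆ ψ.source) {v u : C(M, Euc n × ℝ)} (hv : Transverse v) {δ : ℝ}
    (hδ : 0 < δ) (hvδ : ∀ x, δ ≤ ‖v x‖) (huv : ∀ x, x ∉ K → u x = v x)
    (hclose : ∀ x, ‖u x - v x‖ ≤ δ / 8) {ε : ℝ} (hε : 0 < ε) :
    ∃ w : C(M, Euc n × ℝ), Transverse w ∧ (∀ x, ‖w x - u x‖ < ε) ∧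
      ((posZeros w).ncard : ZMod 2) = (posZeros v).ncard := by
  wlog hεδ : ε ≤ δ / 8 generalizing ε
  · obtain ⟨w, h1, h2, h3⟩ := this (ε := min ε (δ / 8)) (by positivity) (min_le_right _ _)
    exact ⟨w, h1, fun x => (h2 x).trans_le (min_le_left _ _), h3⟩
  -- The positive zeros off `K` are removed from the chart domain before the nested neighbourhoods
  -- of `K` are chosen, so that none of them lies where the cutoff varies.
  have hFfin : (posZeros v \ K).Finite := hv.finite.subset sdiff_subset
  have hUopen : IsOpen (ψ.source \ (posZeros v \ K)) := ψ.open_source.sdiff hFfin.isClosed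
  obtain ⟨O, hO, hKO, hOU⟩ := normal_exists_closure_subset hK hUopen
    fun x hx => ⟨hKψ hx, fun h => h.2 hx⟩
  obtain ⟨N, hN, hKN, hNO⟩ := normal_exists_closure_subset hK hO hKO
  obtain ⟨O₂, hO₂, hOO₂, hO₂U⟩ := normal_exists_closure_subset isClosed_closure hUopen hOU
  obtain ⟨lam, hl0, hl1, hl01⟩ := exists_continuous_zero_one_of_isClosed hO.isClosed_compl
    (isClosed_closure (s := N)) (by
      rw [Set.disjoint_left]
      exact fun x hx hx' => hx (hNO hx'))
  have hOψ : closure O ⊆ ψ.source := hOU.trans sdiff_subset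
  have hNO' : N ⊆ O := subset_closure.trans hNO
  have hKcpt : IsCompact (ψ '' closure O) :=
    isClosed_closure.isCompact.image_of_continuousOn (ψ.continuousOn.mono hOψ)
  have hnoz : ∀ x ∈ closure O₂, x ∉ K → x ∉ posZeros v := fun x hx hxK hxp =>
    (hO₂U hx).2 ⟨hxp, hxK⟩
  have hOO₂' : closure O ⊆ closure O₂ := hOO₂.trans subset_closure
  -- A correction smaller than `η` creates no positive zeros in the blending region.
  obtain ⟨η, hη, hηm⟩ : ∃ η, 0 < η ∧ ∀ x ∈ (closure O \ N) ∩ {x | 0 ≤ (u x).2}, η ≤ ‖(u x).1‖ := by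
    refine IsCompact.exists_forall_le' (f := fun x => ‖(u x).1‖) (a := 0) ?_ (by fun_prop) ?_
    · exact ((isClosed_closure.sdiff hN).inter
        (isClosed_le continuous_const (by fun_prop))).isCompact
    · rintro x ⟨⟨hxO, hxN⟩, hxs⟩
      have hxK : x ∉ K := fun h => hxN (hKN h)
      rw [norm_pos_iff]
      intro h0
      rw [mem_ofPred_eq] at hxs
      rw [huv x hxK] at h0 hxs
      refine hnoz x (hOO₂' hxO) hxK ⟨h0, lt_of_le_of_ne hxs fun h => hv.ne_zero x ?_⟩
      exact Prod.ext h0 h.symm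
  obtain ⟨φ, hφ, hφu, hφreg⟩ := exists_regular_approx (φ := fun z => (u (ψ.symm z)).1)
    hKcpt.isClosed (by
      refine Continuous.comp_continuousOn (g := fun x => (u x).1) (by fun_prop) ?_
      refine ψ.symm.continuousOn.mono ?_
      rintro _ ⟨x, hx, rfl⟩
      exact ψ.map_source (hOψ hx)) (ε := min ε η) (by positivity)
  have hφu' : ∀ x ∈ closure O, ‖φ (ψ x) - (u x).1‖ < min ε η := by
    intro x hx
    have := hφu _ ⟨x, hx, rfl⟩
    simpa only [ψ.left_inv (hOψ hx)] using this
  have hl0' : ∀ x, x ∉ O → lam x = 0 := fun x hx => hl0 hx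
  have hcorr : Continuous fun x => lam x • (φ (ψ x) - (u x).1) := by
    rw [continuous_iff_continuousAt]
    intro x
    by_cases hx : x ∈ ψ.source
    · have h1 : ContinuousAt (fun x => φ (ψ x)) x :=
        (hφ.continuous.continuousAt).comp (ψ.continuousAt hx)
      exact lam.continuous.continuousAt.smul (h1.sub (by fun_prop))
    · have hx' : x ∈ (closure O)ᶜ := fun h => hx (hOψ h)
      refine (continuousAt_const (y := (0 : Euc n))).congr ?_
      filter_upwards [isClosed_closure.isOpen_compl.mem_nhds hx'] with y hy
      rw [hl0' y fun h => hy (subset_closure h), zero_smul]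
  have hcorr_le : ∀ x ∈ closure O, ‖lam x • (φ (ψ x) - (u x).1)‖ < min ε η := by
    intro x hx
    rw [norm_smul, Real.norm_eq_abs, abs_of_nonneg (hl01 x).1]
    refine lt_of_le_of_lt ?_ (hφu' x hx)
    exact mul_le_of_le_one_left (norm_nonneg _) (hl01 x).2
  let w : C(M, Euc n × ℝ) := ⟨fun x => ((u x).1 + lam x • (φ (ψ x) - (u x).1), (u x).2),
    ((by fun_prop : Continuous fun x => (u x).1).add hcorr).prodMk (by fun_prop)⟩
  have hwoff : ∀ x, x ∉ O → w x = v x := by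
    intro x hx
    rw [← huv x fun h => hx (hKO h)]
    simp [w, hl0' x hx]
  have hwu : ∀ x, ‖w x - u x‖ < ε := by
    intro x
    by_cases hx : x ∈ O
    · have := (hcorr_le x (subset_closure hx)).trans_le (min_le_left _ _)
      simpa [w, Prod.norm_def, hε] using this
    · rw [hwoff x hx, ← huv x fun h => hx (hKO h), sub_self, norm_zero]
      exact hε
  have hwv : ∀ x, ‖w x - v x‖ < δ / 4 := by
    intro x
    have h1 := norm_add_le (w x - u x) (u x - v x)
    rw [sub_add_sub_cancel] at h1
    linarith [hwu x, hclose x]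
  have hwδ : ∀ x, 3 * δ / 4 < ‖w x‖ := by
    intro x
    have h1 := norm_sub_norm_le (v x) (w x)
    rw [norm_sub_rev] at h1
    linarith [hwv x, hvδ x]
  have hwt : Transverse w := by
    refine ⟨fun x h => ?_, fun x hx => ?_⟩
    · have := hwδ x
      rw [h, norm_zero] at this
      linarith
    · by_cases hxO : x ∈ closure O
      · by_cases hxN : x ∈ N
        · have hval : EqOn (fun y => φ (ψ y)) (fun y => (w y).1) N := by
            intro y hy
            have : lam y = 1 := hl1 (subset_closure hy)
            simp [w, this]
          have h0 : φ (ψ x) = 0 := (hval hxN).trans hx.1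
          exact (locHomeoAt_comp_chart ψ (hOψ hxO) hφ (hφreg _ h0)).congr hN hxN hval
        · exfalso
          have h1 := hηm x ⟨⟨hxO, hxN⟩, hx.2.le⟩
          have h2 := (hcorr_le x hxO).trans_le (min_le_right _ _)
          have h3 : (u x).1 = -(lam x • (φ (ψ x) - (u x).1)) := eq_neg_of_add_eq_zero_left hx.1
          rw [h3, norm_neg] at h1
          linarith
      · have hopen : IsOpen (closure O)ᶜ := isClosed_closure.isOpen_compl
        have hval : EqOn (fun y => (v y).1) (fun y => (w y).1) (closure O)ᶜ := fun y hy => by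
          simp only [hwoff y fun h => hy (subset_closure h)]
        refine (hv.loc x ?_).congr hopen hxO hval
        have := hwoff x fun h => hxO (subset_closure h)
        refine ⟨?_, ?_⟩
        · rw [← this]; exact hx.1
        · rw [← this]; exact hx.2
  refine ⟨w, hwt, hwu, ?_⟩
  -- The threshold separates the positive zeros, whose last coordinate is at least `δ` for `v` and
  -- above `3 * δ / 4` for `w`, from the frontier: where the last coordinate of `v` is `δ / 2`, its
  -- first component has norm at least `δ`.
  set D := O₂ ∩ {x | δ / 2 < (v x).2} with hD
  have hDopen : IsOpen D := hO₂.inter (isOpen_lt continuous_const (by fun_prop))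
  have hDcl : closure D ⊆ closure O₂ ∩ {x | δ / 2 ≤ (v x).2} :=
    closure_minimal (fun x hx => ⟨subset_closure hx.1, (show δ / 2 < (v x).2 from hx.2).le⟩)
      (isClosed_closure.inter (isClosed_le continuous_const (by fun_prop)))
  have hsnd : ∀ x, |(w x).2 - (v x).2| < δ / 4 := fun x =>
    lt_of_le_of_lt (le_max_right _ _) (hwv x)
  have hv2 : ∀ x ∈ posZeros v, δ ≤ (v x).2 := by
    intro x hx
    have := hvδ x
    rw [Prod.norm_def, hx.1, norm_zero, Real.norm_eq_abs, abs_of_pos hx.2,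
      max_eq_right hx.2.le] at this
    exact this
  have hw2 : ∀ x ∈ posZeros w, 3 * δ / 4 < (w x).2 := by
    intro x hx
    have := hwδ x
    rw [Prod.norm_def, hx.1, norm_zero, Real.norm_eq_abs, abs_of_pos hx.2,
      max_eq_right hx.2.le] at this
    exact this
  have hDv : {x ∈ D | (v x).1 = 0} = posZeros v ∩ O₂ := by
    ext x
    constructor
    · rintro ⟨⟨h1, h2⟩, h3⟩
      exact ⟨⟨h3, lt_trans (by positivity) h2⟩, h1⟩
    · rintro ⟨h1, h2⟩
      have := hv2 x h1
      exact ⟨⟨h2, show δ / 2 < (v x).2 by linarith⟩, h1.1⟩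
  have hDw : {x ∈ D | (w x).1 = 0} = posZeros w ∩ O₂ := by
    ext x
    have h4 := abs_lt.1 (hsnd x)
    constructor
    · rintro ⟨⟨h1, h2⟩, h3⟩
      have h2 : δ / 2 < (v x).2 := h2
      exact ⟨⟨h3, by linarith⟩, h1⟩
    · rintro ⟨h1, h2⟩
      have := hw2 x h1
      exact ⟨⟨h2, show δ / 2 < (v x).2 by linarith⟩, h1.1⟩
  have hmain := ncard_zeros_eq_of_close ψ hDopen isClosed_closure.isCompact
    ((hDcl.trans inter_subset_left).trans (hO₂U.trans sdiff_subset))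
    (g := fun x => (v x).1) (g' := fun x => (w x).1) (by fun_prop) (by fun_prop)
    (by
      intro x hx
      have hxc := hDcl (frontier_subset_closure hx)
      have hd : ‖(v x).1 - (w x).1‖ < δ / 4 := by
        rw [norm_sub_rev]
        exact lt_of_le_of_lt (le_max_left _ _) (hwv x)
      rcases eq_or_lt_of_le (show δ / 2 ≤ (v x).2 from hxc.2) with h | h
      · have h1 := hvδ x
        rw [Prod.norm_def, ← h, Real.norm_eq_abs, abs_of_pos (half_pos hδ), le_max_iff] at h1
        rcases h1 with h1 | h1 <;> linarith
      · have hxO₂ : x ∉ O₂ := fun h' => by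
          rw [hDopen.frontier_eq] at hx
          exact hx.2 ⟨h', h⟩
        have hxO : x ∉ O := fun h' => hxO₂ (hOO₂ (subset_closure h'))
        rw [hwoff x hxO, sub_self, norm_zero, norm_pos_iff]
        exact fun h0 => hnoz x hxc.1 (fun h' => hxO (hKO h')) ⟨h0, lt_trans (half_pos hδ) h⟩)
    (by rw [hDv]; exact hv.finite.subset inter_subset_left)
    (by
      intro x hx h0
      have : x ∈ posZeros v ∩ O₂ := hDv ▸ (⟨hx, h0⟩ : x ∈ {x ∈ D | (v x).1 = 0})
      exact hv.loc x this.1)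
    (by rw [hDw]; exact hwt.finite.subset inter_subset_left)
    (by
      intro x hx h0
      have : x ∈ posZeros w ∩ O₂ := hDw ▸ (⟨hx, h0⟩ : x ∈ {x ∈ D | (w x).1 = 0})
      exact hwt.loc x this.1)
  rw [hDv, hDw] at hmain
  have hoff : posZeros w \ O₂ = posZeros v \ O₂ := by
    ext x
    rw [Set.mem_sdiff, Set.mem_sdiff]
    refine and_congr_left fun hx => ?_
    change ((w x).1 = 0 ∧ 0 < (w x).2) ↔ ((v x).1 = 0 ∧ 0 < (v x).2)
    rw [hwoff x fun h => hx (hOO₂ (subset_closure h))]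
  rw [← ncard_inter_add_ncard_sdiff_eq_ncard (posZeros w) O₂ hwt.finite,
    ← ncard_inter_add_ncard_sdiff_eq_ncard (posZeros v) O₂ hv.finite, hoff]
  push_cast
  rw [hmain]

end Manifold

end ModTwo

namespace ModTwo

open Set Function Filter Topology MeasureTheory
open scoped Pointwise ContDiff unitInterval

/-! ### Maps homotopic to the identity of a closed manifold -/

section Surjective

variable {n : ℕ} {M : Type*} [TopologicalSpace M] [CompactSpace M] [T2Space M]

lemma exists_finite_charts [ChartedSpace (Euc n) M] : ∃ (q : ℕ)
    (ψ : Fin q → OpenPartialHomeomorph M (Euc n)) (χ : Fin q → C(M, ℝ)),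
    (∀ i, tsupport (χ i) ⊆ (ψ i).source) ∧ (∀ x, ∑ i, χ i x = 1) ∧ ∀ i x, 0 ≤ χ i x := by
  obtain ⟨t, ht⟩ := isCompact_univ.elim_finite_subcover
    (fun x : M => (chartAt (Euc n) x).source) (fun x => (chartAt (Euc n) x).open_source)
    (fun x _ => mem_iUnion.2 ⟨x, mem_chart_source _ x⟩)
  let e := t.equivFin
  obtain ⟨χ, h1, h2, h3, -⟩ := exists_continuous_sum_one_of_isOpen_isCompact
    (s := fun i => (chartAt (Euc n) (e.symm i : M)).source)
    (fun i => (chartAt (Euc n) _).open_source) (isCompact_univ (X := M)) (by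
      intro x hx
      obtain ⟨y, hy, hxy⟩ := mem_iUnion₂.1 (ht hx)
      exact mem_iUnion.2 ⟨e ⟨y, hy⟩, by simpa using hxy⟩)
  refine ⟨t.card, fun i => chartAt (Euc n) (e.symm i : M), χ, h1, fun x => ?_,
    fun i x => (h3 i x).1⟩
  have := h2 (mem_univ x)
  simpa using this

/-- A partition of unity divides the move from `v` to `v'` into moves supported in single charts,
each handled by `exists_transverse_move`. -/
theorem exists_transverse_close [ChartedSpace (Euc n) M] {v v' : C(M, Euc n × ℝ)}
    (hv : Transverse v) {δ : ℝ} (hδ : 0 < δ) (hvδ : ∀ x, δ ≤ ‖v x‖)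
    (hclose : ∀ x, ‖v' x - v x‖ ≤ δ / 16) {ε : ℝ} (hε : 0 < ε) :
    ∃ w : C(M, Euc n × ℝ), Transverse w ∧ (∀ x, ‖w x - v' x‖ < ε) ∧
      ((posZeros w).ncard : ZMod 2) = (posZeros v).ncard := by
  classical
  obtain ⟨q, ψ, χ, hχψ, hχ1, hχ0⟩ := exists_finite_charts (n := n) (M := M)
  have hχle : ∀ (S : Finset (Fin q)) x, ∑ i ∈ S, χ i x ≤ 1 := fun S x => by
    rw [← hχ1 x]
    exact Finset.sum_le_sum_of_subset_of_nonneg S.subset_univ fun i _ _ => hχ0 i x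
  have hχnn : ∀ (S : Finset (Fin q)) x, 0 ≤ ∑ i ∈ S, χ i x := fun S x =>
    Finset.sum_nonneg fun i _ => hχ0 i x
  have key : ∀ (S : Finset (Fin q)) (ε : ℝ), 0 < ε → ∃ w : C(M, Euc n × ℝ), Transverse w ∧
      (∀ x, ‖w x - (v x + (∑ i ∈ S, χ i x) • (v' x - v x))‖ < ε) ∧
      ((posZeros w).ncard : ZMod 2) = (posZeros v).ncard := by
    intro S
    induction S using Finset.induction_on with
    | empty => exact fun ε hε => ⟨v, hv, fun x => by simpa using hε, rfl⟩
    | insert j S hj ih =>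
      intro ε hε
      obtain ⟨w, hw, hwS, hwp⟩ := ih (min (ε / 2) (δ / 16)) (by positivity)
      have hwv : ∀ x, ‖w x - v x‖ ≤ δ / 8 := by
        intro x
        have h1 := norm_add_le (w x - (v x + (∑ i ∈ S, χ i x) • (v' x - v x)))
          ((∑ i ∈ S, χ i x) • (v' x - v x))
        have h2 : ‖(∑ i ∈ S, χ i x) • (v' x - v x)‖ ≤ δ / 16 := by
          rw [norm_smul, Real.norm_eq_abs, abs_of_nonneg (hχnn S x)]
          exact (mul_le_of_le_one_left (norm_nonneg _) (hχle S x)).trans (hclose x)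
        have h3 := (hwS x).trans_le (min_le_right _ _)
        have h4 : w x - (v x + (∑ i ∈ S, χ i x) • (v' x - v x))
          + (∑ i ∈ S, χ i x) • (v' x - v x) = w x - v x := by abel
        rw [h4] at h1
        linarith
      have hwδ : ∀ x, δ / 2 ≤ ‖w x‖ := by
        intro x
        have h1 := norm_sub_norm_le (v x) (w x)
        rw [norm_sub_rev] at h1
        linarith [hwv x, hvδ x]
      let u : C(M, Euc n × ℝ) := ⟨fun x => w x + χ j x • (v' x - v x), by fun_prop⟩
      obtain ⟨w', hw', hw'u, hw'p⟩ := exists_transverse_move (ψ j) (isClosed_tsupport (χ j))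
        (hχψ j) (u := u) hw (half_pos hδ) hwδ (fun x hx => by
          simp [u, image_eq_zero_of_notMem_tsupport hx]) (fun x => by
          have h2 : ‖χ j x • (v' x - v x)‖ ≤ δ / 16 := by
            rw [norm_smul, Real.norm_eq_abs, abs_of_nonneg (hχ0 j x)]
            have := hχle {j} x
            rw [Finset.sum_singleton] at this
            exact (mul_le_of_le_one_left (norm_nonneg _) this).trans (hclose x)
          have h3 : u x - w x = χ j x • (v' x - v x) := by simp [u]
          rw [h3]
          linarith) (half_pos hε)
      refine ⟨w', hw', fun x => ?_, hw'p.trans hwp⟩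
      have h1 := norm_add_le (w' x - u x) (w x - (v x + (∑ i ∈ S, χ i x) • (v' x - v x)))
      have h2 := (hwS x).trans_le (min_le_left _ _)
      have h4 : w' x - u x + (w x - (v x + (∑ i ∈ S, χ i x) • (v' x - v x)))
          = w' x - (v x + (∑ i ∈ insert j S, χ i x) • (v' x - v x)) := by
        rw [Finset.sum_insert hj, add_smul]
        simp only [u, ContinuousMap.coe_mk]
        abel
      rw [h4] at h1
      linarith [hw'u x]
  obtain ⟨w, h1, h2, h3⟩ := key Finset.univ ε hε
  refine ⟨w, h1, fun x => ?_, h3⟩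
  have := h2 x
  rwa [hχ1, one_smul, add_sub_cancel] at this

/-- The collapse of the complement of a chart neighbourhood of `p`: far from `p` the value is `(0,
-1)`, and near `p` it is the centred chart paired with 1. -/
lemma exists_collapse [ChartedSpace (Euc n) M] (p : M) : ∃ c : C(M, Euc n × ℝ),
    Transverse c ∧ posZeros c = {p} := by
  set ψ := chartAt (Euc n) p with hψ
  have hp : p ∈ ψ.source := mem_chart_source _ p
  obtain ⟨O, hO, hpO, hOψ⟩ := normal_exists_closure_subset (isClosed_singleton (x := p))
    ψ.open_source (by simpa using hp)
  obtain ⟨N, hN, hpN, hNO⟩ := normal_exists_closure_subset (isClosed_singleton (x := p)) hO hpO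
  obtain ⟨lam, hl0, hl1, hl01⟩ := exists_continuous_zero_one_of_isClosed hO.isClosed_compl
    (isClosed_closure (s := N)) (by
      rw [Set.disjoint_left]
      exact fun x hx hx' => hx (hNO hx'))
  have hcont : Continuous fun x => lam x • (ψ x - ψ p) := by
    rw [continuous_iff_continuousAt]
    intro x
    by_cases hx : x ∈ ψ.source
    · exact lam.continuous.continuousAt.smul ((ψ.continuousAt hx).sub continuousAt_const)
    · have hx' : x ∈ (closure O)ᶜ := fun h => hx (hOψ h)
      refine (continuousAt_const (y := (0 : Euc n))).congr ?_
      filter_upwards [isClosed_closure.isOpen_compl.mem_nhds hx'] with y hy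
      rw [show lam y = 0 from hl0 fun h => hy (subset_closure h), zero_smul]
  let c : C(M, Euc n × ℝ) := ⟨fun x => (lam x • (ψ x - ψ p), 2 * lam x - 1),
    hcont.prodMk (by fun_prop)⟩
  have hpN' : p ∈ N := hpN rfl
  have hlp : lam p = 1 := hl1 (subset_closure hpN')
  have hzero : ∀ x, (c x).1 = 0 → lam x ≠ 0 → x = p := by
    intro x hx hl
    have hxO : x ∈ O := by
      by_contra h
      exact hl (hl0 h)
    have h1 : ψ x - ψ p = 0 := (smul_eq_zero.1 hx).resolve_left hl
    exact ψ.injOn (hOψ (subset_closure hxO)) hp (sub_eq_zero.1 h1)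
  have hpos : posZeros c = {p} := by
    ext x
    constructor
    · rintro ⟨h1, h2⟩
      have h2 : 0 < 2 * lam x - 1 := h2
      exact hzero x h1 (by intro h; rw [h] at h2; linarith)
    · rintro rfl
      refine ⟨by simp [c], ?_⟩
      change 0 < 2 * lam x - 1
      rw [hlp]
      norm_num
  refine ⟨c, ⟨fun x hx => ?_, fun x hx => ?_⟩, hpos⟩
  · have h1 : 2 * lam x - 1 = 0 := congrArg Prod.snd hx
    have h2 := hzero x (congrArg Prod.fst hx) (by intro h; rw [h] at h1; linarith)
    rw [h2, hlp] at h1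
    norm_num at h1
  · rw [hpos, mem_singleton_iff] at hx
    subst hx
    have h1 : LocHomeoAt (fun y => ψ y - ψ x) x := by
      refine ⟨ψ.trans (Homeomorph.subRight (ψ x)).toOpenPartialHomeomorph, ?_, fun y _ => rfl⟩
      rw [OpenPartialHomeomorph.trans_source]
      exact ⟨hp, trivial⟩
    refine h1.congr hN hpN' fun y hy => ?_
    simp [c, show lam y = 1 from hl1 (subset_closure hy)]

/-- Compose the homotopy with the collapse at a missed point `p`. Having transverse approximations
with an odd number of positive zeros is locally constant in time; it holds for the collapse itself,
but fails at the end if `p` is not a value of `h`. -/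
theorem surjective_of_homotopy_id_aux [ChartedSpace (Euc n) M] {h : C(M, M)}
    (H : (ContinuousMap.id M).Homotopy h) : Surjective h := by
  intro p
  by_contra hp
  obtain ⟨c, hc, hcp⟩ := exists_collapse (n := n) p
  have hcpt : IsCompact (univ : Set M) := isCompact_univ
  obtain ⟨δ, hδ, hδc⟩ := hcpt.exists_forall_le' (f := fun x => ‖c x‖) (by fun_prop) (a := 0)
    fun x _ => norm_pos_iff.2 (hc.ne_zero x)
  let V : C(I, C(M, Euc n × ℝ)) := (c.comp H.toContinuousMap).curry
  have hV : ∀ t x, V t x = c (H (t, x)) := fun t x => rfl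
  have hVδ : ∀ t x, δ ≤ ‖V t x‖ := fun t x => hδc _ trivial
  let A : I → Prop := fun t => ∀ ε : ℝ, 0 < ε → ∃ w : C(M, Euc n × ℝ), Transverse w ∧
    (∀ x, ‖w x - V t x‖ < ε) ∧ ((posZeros w).ncard : ZMod 2) = 1
  have hstep : ∀ t t', dist (V t) (V t') < δ / 64 → A t → A t' := by
    intro t t' htt hA ε hε
    obtain ⟨w, hw, hwt, hwp⟩ := hA (δ / 64) (by positivity)
    obtain ⟨w', h1, h2, h3⟩ := exists_transverse_close (v := w) (v' := V t') hw (half_pos hδ)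
      (fun x => by
        have h1 := norm_sub_norm_le (V t x) (w x)
        rw [norm_sub_rev] at h1
        linarith [hwt x, hVδ t x])
      (fun x => by
        have h1 := norm_add_le (V t' x - V t x) (V t x - w x)
        rw [sub_add_sub_cancel] at h1
        have h2 := ContinuousMap.dist_apply_le_dist (f := V t) (g := V t') x
        rw [dist_eq_norm, norm_sub_rev] at h2
        have h3 := hwt x
        rw [norm_sub_rev] at h3
        linarith) hε
    exact ⟨w', h1, h2, h3.trans hwp⟩
  have hall : A 0 → A 1 := by
    refine PreconnectedSpace.induction₂' (fun t t' => A t → A t') (fun t => ?_)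
      ⟨fun _ _ _ h1 h2 h => h2 (h1 h)⟩ 0 1
    have := V.continuous.tendsto t (Metric.ball_mem_nhds (V t) (show 0 < δ / 64 by positivity))
    filter_upwards [this] with t' ht'
    exact ⟨hstep t t' (by rw [dist_comm]; exact ht'), hstep t' t ht'⟩
  have hA0 : A 0 := by
    intro ε hε
    refine ⟨c, hc, fun x => ?_, by simp [hcp]⟩
    rw [hV, H.apply_zero]
    simpa using hε
  have hA1 := hall hA0
  have hV1 : ∀ x, V 1 x = c (h x) := fun x => by rw [hV, H.apply_one]
  -- The final map stays at positive distance from the open positive half-axis, so close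
  -- approximations have no positive zeros at all.
  obtain ⟨η, hη, hηm⟩ := hcpt.exists_forall_le'
    (f := fun x => max ‖(V 1 x).1‖ (-(V 1 x).2)) (by fun_prop) (a := 0) fun x _ => by
      by_contra hcon
      rw [not_lt, max_le_iff, norm_le_zero_iff] at hcon
      have h0 : (c (h x)) ≠ 0 := hc.ne_zero _
      rw [hV1] at hcon
      have h2 : h x ∈ posZeros c := by
        refine ⟨hcon.1, lt_of_le_of_ne (by linarith [hcon.2]) fun h' => h0 ?_⟩
        exact Prod.ext hcon.1 h'.symm
      rw [hcp] at h2
      exact hp ⟨x, h2⟩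
  obtain ⟨w, hw, hwV, hwp⟩ := hA1 η hη
  have hempty : posZeros w = ∅ := by
    refine eq_empty_of_forall_notMem fun x hx => ?_
    have h1 := hwV x
    rw [Prod.norm_def, max_lt_iff, Prod.fst_sub, Prod.snd_sub, hx.1, zero_sub, norm_neg,
      Real.norm_eq_abs, abs_lt] at h1
    have h2 := hηm x trivial
    rw [le_max_iff] at h2
    rcases h2 with h2 | h2
    · linarith [h1.1]
    · linarith [h1.2.2, hx.2]
  rw [hempty, ncard_empty] at hwp
  exact absurd hwp (by decide)

/-- On a closed topological manifold every map homotopic to the identity is surjective. -/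
theorem surjective_of_homotopy_id {d : ℕ} [ChartedSpace (EuclideanSpace ℝ (Fin d)) M] {h : C(M, M)}
    (H : (ContinuousMap.id M).Homotopy h) : Surjective h := by
  cases d with
  -- The degree is set up in positive dimensions only. A manifold of dimension 0 is discrete, and
  -- homotopies on it are constant.
  | zero =>
    have hsing : ∀ x : M, IsOpen ({x} : Set M) := by
      intro x
      let ψ := chartAt (EuclideanSpace ℝ (Fin 0)) x
      have : {x} = ψ.source := by
        refine Subset.antisymm (singleton_subset_iff.2 (mem_chart_source (EuclideanSpace ℝ (Fin 0)) x)) fun y hy => ?_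
        exact ψ.injOn hy (mem_chart_source (EuclideanSpace ℝ (Fin 0)) x) (Subsingleton.elim _ _)
      rw [this]
      exact ψ.open_source
    have : DiscreteTopology M := discreteTopology_iff_isOpen_singleton.2 hsing
    intro x
    refine ⟨x, ?_⟩
    have h1 : IsPreconnected (range fun t : I => H (t, x)) :=
      isPreconnected_range (by fun_prop)
    have h2 := h1.subsingleton ⟨1, rfl⟩ ⟨0, rfl⟩
    simpa using h2
  | succ n => exact surjective_of_homotopy_id_aux (n := n) H

end Surjective

end ModTwo

namespace LocallyLinear

open Set Filter Topology Function QuaternionicMA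

/-! ### Tubes around free orbits -/

/-- For gluing: a construction with compact support in a tube extends to the whole space. -/
lemma continuous_of_openEmbedding {W X Y Z : Type*} [TopologicalSpace W] [TopologicalSpace X]
    [TopologicalSpace Y] [TopologicalSpace Z] {Φ : X → Z} (hΦ : IsOpenEmbedding Φ) {K : Set X}
    (hK : IsClosed (Φ '' K)) {F F₀ : W × Z → Y} (h₀ : Continuous F₀)
    (h₁ : Continuous fun p : W × X => F (p.1, Φ p.2))
    (h₂ : ∀ w z, z ∉ Φ '' K → F (w, z) = F₀ (w, z)) : Continuous F := by
  rw [continuous_iff_continuousAt]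
  rintro ⟨w, z⟩
  by_cases hz : z ∈ Φ '' K
  · obtain ⟨x, -, rfl⟩ := hz
    exact ((IsOpenEmbedding.id.prodMap hΦ).continuousAt_iff (x := (w, x))).1 h₁.continuousAt
  · refine h₀.continuousAt.congr ?_
    filter_upwards [(hK.isOpen_compl.preimage continuous_snd).mem_nhds
      (show (w, z) ∈ Prod.snd ⁻¹' (Φ '' K)ᶜ from hz)] with p hp
    exact (h₂ p.1 p.2 hp).symm

section Tube

variable {G Z : Type*} [Group G] [TopologicalSpace G] [TopologicalSpace Z] [MulAction G Z]

/-- A linear tube around a free orbit. -/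
structure IsFreeTube {k : ℕ} (Φ : G × EuclideanSpace ℝ (Fin k) → Z) : Prop where
  isOpenEmbedding : IsOpenEmbedding Φ
  map_mul : ∀ (a g : G) (v : EuclideanSpace ℝ (Fin k)), Φ (a * g, v) = a • Φ (g, v)

/-- Over a trivial isotropy group the twisted product is the plain product `G × V`. -/
lemma exists_freeTube (hZ : IsLocallyLinear G Z) {y : Z} (hy : MulAction.stabilizer G y = ⊥) :
    ∃ (k : ℕ) (Φ : G × EuclideanSpace ℝ (Fin k) → Z), IsFreeTube Φ ∧ Φ (1, 0) = y := by
  obtain ⟨k, ρ, φ, -, hφ, heq, h0⟩ := hZ y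
  let q : G × EuclideanSpace ℝ (Fin k) → TwistedProduct (MulAction.stabilizer G y) ρ :=
    Quotient.mk _
  have hq : IsQuotientMap q := isQuotientMap_quotient_mk'
  have hinj : Injective q := by
    rintro ⟨a, v⟩ ⟨b, w⟩ h
    obtain ⟨s, h1, h2⟩ := Quotient.exact h
    have hs : s = 1 := by
      have : (s : G) ∈ (⊥ : Subgroup G) := hy ▸ s.2
      exact Subtype.ext (Subgroup.mem_bot.1 this)
    subst hs
    ext1
    · simpa using h1
    · simpa using h2.symm
  have hopen : IsOpenMap q := fun U hU => by
    rw [← hq.isOpen_preimage, preimage_image_eq _ hinj]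
    exact hU
  exact ⟨k, φ ∘ q, ⟨hφ.comp (.of_continuous_injective_isOpenMap hq.continuous hinj hopen),
    fun a g v => heq a g v⟩, h0⟩

variable {k : ℕ} {Φ : G × EuclideanSpace ℝ (Fin k) → Z}

lemma IsFreeTube.stabilizer (hΦ : IsFreeTube Φ) (x : G × EuclideanSpace ℝ (Fin k)) :
    MulAction.stabilizer G (Φ x) = ⊥ := by
  rw [eq_bot_iff]
  intro a ha
  have h1 : a • Φ (x.1, x.2) = Φ (x.1, x.2) := ha
  rw [← hΦ.map_mul] at h1
  have h2 := (Prod.ext_iff.1 (hΦ.isOpenEmbedding.injective h1)).1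
  simpa using h2

/-- A slice chart of the orbit space: `r` identifies the orbits in the invariant open set `U` with
the points of `T`, and `c` is a section of `r`. -/
structure IsOrbitChart (G : Type*) {Z : Type*} [Group G] [TopologicalSpace Z] [MulAction G Z]
    (T : Set ℝ) (U : Set Z) (r : Z → ℝ) (c : ℝ → Z) : Prop where
  isOpen : IsOpen U
  continuousOn : ContinuousOn r U
  continuous_section : Continuous c
  mem : ∀ z ∈ U, r z ∈ T
  section_mem : ∀ t ∈ T, c t ∈ U
  right_inv : ∀ t ∈ T, r (c t) = t
  orbit : ∀ z ∈ U, ∀ z' ∈ U, r z = r z' ↔ ∃ a : G, a • z = z'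

lemma IsFreeTube.isOrbitChart {Φ : G × EuclideanSpace ℝ (Fin 1) → Z} (hΦ : IsFreeTube Φ) :
    IsOrbitChart G univ (range Φ) (extend Φ (fun x => x.2 0) 0)
      (fun t => Φ (1, EuclideanSpace.single 0 t)) := by
  have hr : ∀ x, extend Φ (fun x => x.2 0) 0 (Φ x) = x.2 0 :=
    fun x => hΦ.isOpenEmbedding.injective.extend_apply _ _ x
  refine ⟨hΦ.isOpenEmbedding.isOpen_range, ?_, ?_, fun _ _ => trivial, fun t _ => ⟨_, rfl⟩,
    fun t _ => ?_, ?_⟩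
  · rintro _ ⟨x, rfl⟩
    refine (hΦ.isOpenEmbedding.continuousAt_iff.1 ?_).continuousWithinAt
    have : extend Φ (fun x => x.2 0) 0 ∘ Φ = fun x => x.2 0 := funext hr
    rw [this]
    fun_prop
  · have h := hΦ.isOpenEmbedding.continuous
    have h2 : Continuous fun t : ℝ => (EuclideanSpace.single 0 t : EuclideanSpace ℝ (Fin 1)) := by
      have h3 : (fun t : ℝ => (EuclideanSpace.single 0 t : EuclideanSpace ℝ (Fin 1))) =
          fun t => t • EuclideanSpace.single 0 1 := by
        ext t i
        fin_cases i
        simp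
      rw [h3]
      fun_prop
    fun_prop
  · rw [hr]
    simp
  · rintro _ ⟨x, rfl⟩ _ ⟨x', rfl⟩
    rw [hr, hr]
    constructor
    · intro h
      refine ⟨x'.1 * x.1⁻¹, ?_⟩
      rw [← hΦ.map_mul, inv_mul_cancel_right]
      congr 1
      refine Prod.ext rfl ?_
      ext i
      fin_cases i
      exact h
    · rintro ⟨a, h⟩
      rw [← hΦ.map_mul a x.1 x.2] at h
      rw [← hΦ.isOpenEmbedding.injective h]

/-- Pushing a map into a free tube of dimension at least two off an orbit. -/
theorem IsFreeTube.exists_homotopic_not_surjective [CompactSpace G] [T2Space Z]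
    (hΦ : IsFreeTube Φ) (hk : 1 < k) {S : Type*} [TopologicalSpace S] [MulAction G S] (g : C(S, Z))
    (hg : ∀ (a : G) x, g (a • x) = a • g x) (π : C(S, ℝ)) {s : ℝ → S} (hs : Continuous s)
    (hπs : ∀ x, ∃ a : G, a • s (π x) = x) :
    ∃ g' : C(S, Z), g.Homotopic g' ∧ ¬ Surjective g' := by
  have hinj := hΦ.isOpenEmbedding.injective
  have hcont := hΦ.isOpenEmbedding.continuous
  have hcl : ∀ R : ℝ, IsClosed (Φ '' (univ ×ˢ Metric.closedBall 0 R)) := fun R =>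
    ((isCompact_univ.prod (isCompact_closedBall _ _)).image hcont).isClosed
  -- The slice coordinate, truncated so as to be globally continuous: exact up to radius 2, zero
  -- from radius 3 on. It is invariant under the group.
  let κ : Z → EuclideanSpace ℝ (Fin k) := extend Φ (fun x => (max 0 (min 1 (3 - ‖x.2‖))) • x.2) 0
  have hκ : ∀ x, κ (Φ x) = (max 0 (min 1 (3 - ‖x.2‖))) • x.2 := fun x => hinj.extend_apply _ _ x
  have hκcont : Continuous κ := by
    have := continuous_of_openEmbedding (W := Unit) (F := fun p => κ p.2) hΦ.isOpenEmbedding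
      (hcl 3) (F₀ := fun _ => 0) continuous_const
      (by simp only [hκ]; fun_prop) fun _ z hz => ?_
    · exact this.comp (by fun_prop : Continuous fun z : Z => ((), z))
    · by_cases hz' : ∃ x, Φ x = z
      · obtain ⟨x, rfl⟩ := hz'
        have h3 : 3 < ‖x.2‖ := by
          by_contra hcon
          exact hz ⟨x, ⟨trivial, by simpa using hcon⟩, rfl⟩
        dsimp only
        rw [hκ, max_eq_left (by rw [min_le_iff]; right; linarith), zero_smul]
      · exact extend_apply' _ _ _ hz'
  have hκinv : ∀ (a : G) z, κ (a • z) = κ z := by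
    intro a z
    by_cases hz : ∃ x, Φ x = z
    · obtain ⟨x, rfl⟩ := hz
      rw [← hΦ.map_mul a x.1 x.2, hκ, hκ]
    · have hz' : ¬ ∃ x, Φ x = a • z := by
        rintro ⟨x, hx⟩
        refine hz ⟨(a⁻¹ * x.1, x.2), ?_⟩
        rw [hΦ.map_mul, hx, inv_smul_smul]
      rw [show κ z = 0 from extend_apply' _ _ _ hz]
      exact extend_apply' _ _ _ hz'
  -- By invariance the truncated coordinate of `g x` depends on the real parameter `π x` only, so it
  -- traces a curve, which is smoothed here.
  obtain ⟨w, hw, hwκ, -⟩ := (hκcont.comp (g.continuous.comp hs)).exists_contDiff_approx 1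
    (ε := fun _ => 1 / 4) continuous_const (fun _ => by norm_num)
  have hwκ' : ∀ x, dist (w (π x)) (κ (g x)) < 1 / 4 := by
    intro x
    obtain ⟨a, ha⟩ := hπs x
    have h1 := hwκ (π x)
    have h2 : κ (g x) = κ (g (s (π x))) := by
      conv_lhs => rw [← ha, hg, hκinv]
    rw [h2]
    exact h1
  -- A smooth curve in dimension at least 2 misses points arbitrarily close to 0.
  obtain ⟨c, hc, hcw⟩ := Metric.dense_iff.1
    (hw.dense_compl_range_of_finrank_lt_finrank (by simpa using hk)) 0 (1 / 4) (by norm_num)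
  rw [mem_ball_zero_iff] at hc
  -- Moves the slice coordinate towards a target point: at time 1 all the way within radius 1, and
  -- never beyond radius 2.
  let Ψ : (ℝ × EuclideanSpace ℝ (Fin k)) × Z → Z := fun p =>
    extend Φ (fun x => Φ (x.1, x.2 + (p.1.1 * max 0 (min 1 (2 - ‖x.2‖))) • (p.1.2 - x.2))) id p.2
  have hΨ : ∀ p x, Ψ (p, Φ x) =
      Φ (x.1, x.2 + (p.1 * max 0 (min 1 (2 - ‖x.2‖))) • (p.2 - x.2)) :=
    fun p x => hinj.extend_apply _ _ x
  have hΨ' : ∀ p z, (¬ ∃ x, Φ x = z) → Ψ (p, z) = z := fun p z hz => extend_apply' _ _ _ hz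
  have hΨcont : Continuous Ψ := by
    refine continuous_of_openEmbedding (F₀ := Prod.snd) hΦ.isOpenEmbedding (hcl 2) continuous_snd
      (by simp only [hΨ]; fun_prop) fun p z hz => ?_
    by_cases hz' : ∃ x, Φ x = z
    · obtain ⟨x, rfl⟩ := hz'
      have h3 : 2 < ‖x.2‖ := by
        by_contra hcon
        exact hz ⟨x, ⟨trivial, by simpa using hcon⟩, rfl⟩
      rw [hΨ, max_eq_left (by rw [min_le_iff]; right; linarith), mul_zero, zero_smul, add_zero]
    · exact hΨ' p z hz'
  have hw' := hw.continuous
  refine ⟨⟨fun x => Ψ ((1, w (π x)), g x), by fun_prop⟩,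
    ⟨⟨⟨fun p => Ψ (((p.1 : ℝ), w (π p.2)), g p.2), by fun_prop⟩, fun x => ?_, fun x => ?_⟩⟩, ?_⟩
  · by_cases hz' : ∃ y, Φ y = g x
    · obtain ⟨y, hy⟩ := hz'
      simp [← hy, hΨ]
    · simpa using hΨ' _ _ hz'
  · simp
  · intro hsurj
    obtain ⟨x, hx⟩ := hsurj (Φ (1, c))
    change Ψ ((1, w (π x)), g x) = _ at hx
    by_cases hz' : ∃ y, Φ y = g x
    · obtain ⟨y, hy⟩ := hz'
      have h1 := hwκ' x
      rw [← hy, hκ, dist_eq_norm] at h1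
      rw [← hy, hΨ, one_mul] at hx
      have h2 : y.2 + (max 0 (min 1 (2 - ‖y.2‖))) • (w (π x) - y.2) = c :=
        (Prod.ext_iff.1 (hinj hx)).2
      -- Within radius 1 the new coordinate is on the curve, which misses `c`. Between radii 1 and 2
      -- it moves by at most 1/4, and beyond 2 not at all, so it remains too large to equal `c`.
      rcases le_or_gt ‖y.2‖ 1 with h | h
      · rw [min_eq_left (by linarith), max_eq_right zero_le_one, one_smul, add_sub_cancel] at h2
        exact hcw ⟨_, h2⟩
      rcases le_or_gt ‖y.2‖ 2 with h' | h'
      · rw [min_eq_left (by linarith), max_eq_right zero_le_one, one_smul] at h1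
        rw [min_eq_right (by linarith), max_eq_right (by linarith)] at h2
        have h3 : ‖(2 - ‖y.2‖) • (w (π x) - y.2)‖ ≤ 1 / 4 := by
          rw [norm_smul, Real.norm_eq_abs, abs_of_nonneg (by linarith)]
          nlinarith [norm_nonneg (w (π x) - y.2)]
        have h4 : ‖y.2‖ ≤ ‖c‖ + ‖(2 - ‖y.2‖) • (w (π x) - y.2)‖ := by
          have : y.2 = c - (2 - ‖y.2‖) • (w (π x) - y.2) := by rw [← h2, add_sub_cancel_right]
          calc ‖y.2‖ = ‖c - (2 - ‖y.2‖) • (w (π x) - y.2)‖ := by rw [← this]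
            _ ≤ _ := norm_sub_le _ _
        linarith
      · rw [max_eq_left (by rw [min_le_iff]; right; linarith), zero_smul, add_zero] at h2
        rw [h2] at h'
        linarith
    · rw [hΨ' _ _ hz'] at hx
      exact hz' ⟨_, hx.symm⟩

/-- A tube of dimension 0 is a single orbit that is open and compact, hence all of `Z`, with no room
for a singular point. -/
lemma IsFreeTube.dim_ne_zero [CompactSpace G] [T2Space Z] [PreconnectedSpace Z]
    {Φ : G × EuclideanSpace ℝ (Fin k) → Z} (hΦ : IsFreeTube Φ) {z : Z}
    (hz : MulAction.stabilizer G z ≠ ⊥) : k ≠ 0 := by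
  rintro rfl
  have h1 : IsClopen (range Φ) :=
    ⟨(isCompact_range hΦ.isOpenEmbedding.continuous).isClosed, hΦ.isOpenEmbedding.isOpen_range⟩
  have h2 := h1.eq_univ ⟨_, mem_range_self (1, 0)⟩
  obtain ⟨x, rfl⟩ : z ∈ range Φ := h2 ▸ mem_univ z
  exact hz (hΦ.stabilizer x)

end Tube

end LocallyLinear

namespace LocallyLinear

open Set Filter Topology Function QuaternionicMA

/-! ### Charts of the orbit space at singular orbits -/

lemma image_mem_nhds_of_injOn {f : ℝ → ℝ} {a b t : ℝ} (hat : a < t) (htb : t < b)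
    (hf : ContinuousOn f (Icc a b)) (hinj : InjOn f (Icc a b)) : f '' Icc a b ∈ 𝓝 (f t) := by
  have hab : a ≤ b := (hat.trans htb).le
  have ha : a ∈ Icc a b := left_mem_Icc.2 hab
  have hb : b ∈ Icc a b := right_mem_Icc.2 hab
  have ht : t ∈ Icc a b := ⟨hat.le, htb.le⟩
  rcases hf.strictMonoOn_of_injOn_Icc' hab hinj with h | h
  · exact mem_of_superset (Icc_mem_nhds (h ha ht hat) (h ht hb htb)) (intermediate_value_Icc hab hf)
  · exact mem_of_superset (Icc_mem_nhds (h ht hb htb) (h ha ht hat))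
      (intermediate_value_Icc' hab hf)

section Cone

variable {H V : Type*} [Group H] [TopologicalSpace H] [CompactSpace H] [NormedAddCommGroup V]
  [NormedSpace ℝ V] {ρ : Representation ℝ H V}

/-- A continuous norm that is invariant under the representation `ρ`. -/
noncomputable def invNorm (ρ : Representation ℝ H V) (w : V) : ℝ :=
  sSup ((fun h => ‖ρ h w‖) '' univ)

variable (hρ : Continuous fun p : H × V => ρ p.1 p.2)
include hρ

lemma continuous_invNorm : Continuous (invNorm ρ) := by
  refine isCompact_univ.continuous_sSup (f := fun w h => ‖ρ h w‖) ?_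
  exact (hρ.comp (continuous_swap (X := V) (Y := H))).norm

lemma norm_le_invNorm (w : V) : ‖w‖ ≤ invNorm ρ w := by
  have hc : Continuous fun h => ‖ρ h w‖ :=
    (hρ.comp (by fun_prop : Continuous fun h : H => (h, w))).norm
  exact le_csSup (isCompact_univ.image hc).bddAbove ⟨1, trivial, by simp⟩

lemma invNorm_pos {w : V} (hw : w ≠ 0) : 0 < invNorm ρ w :=
  (norm_pos_iff.2 hw).trans_le (norm_le_invNorm hρ w)

omit hρ [TopologicalSpace H] [CompactSpace H] in
lemma invNorm_apply (h : H) (w : V) : invNorm ρ (ρ h w) = invNorm ρ w := by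
  unfold invNorm
  congr 1
  ext x
  constructor
  · rintro ⟨k, -, rfl⟩
    exact ⟨k * h, trivial, by simp⟩
  · rintro ⟨k, -, rfl⟩
    refine ⟨k * h⁻¹, trivial, ?_⟩
    change ‖ρ (k * h⁻¹) (ρ h w)‖ = _
    rw [← Module.End.mul_apply, ← map_mul, inv_mul_cancel_right]

omit hρ [TopologicalSpace H] [CompactSpace H] in
lemma invNorm_smul (t : ℝ) (w : V) : invNorm ρ (t • w) = |t| * invNorm ρ w := by
  unfold invNorm
  simp only [map_smul, norm_smul, Real.norm_eq_abs]
  rw [← smul_eq_mul, ← Real.sSup_smul_of_nonneg (abs_nonneg t)]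
  congr 1
  rw [← image_smul, image_image]
  rfl

/-- If the orbits of a compact linear group are locally separated by a real function near `v`, then
the group is transitive on the directions. -/
theorem exists_eq_smul_apply [FiniteDimensional ℝ V] {v : V} (hv : invNorm ρ v = 1)
    (hmove : ∃ h, ρ h v ≠ v) {O : Set V} (hO : IsOpen O) (hvO : v ∈ O) {r : V → ℝ}
    (hr : ContinuousOn r O) (hsep : ∀ w ∈ O, ∀ w' ∈ O, r w = r w' → ∃ h, ρ h w = w') (w : V) :
    ∃ h : H, w = invNorm ρ w • ρ h v := by
  have hNt : ∀ {t : ℝ} (h : H), 0 ≤ t → invNorm ρ (t • ρ h v) = t := fun h ht => by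
    rw [invNorm_smul, invNorm_apply, hv, mul_one, abs_of_nonneg ht]
  have hρh : ∀ h, Continuous (ρ h) := fun h =>
    hρ.comp (by fun_prop : Continuous fun w : V => (h, w))
  have hv0 : v ≠ 0 := by
    rintro rfl
    have h1 := invNorm_smul (ρ := ρ) 0 (0 : V)
    rw [zero_smul, hv] at h1
    norm_num at h1
  -- The cone over the orbit of `v`. Along the ray through `v` the function `r` is injective, since
  -- `invNorm` tells the points apart; so its values fill a neighbourhood of `r v`, and separation
  -- of orbits puts a neighbourhood of `v` into `W`.
  let W : Set V := {w | ∃ t : ℝ, 0 < t ∧ ∃ h : H, w = t • ρ h v}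
  have hWv : W ∈ 𝓝 v := by
    have hray : Continuous fun t : ℝ => t • v := by fun_prop
    have h1 : ∀ᶠ t in 𝓝 (1 : ℝ), t • v ∈ O :=
      hray.continuousAt.eventually_mem (by simpa using hO.mem_nhds hvO)
    obtain ⟨ε, hε, hεO⟩ := Metric.eventually_nhds_iff_ball.1 (h1.and (eventually_gt_nhds one_pos))
    have hsub : ∀ t ∈ Icc (1 - ε / 2) (1 + ε / 2), t • v ∈ O ∧ 0 < t := fun t ht => by
      refine hεO t ?_
      rw [Real.ball_eq_Ioo]
      exact ⟨by linarith [ht.1], by linarith [ht.2]⟩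
    have h2 := image_mem_nhds_of_injOn (f := fun t => r (t • v)) (a := 1 - ε / 2) (t := 1)
      (b := 1 + ε / 2) (by linarith) (by linarith)
      (hr.comp hray.continuousOn fun t ht => (hsub t ht).1) (fun t ht t' ht' h => by
        obtain ⟨k, hk⟩ := hsep _ (hsub t ht).1 _ (hsub t' ht').1 h
        have h3 := congrArg (invNorm ρ) hk
        rwa [map_smul, hNt k (hsub t ht).2.le, invNorm_smul, hv, mul_one,
          abs_of_pos (hsub t' ht').2] at h3)
    rw [one_smul] at h2
    filter_upwards [(hr.continuousAt (hO.mem_nhds hvO)).preimage_mem_nhds h2, hO.mem_nhds hvO]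
      with x hx hxO
    obtain ⟨t, ht, htx⟩ := hx
    obtain ⟨k, hk⟩ := hsep _ (hsub t ht).1 _ hxO htx
    exact ⟨t, (hsub t ht).2, k, by rw [← hk, map_smul]⟩
  have hWopen : IsOpen W := by
    rw [isOpen_iff_mem_nhds]
    rintro _ ⟨t, ht, h, rfl⟩
    have hc : Continuous fun x : V => t⁻¹ • ρ h⁻¹ x := (hρh h⁻¹).const_smul _
    have h1 : t⁻¹ • ρ h⁻¹ (t • ρ h v) = v := by
      rw [map_smul, smul_smul, inv_mul_cancel₀ ht.ne', one_smul, ← Module.End.mul_apply,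
        ← map_mul, inv_mul_cancel, map_one, Module.End.one_apply]
    filter_upwards [hc.continuousAt.preimage_mem_nhds (h1.symm ▸ hWv)] with x hx
    obtain ⟨s, hs, k, hk⟩ := hx
    refine ⟨t * s, mul_pos ht hs, h * k, ?_⟩
    rw [map_mul, Module.End.mul_apply, mul_smul, ← map_smul _ s, ← hk, map_smul, smul_smul,
      mul_inv_cancel₀ ht.ne', one_smul, ← Module.End.mul_apply, ← map_mul, mul_inv_cancel, map_one,
      Module.End.one_apply]
  have hWsub : ∀ x ∈ W, ∃ h : H, x = invNorm ρ x • ρ h v := by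
    rintro _ ⟨t, ht, h, rfl⟩
    exact ⟨h, by rw [hNt h ht.le]⟩
  rcases eq_or_ne w 0 with rfl | hw
  · refine ⟨1, ?_⟩
    have h1 := invNorm_smul (ρ := ρ) 0 (0 : V)
    rw [zero_smul, abs_zero, zero_mul] at h1
    rw [h1, zero_smul]
  refine hWsub w ?_
  -- Above dimension 1 the punctured space is connected, and `W` is open and closed in it. On a
  -- line, the element that moves `v` must act by -1.
  rcases lt_or_ge 1 (Module.finrank ℝ V) with hdim | hdim
  · have hC : IsClosed {x : V | ∃ h : H, x = invNorm ρ x • ρ h v} := by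
      have h1 : IsClosed {p : H × V | p.2 = invNorm ρ p.2 • ρ p.1 v} := by
        refine isClosed_eq continuous_snd ?_
        have h2 := (continuous_invNorm hρ).comp (continuous_snd (X := H) (Y := V))
        exact h2.smul (hρ.comp (by fun_prop : Continuous fun p : H × V => (p.1, v)))
      convert isClosedMap_snd_of_compactSpace _ h1 using 1
      ext x
      simp
    have hconn := (isConnected_compl_singleton_of_one_lt_rank (E := V)
      (by rw [← Module.finrank_eq_rank]; exact_mod_cast hdim) 0).isPreconnected
    refine hconn.subset_of_closure_inter_subset hWopen ⟨v, hv0, mem_of_mem_nhds hWv⟩ ?_ hw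
    rintro x ⟨hx, hx0⟩
    obtain ⟨h, hh⟩ := closure_minimal hWsub hC hx
    exact ⟨_, invNorm_pos hρ hx0, h, hh⟩
  · have hdim1 : Module.finrank ℝ V = 1 := by
      have : Nontrivial V := ⟨v, 0, hv0⟩
      have := Module.finrank_pos (R := ℝ) (M := V)
      omega
    have hline := (finrank_eq_one_iff_of_nonzero' v hv0).1 hdim1
    obtain ⟨h, hh⟩ := hmove
    obtain ⟨c, hc⟩ := hline (ρ h v)
    have hc1 : c = -1 := by
      have h1 := congrArg (invNorm ρ) hc
      rw [invNorm_smul, invNorm_apply, hv, mul_one] at h1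
      rcases (abs_eq zero_le_one).1 h1 with h2 | h2
      · rw [h2, one_smul] at hc
        exact absurd hc.symm hh
      · exact h2
    obtain ⟨s, rfl⟩ := hline w
    have hs : s ≠ 0 := by
      rintro rfl
      simp at hw
    rcases lt_or_gt_of_ne hs with h1 | h1
    · exact ⟨-s, by linarith, h, by rw [← hc, hc1, smul_smul]; simp⟩
    · exact ⟨s, h1, 1, by simp⟩

end Cone

section SingularChart

lemma stabilizer_smul_eq_bot {G Z : Type*} [Group G] [MulAction G Z] {z : Z} (hz : MulAction.stabilizer G z = ⊥) (a : G) :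
    MulAction.stabilizer G (a • z) = ⊥ := by
  rw [MulAction.stabilizer_smul_eq_stabilizer_map_conj, hz, Subgroup.map_bot]

variable {G Z : Type*} [Group G] [TopologicalSpace G] [TopologicalSpace Z] [MulAction G Z]

/-- The orbits in a tube correspond to the orbits of the isotropy group on the slice. Near a free
orbit they are separated by a real parameter, so `exists_eq_smul_apply` makes the isotropy group
transitive on directions, and the invariant norm is a chart with values in the half-line. -/
theorem exists_orbitChart_Ici [CompactSpace G] [T2Space Z] [ContinuousSMul G Z]
    (hZ : IsLocallyLinear G Z)
    (hreg : ∀ z : Z, MulAction.stabilizer G z = ⊥ → ∃ U r c, IsOrbitChart G univ U r c ∧ z ∈ U)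
    {y : Z} (hy : MulAction.stabilizer G y ≠ ⊥)
    (hy' : y ∈ closure {z | MulAction.stabilizer G z = ⊥}) :
    ∃ U r c, IsOrbitChart G (Ici 0) U r c ∧ y ∈ U ∧ r y = 0 ∧
      ∀ z ∈ U, r z ≠ 0 → MulAction.stabilizer G z = ⊥ := by
  obtain ⟨k, ρ, φ, hρ, hφ, heq, h0⟩ := hZ y
  have hHcl : IsClosed (MulAction.stabilizer G y : Set G) :=
    isClosed_eq (by fun_prop : Continuous fun a : G => a • y) continuous_const
  have : CompactSpace (MulAction.stabilizer G y) := isCompact_iff_compactSpace.1 hHcl.isCompact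
  let F : G × EuclideanSpace ℝ (Fin k) → Z := fun p => φ (Quotient.mk _ p)
  have hF : Continuous F := hφ.continuous.comp continuous_quotient_mk'
  have hFmul : ∀ a g w, F (a * g, w) = a • F (g, w) := heq
  have hFeq : ∀ {p q}, F p = F q ↔ ∃ h : MulAction.stabilizer G y, p.1 = q.1 * (h : G) ∧
      q.2 = ρ h p.2 := fun {p q} => hφ.injective.eq_iff.trans Quotient.eq
  have hFρ : ∀ g (h : MulAction.stabilizer G y) w, F (g, ρ h w) = F (g * h, w) := fun g h w =>
    (hFeq.2 ⟨h, rfl, rfl⟩).symm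
  have hrange : ∀ z ∈ range φ, ∃ g w, F (g, w) = z := by
    rintro _ ⟨x, rfl⟩
    obtain ⟨⟨g, w⟩, rfl⟩ := Quotient.exists_rep x
    exact ⟨g, w, rfl⟩
  -- Closure under free orbits provides a free vector in the slice; all its nonzero multiples are
  -- free by linearity.
  obtain ⟨w₀, hw₀⟩ : ∃ w, MulAction.stabilizer G (F (1, w)) = ⊥ := by
    obtain ⟨z, hz, hzreg⟩ := mem_closure_iff.1 hy' (range φ) hφ.isOpen_range ⟨_, h0⟩
    obtain ⟨g, w, rfl⟩ := hrange z hz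
    refine ⟨w, ?_⟩
    have := stabilizer_smul_eq_bot hzreg g⁻¹
    rwa [← hFmul, inv_mul_cancel] at this
  have hscale : ∀ t : ℝ, t ≠ 0 → MulAction.stabilizer G (F (1, t • w₀)) = ⊥ := by
    intro t ht
    rw [eq_bot_iff]
    intro a ha
    have h1 : a • F (1, t • w₀) = F (1, t • w₀) := ha
    rw [← hFmul, hFeq] at h1
    obtain ⟨h, h1, h2⟩ := h1
    rw [← hw₀, MulAction.mem_stabilizer_iff, ← hFmul, hFeq]
    refine ⟨h, h1, ?_⟩
    change t • w₀ = ρ h (t • w₀) at h2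
    rw [map_smul] at h2
    exact smul_right_injective _ ht h2
  have hw₀0 : w₀ ≠ 0 := by
    rintro rfl
    exact hy (h0 ▸ hw₀)
  have hN := invNorm_pos hρ hw₀0
  set v := (invNorm ρ w₀)⁻¹ • w₀ with hv
  have hNv : invNorm ρ v = 1 := by
    rw [hv, invNorm_smul, abs_of_pos (inv_pos.2 hN), inv_mul_cancel₀ hN.ne']
  have hregt : ∀ t : ℝ, t ≠ 0 → MulAction.stabilizer G (F (1, t • v)) = ⊥ := fun t ht => by
    rw [hv, smul_smul]
    exact hscale _ (mul_ne_zero ht (inv_ne_zero hN.ne'))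
  have hregv : MulAction.stabilizer G (F (1, v)) = ⊥ := by
    simpa using hregt 1 one_ne_zero
  obtain ⟨U, r, c, hchart, hU⟩ := hreg _ hregv
  have hF1 : Continuous fun w => F (1, w) := by fun_prop
  have hcone := exists_eq_smul_apply hρ hNv
    -- If the isotropy group fixed `v`, it would lie in the trivial stabilizer of the point given by
    -- `v`.
    (by
      by_contra! hcon
      refine hy (eq_bot_iff.2 fun a ha => ?_)
      rw [← hregv, MulAction.mem_stabilizer_iff, ← hFmul, mul_one]
      have := hFρ 1 ⟨a, ha⟩ v
      rw [hcon, one_mul] at this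
      exact this.symm)
    (hchart.isOpen.preimage hF1) hU (r := fun w => r (F (1, w)))
    (hchart.continuousOn.comp hF1.continuousOn fun w hw => hw)
    (fun w hw w' hw' h => by
      obtain ⟨a, ha⟩ := (hchart.orbit _ hw _ hw').1 h
      rw [← hFmul, hFeq] at ha
      obtain ⟨h, -, h2⟩ := ha
      exact ⟨h, h2.symm⟩)
  let R : TwistedProduct (MulAction.stabilizer G y) ρ → ℝ :=
    Quotient.lift (fun p => invNorm ρ p.2) (by
      rintro p q ⟨h, -, h2⟩
      rw [h2, invNorm_apply])
  have hR : Continuous R :=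
    ((continuous_invNorm hρ).comp continuous_snd).quotient_lift _
  have hr : ∀ g w, extend φ R 0 (F (g, w)) = invNorm ρ w := fun g w =>
    hφ.injective.extend_apply _ _ _
  have hy0 : F (1, 0) = y := h0
  refine ⟨range φ, extend φ R 0, fun t => F (1, t • v), ⟨hφ.isOpen_range, ?_, by fun_prop, ?_,
    fun t _ => ⟨_, rfl⟩, ?_, ?_⟩, ⟨_, h0⟩, ?_, ?_⟩
  · rintro _ ⟨x, rfl⟩
    refine (hφ.continuousAt_iff.1 ?_).continuousWithinAt
    have : extend φ R 0 ∘ φ = R := extend_comp hφ.injective R 0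
    rw [this]
    exact hR.continuousAt
  · intro z hz
    obtain ⟨g, w, rfl⟩ := hrange z hz
    rw [hr]
    exact (norm_nonneg w).trans (norm_le_invNorm hρ w)
  · intro t ht
    rw [hr, invNorm_smul, hNv, mul_one, abs_of_nonneg ht]
  · intro z hz z' hz'
    obtain ⟨g, w, rfl⟩ := hrange z hz
    obtain ⟨g', w', rfl⟩ := hrange z' hz'
    rw [hr, hr]
    constructor
    · intro h
      obtain ⟨a, ha⟩ := hcone w
      obtain ⟨b, hb⟩ := hcone w'
      rw [← h] at hb
      refine ⟨g' * b * (g * a)⁻¹, ?_⟩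
      rw [ha, hb, ← map_smul, ← map_smul, hFρ, hFρ, ← hFmul, inv_mul_cancel_right]
    · rintro ⟨a, ha⟩
      rw [← hFmul, hFeq] at ha
      obtain ⟨h, -, h2⟩ := ha
      change w' = ρ h w at h2
      rw [h2, invNorm_apply]
  · refine (congrArg (extend φ R 0) hy0).symm.trans ((hr 1 0).trans ?_)
    simpa using invNorm_smul (ρ := ρ) 0 0
  · intro z hz
    obtain ⟨g, w, rfl⟩ := hrange z hz
    rw [hr]
    intro hw
    obtain ⟨a, ha⟩ := hcone w
    rw [ha, ← map_smul, hFρ, ← mul_one (g * (a : G)), hFmul]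
    exact stabilizer_smul_eq_bot (hregt _ hw) _

end SingularChart

end LocallyLinear

namespace LocallyLinear

open Set Filter Topology Function QuaternionicMA

/-! ### Arcs transverse to the orbits -/

section Arc

variable (G : Type*) {Z : Type*} [Group G] [MulAction G Z]

/-- The union of the orbits that meet `σ` on `[p, q]`. -/
def saturation (σ : ℝ → Z) (p q : ℝ) : Set Z := {z | ∃ t ∈ Icc p q, ∃ a : G, a • σ t = z}

variable {G} {σ : ℝ → Z} {p q : ℝ}

lemma smul_mem_saturation {z : Z} (hz : z ∈ saturation G σ p q) (a : G) :
    a • z ∈ saturation G σ p q := by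
  obtain ⟨t, ht, b, rfl⟩ := hz
  exact ⟨t, ht, a * b, mul_smul _ _ _⟩

lemma saturation_comp_neg : saturation G (fun t => σ (-t)) (-q) (-p) = saturation G σ p q := by
  ext z
  constructor
  · rintro ⟨t, ht, a, h⟩
    exact ⟨-t, ⟨by linarith [ht.2], by linarith [ht.1]⟩, a, h⟩
  · rintro ⟨t, ht, a, h⟩
    exact ⟨-t, ⟨by linarith [ht.2], by linarith [ht.1]⟩, a, by simpa using h⟩

variable [TopologicalSpace Z]

variable (G) in
/-- `σ` restricts to an arc on `[p, q]` that meets every orbit at most once. -/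
structure IsArc (σ : ℝ → Z) (p q : ℝ) : Prop where
  le : p ≤ q
  continuousOn : ContinuousOn σ (Icc p q)
  inj : ∀ s ∈ Icc p q, ∀ t ∈ Icc p q, ∀ a : G, a • σ s = σ t → s = t

variable (G) in
/-- The orbits of `x` and `y` agree or are joined by an arc. -/
def ArcJoined (x y : Z) : Prop :=
  ∃ σ p q, IsArc G σ p q ∧ (∃ a : G, a • σ p = x) ∧ ∃ a : G, a • σ q = y

lemma IsArc.mono (h : IsArc G σ p q) {p' q' : ℝ} (hp : p ≤ p') (hpq : p' ≤ q') (hq : q' ≤ q) :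
    IsArc G σ p' q' :=
  ⟨hpq, h.continuousOn.mono (Icc_subset_Icc hp hq), fun s hs t ht =>
    h.inj s (Icc_subset_Icc hp hq hs) t (Icc_subset_Icc hp hq ht)⟩

lemma IsArc.comp_neg (h : IsArc G σ p q) : IsArc G (fun t => σ (-t)) (-q) (-p) := by
  have hmem : ∀ t ∈ Icc (-q) (-p), -t ∈ Icc p q := fun t ht =>
    ⟨by linarith [ht.2], by linarith [ht.1]⟩
  exact ⟨neg_le_neg h.le, h.continuousOn.comp continuous_neg.continuousOn hmem,
    fun s hs t ht a hst => neg_injective (h.inj _ (hmem s hs) _ (hmem t ht) a hst)⟩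

lemma IsArc.comp_add (h : IsArc G σ p q) (c : ℝ) :
    IsArc G (fun t => σ (t + c)) (p - c) (q - c) := by
  have hmem : ∀ t ∈ Icc (p - c) (q - c), t + c ∈ Icc p q := fun t ht =>
    ⟨by linarith [ht.1], by linarith [ht.2]⟩
  exact ⟨sub_le_sub_right h.le c, h.continuousOn.comp (continuous_add_const c).continuousOn hmem,
    fun s hs t ht a hst => add_right_cancel (h.inj _ (hmem s hs) _ (hmem t ht) a hst)⟩

lemma ArcJoined.symm {x y : Z} (h : ArcJoined G x y) : ArcJoined G y x := by
  obtain ⟨σ, p, q, h, hx, hy⟩ := h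
  exact ⟨_, _, _, h.comp_neg, by simpa using hy, by simpa using hx⟩

lemma IsOrbitChart.arcJoined {r : Z → ℝ} {c : ℝ → Z} {T : Set ℝ} {U : Set Z}
    (h : IsOrbitChart G T U r c) (hT : T.OrdConnected) {x y : Z} (hx : x ∈ U) (hy : y ∈ U) :
    ArcJoined G x y := by
  wlog hle : r x ≤ r y generalizing x y
  · exact (this hy hx (le_of_not_ge hle)).symm
  have hsub : Icc (r x) (r y) ⊆ T := hT.out (h.mem x hx) (h.mem y hy)
  refine ⟨c, r x, r y, ⟨hle, h.continuous_section.continuousOn, fun s hs t ht a hst => ?_⟩, ?_, ?_⟩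
  · rw [← h.right_inv s (hsub hs), ← h.right_inv t (hsub ht)]
    exact (h.orbit _ (h.section_mem s (hsub hs)) _ (h.section_mem t (hsub ht))).2 ⟨a, hst⟩
  · exact (h.orbit _ (h.section_mem _ (h.mem x hx)) _ hx).1 (h.right_inv _ (h.mem x hx))
  · exact (h.orbit _ (h.section_mem _ (h.mem y hy)) _ hy).1 (h.right_inv _ (h.mem y hy))

/-- In a chart the arc becomes an injective real function, hence it is open at interior points. -/
lemma IsArc.exists_image_mem_nhds (h : IsArc G σ p q) {T : Set ℝ} {U : Set Z} {r : Z → ℝ}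
    {c : ℝ → Z} (hU : IsOrbitChart G T U r c) {t : ℝ} (hpt : p < t) (htq : t < q)
    (ht : σ t ∈ U) : ∃ I ⊆ Icc p q, (∀ s ∈ I, σ s ∈ U) ∧ (fun s => r (σ s)) '' I ∈ 𝓝 (r (σ t)) := by
  have h1 : ∀ᶠ s in 𝓝 t, σ s ∈ U :=
    (h.continuousOn.continuousAt (Icc_mem_nhds hpt htq)).eventually_mem (hU.isOpen.mem_nhds ht)
  obtain ⟨ε, hε, h2⟩ := Metric.eventually_nhds_iff_ball.1 (h1.and (Icc_mem_nhds hpt htq))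
  have hsub : ∀ s ∈ Icc (t - ε / 2) (t + ε / 2), σ s ∈ U ∧ s ∈ Icc p q := fun s hs => by
    refine h2 s ?_
    rw [Real.ball_eq_Ioo]
    exact ⟨by linarith [hs.1], by linarith [hs.2]⟩
  refine ⟨Icc (t - ε / 2) (t + ε / 2), fun s hs => (hsub s hs).2, fun s hs => (hsub s hs).1,
    image_mem_nhds_of_injOn (f := fun s => r (σ s)) (by linarith : t - ε / 2 < t)
      (by linarith) ?_ ?_⟩
  · exact hU.continuousOn.comp (h.continuousOn.mono fun s hs => (hsub s hs).2)
      fun s hs => (hsub s hs).1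
  · intro s hs s' hs' hss
    obtain ⟨a, ha⟩ := (hU.orbit _ (hsub s hs).1 _ (hsub s' hs').1).1 hss
    exact h.inj s (hsub s hs).2 s' (hsub s' hs').2 a ha

lemma IsArc.saturation_mem_nhds_of_image {T : Set ℝ} {U : Set Z} {r : Z → ℝ}
    {c : ℝ → Z} (hU : IsOrbitChart G T U r c) {y : Z} (hy : y ∈ U) {I : Set ℝ} (hI : I ⊆ Icc p q)
    (hIU : ∀ s ∈ I, σ s ∈ U) (h : ∀ᶠ z in 𝓝 y, z ∈ U → r z ∈ (fun s => r (σ s)) '' I) :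
    saturation G σ p q ∈ 𝓝 y := by
  filter_upwards [h, hU.isOpen.mem_nhds hy] with z hz hzU
  obtain ⟨s, hs, hsz⟩ := hz hzU
  obtain ⟨a, ha⟩ := (hU.orbit _ (hIU s hs) _ hzU).1 hsz
  exact ⟨s, hI hs, a, ha⟩

/-- The arc starts at the end of the half-line and must move into it, so by the intermediate value
theorem it sweeps out an initial interval. -/
lemma IsArc.saturation_mem_nhds_left (h : IsArc G σ p q) (hpq : p < q) {U : Set Z} {r : Z → ℝ}
    {c : ℝ → Z} (hU : IsOrbitChart G (Ici 0) U r c) (hp : σ p ∈ U) (hr : r (σ p) = 0) :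
    saturation G σ p q ∈ 𝓝 (σ p) := by
  have h1 : ∀ᶠ s in 𝓝[Icc p q] p, σ s ∈ U :=
    (h.continuousOn p (left_mem_Icc.2 hpq.le)).eventually_mem (hU.isOpen.mem_nhds hp)
  obtain ⟨ε, hε, h2⟩ := Metric.eventually_nhds_iff_ball.1 (eventually_nhdsWithin_iff.1 h1)
  set q' := min q (p + ε / 2) with hq'
  have hpq' : p < q' := lt_min hpq (by linarith)
  have hsub : ∀ s ∈ Icc p q', s ∈ Icc p q ∧ σ s ∈ U := fun s hs => by
    have h3 : s ≤ q := hs.2.trans (min_le_left _ _)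
    have h4 : s ≤ p + ε / 2 := hs.2.trans (min_le_right _ _)
    refine ⟨⟨hs.1, h3⟩, h2 s ?_ ⟨hs.1, h3⟩⟩
    rw [Real.ball_eq_Ioo]
    exact ⟨by linarith [hs.1], by linarith⟩
  have hq'mem : q' ∈ Icc p q' := right_mem_Icc.2 hpq'.le
  have hpos : 0 < r (σ q') := by
    refine lt_of_le_of_ne (hU.mem _ (hsub _ hq'mem).2) fun h0 => ?_
    obtain ⟨a, ha⟩ := (hU.orbit _ hp _ (hsub _ hq'mem).2).1 (hr.trans h0)
    exact hpq'.ne (h.inj p (left_mem_Icc.2 hpq.le) q' (hsub _ hq'mem).1 a ha)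
  have hIVT := intermediate_value_Icc (f := fun s => r (σ s)) hpq'.le
    (hU.continuousOn.comp (h.continuousOn.mono fun s hs => (hsub s hs).1)
      fun s hs => (hsub s hs).2)
  refine IsArc.saturation_mem_nhds_of_image hU hp (fun s hs => (hsub s hs).1)
    (fun s hs => (hsub s hs).2) ?_
  filter_upwards [(hU.continuousOn.continuousAt (hU.isOpen.mem_nhds hp)).eventually
    (eventually_lt_nhds (hr.symm ▸ hpos))] with z hz hzU
  refine hIVT ⟨?_, hz.le⟩
  change r (σ p) ≤ r z
  rw [hr]
  exact hU.mem z hzU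

variable [TopologicalSpace G] [ContinuousSMul G Z]

lemma IsArc.smul (h : IsArc G σ p q) (b : G) : IsArc G (fun t => b • σ t) p q := by
  refine ⟨h.le, h.continuousOn.const_smul b, fun s hs t ht a hst => h.inj s hs t ht (b⁻¹ * a * b) ?_⟩
  rw [mul_smul, mul_smul, hst, inv_smul_smul]

variable [CompactSpace G] [T2Space Z]

lemma IsArc.isClosed_saturation (h : IsArc G σ p q) : IsClosed (saturation G σ p q) := by
  have h1 : IsCompact ((fun x : G × ℝ => x.1 • σ x.2) '' (univ ×ˢ Icc p q)) := by
    refine (isCompact_univ.prod isCompact_Icc).image_of_continuousOn ?_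
    exact continuousOn_fst.smul (h.continuousOn.comp continuousOn_snd fun x hx => hx.2)
  convert h1.isClosed using 1
  ext z
  constructor
  · rintro ⟨t, ht, a, rfl⟩
    exact ⟨(a, t), ⟨trivial, ht⟩, rfl⟩
  · rintro ⟨⟨a, t⟩, ⟨-, ht⟩, rfl⟩
    exact ⟨t, ht, a, rfl⟩

/-- Concatenation may meet an orbit twice. So follow `σ` only as far as the orbit on which `τ` is
last in the saturation of `σ`, then translate the remainder of `τ` by a group element to continue
from there. -/
lemma ArcJoined.trans {x y z : Z} (hxy : ArcJoined G x y) (hyz : ArcJoined G y z) :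
    ArcJoined G x z := by
  obtain ⟨σ, p, q, hσ, hx, b, hy⟩ := hxy
  obtain ⟨τ, p', q', hτ, ⟨b', hy'⟩, b'', hz⟩ := hyz
  obtain ⟨s, ⟨hs, t, ht, a, hst⟩, hmax⟩ := IsCompact.exists_isGreatest
    (s := Icc p' q' ∩ τ ⁻¹' saturation G σ p q)
    (isCompact_Icc.of_isClosed_subset
      (hτ.continuousOn.preimage_isClosed_of_isClosed isClosed_Icc hσ.isClosed_saturation)
      inter_subset_left)
    ⟨p', left_mem_Icc.2 hτ.le, q, right_mem_Icc.2 hσ.le, b'⁻¹ * b, by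
      rw [mul_smul, hy, ← hy', inv_smul_smul]⟩
  have hmax' : ∀ s' ∈ Icc p' q', τ s' ∈ saturation G σ p q → s' ≤ s := fun s' h h' => hmax ⟨h, h'⟩
  have h1 := hσ.mono le_rfl ht.1 ht.2
  have h2 := ((hτ.mono hs.1 hs.2 le_rfl).smul a⁻¹).comp_add (s - t)
  have hst' : a⁻¹ • τ s = σ t := by rw [← hst, inv_smul_smul]
  set τ' : ℝ → Z := fun u => a⁻¹ • τ (u + (s - t)) with hτ'
  rw [sub_sub_cancel] at h2
  have hcross : ∀ u ∈ Icc p t, ∀ u' ∈ Icc t (q' - (s - t)), ∀ d : G, d • σ u = τ' u' →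
      u = u' := by
    intro u hu u' hu' d hd
    have h3 : u' + (s - t) ≤ s := by
      refine hmax' _ ⟨by linarith [hu'.1, hs.1], by linarith [hu'.2]⟩
        ⟨u, ⟨hu.1, hu.2.trans ht.2⟩, a * d, ?_⟩
      rw [mul_smul, hd, hτ', smul_inv_smul]
    have h4 : u' = t := le_antisymm (by linarith) hu'.1
    rw [h4] at hd ⊢
    refine hσ.inj u ⟨hu.1, hu.2.trans ht.2⟩ t ht d ?_
    rw [hd, ← hst', hτ']
    simp
  have hω1 : ∀ u ≤ t, (if u ≤ t then σ u else τ' u) = σ u := fun u hu => if_pos hu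
  have hω2 : ∀ u, t ≤ u → (if u ≤ t then σ u else τ' u) = τ' u := fun u hu => by
    rcases hu.eq_or_lt with rfl | hu
    · rw [if_pos le_rfl, ← hst', hτ']
      simp
    · exact if_neg hu.not_ge
  refine ⟨fun u => if u ≤ t then σ u else τ' u, p, q' - (s - t), ⟨h1.le.trans h2.le, ?_, ?_⟩, ?_, ?_⟩
  · rw [← Icc_union_Icc_eq_Icc h1.le h2.le]
    exact (h1.continuousOn.congr fun u hu => hω1 u hu.2).union_of_isClosed
      (h2.continuousOn.congr fun u hu => hω2 u hu.1) isClosed_Icc isClosed_Icc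
  · intro u hu u' hu' d hd
    rcases le_total u t with h | h <;> rcases le_total u' t with h' | h'
    · rw [hω1 u h, hω1 u' h'] at hd
      exact h1.inj u ⟨hu.1, h⟩ u' ⟨hu'.1, h'⟩ d hd
    · rw [hω1 u h, hω2 u' h'] at hd
      exact hcross u ⟨hu.1, h⟩ u' ⟨h', hu'.2⟩ d hd
    · rw [hω2 u h, hω1 u' h'] at hd
      refine (hcross u' ⟨hu'.1, h'⟩ u ⟨h, hu.2⟩ d⁻¹ ?_).symm
      rw [← hd, inv_smul_smul]
    · rw [hω2 u h, hω2 u' h'] at hd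
      exact h2.inj u ⟨h, hu.2⟩ u' ⟨h', hu'.2⟩ d hd
  · dsimp only
    rw [hω1 p h1.le]
    exact hx
  · dsimp only
    rw [hω2 _ h2.le]
    refine ⟨b'' * a, ?_⟩
    rw [mul_smul, hτ', smul_inv_smul, sub_add_cancel, hz]

/-- If all orbits have charts and the space is connected, then an arc between two distinct singular
orbits meets all orbits, the singular ones at its ends only. -/
theorem exists_arc [PreconnectedSpace Z]
    (hchart : ∀ y : Z, (MulAction.stabilizer G y = ⊥ ∧ ∃ U r c, IsOrbitChart G univ U r c ∧ y ∈ U) ∨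
      ∃ U r c, IsOrbitChart G (Ici 0) U r c ∧ y ∈ U ∧ r y = 0)
    {x y : Z} (hx : MulAction.stabilizer G x ≠ ⊥) (hy : MulAction.stabilizer G y ≠ ⊥)
    (hxy : ∀ a : G, a • x ≠ y) :
    ∃ (σ : ℝ → Z) (p q : ℝ), p < q ∧ IsArc G σ p q ∧ σ p = x ∧ (∃ a : G, a • σ q = y) ∧
      saturation G σ p q = univ ∧ ∀ t ∈ Ioo p q, MulAction.stabilizer G (σ t) = ⊥ := by
  have hjoin : ArcJoined G x y := by
    have : Std.Symm (ArcJoined G (Z := Z)) := ⟨fun _ _ h => h.symm⟩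
    -- Being joined by an arc is a symmetric and transitive relation that holds locally, by the
    -- charts.
    refine PreconnectedSpace.induction₂ _ (fun z => ?_) ⟨fun _ _ _ h h' => h.trans h'⟩ x y
    rcases hchart z with ⟨-, U, r, c, hU, hz⟩ | ⟨U, r, c, hU, hz, -⟩
    · filter_upwards [hU.isOpen.mem_nhds hz] with w hw
      exact hU.arcJoined ordConnected_univ hz hw
    · filter_upwards [hU.isOpen.mem_nhds hz] with w hw
      exact hU.arcJoined ordConnected_Ici hz hw
  obtain ⟨σ₀, p, q, hσ₀, ⟨a, ha⟩, b, hb⟩ := hjoin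
  have hσ := hσ₀.smul a
  set σ : ℝ → Z := fun t => a • σ₀ t
  have hσp : σ p = x := ha
  have hσq : (b * a⁻¹) • σ q = y := by rw [mul_smul, ← hb, inv_smul_smul]
  have hsing : MulAction.stabilizer G (σ q) ≠ ⊥ := fun h => hy (hσq ▸ stabilizer_smul_eq_bot h _)
  have hpq : p < q := by
    refine lt_of_le_of_ne hσ.le ?_
    rintro rfl
    exact hxy (b * a⁻¹) (hσp ▸ hσq)
  have hint : ∀ t ∈ Ioo p q, MulAction.stabilizer G (σ t) = ⊥ ∧ saturation G σ p q ∈ 𝓝 (σ t) := by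
    intro t ht
    rcases hchart (σ t) with ⟨hreg, U, r, c, hU, hz⟩ | ⟨U, r, c, hU, hz, h0⟩
    · obtain ⟨I, hI, hIU, hn⟩ := hσ.exists_image_mem_nhds hU ht.1 ht.2 hz
      refine ⟨hreg, IsArc.saturation_mem_nhds_of_image hU hz hI hIU ?_⟩
      filter_upwards [(hU.continuousOn.continuousAt (hU.isOpen.mem_nhds hz)).preimage_mem_nhds hn]
        with z hz' _ using hz'
    -- At an interior point on a singular orbit, the arc would have to take negative values in a
    -- chart with values in the half-line.
    · exfalso
      obtain ⟨I, hI, hIU, hn⟩ := hσ.exists_image_mem_nhds hU ht.1 ht.2 hz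
      rw [h0] at hn
      obtain ⟨ε, hε, hball⟩ := Metric.mem_nhds_iff.1 hn
      obtain ⟨s, hs, hs'⟩ := hball (show -(ε / 2) ∈ Metric.ball (0 : ℝ) ε by
        rw [Real.ball_eq_Ioo]
        constructor <;> linarith)
      have h1 : 0 ≤ r (σ s) := hU.mem _ (hIU s hs)
      have h2 : r (σ s) = -(ε / 2) := hs'
      linarith
  -- This makes the saturation open; being compact as well, it is all of the connected space.
  have hnhds : ∀ t ∈ Icc p q, saturation G σ p q ∈ 𝓝 (σ t) := by
    intro t ht
    rcases ht.1.eq_or_lt with rfl | h1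
    · rcases hchart (σ p) with ⟨hreg, -⟩ | ⟨U, r, c, hU, hz, h0⟩
      · exact absurd (hσp ▸ hreg) hx
      · exact hσ.saturation_mem_nhds_left hpq hU hz h0
    rcases ht.2.eq_or_lt with rfl | h2
    · rcases hchart (σ t) with ⟨hreg, -⟩ | ⟨U, r, c, hU, hz, h0⟩
      · exact absurd hreg hsing
      · rw [← saturation_comp_neg]
        have := hσ.comp_neg.saturation_mem_nhds_left (neg_lt_neg hpq) hU (by simpa using hz)
          (by simpa using h0)
        simpa using this
    · exact (hint t ⟨h1, h2⟩).2
  refine ⟨σ, p, q, hpq, hσ, hσp, ⟨_, hσq⟩, IsClopen.eq_univ ⟨hσ.isClosed_saturation, ?_⟩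
    ⟨σ p, p, left_mem_Icc.2 hpq.le, 1, one_smul _ _⟩, fun t ht => (hint t ht).1⟩
  rw [isOpen_iff_mem_nhds]
  rintro _ ⟨t, ht, d, rfl⟩
  have hc : ContinuousAt (fun z : Z => d⁻¹ • z) (d • σ t) := by fun_prop
  filter_upwards [hc.preimage_mem_nhds (by rw [inv_smul_smul]; exact hnhds t ht)] with z hz
  have := smul_mem_saturation hz d
  rwa [smul_inv_smul] at this

end Arc

end LocallyLinear

namespace QuaternionicMA

open scoped Quaternion unitInterval
open Set Filter Topology Function QuaternionicMA

/-! ### The unit sphere of the quaternionic plane -/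

noncomputable section

/-- The unit sphere of `ℍ²`. -/
abbrev QSphere : Type := {h : Fin 2 → ℍ[ℝ] // ‖h 0‖ ^ 2 + ‖h 1‖ ^ 2 = 1}

instance : MulAction (QTorus 2) QSphere where
  smul q z := ⟨stdAct q z.1, by simpa [stdAct] using z.2⟩
  one_smul z := Subtype.ext (funext fun i => one_mul (z.1 i))
  mul_smul q r z := Subtype.ext (funext fun i => mul_assoc (q i : ℍ[ℝ]) (r i : ℍ[ℝ]) (z.1 i))

namespace QSphere

lemma smul_apply (q : QTorus 2) (x : QSphere) (i : Fin 2) : (q • x).1 i = (q i : ℍ[ℝ]) * x.1 i :=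
  rfl

lemma continuous_coord (i : Fin 2) : Continuous fun x : QSphere => x.1 i :=
  (continuous_apply i).comp continuous_subtype_val

instance : ContinuousSMul (QTorus 2) QSphere where
  continuous_smul := by
    refine Continuous.subtype_mk (continuous_pi fun i => ?_) _
    change Continuous fun p : QTorus 2 × QSphere => (p.1 i : ℍ[ℝ]) * p.2.1 i
    exact (continuous_subtype_val.comp ((continuous_apply i).comp continuous_fst)).mul
      ((continuous_coord i).comp continuous_snd)

lemma exists_ne_zero (x : QSphere) : ∃ i, x.1 i ≠ 0 := by
  by_contra! h
  have := x.2
  rw [h 0, h 1] at this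
  norm_num at this

lemma smul_eq_self_iff (q : QTorus 2) (x : QSphere) : q • x = x ↔ ∀ i, x.1 i ≠ 0 → q i = 1 := by
  rw [Subtype.ext_iff, funext_iff]
  refine forall_congr' fun i => ?_
  rw [smul_apply]
  constructor
  · intro h hx
    exact Subtype.ext (mul_right_cancel₀ hx (h.trans (one_mul _).symm))
  · intro h
    by_cases hx : x.1 i = 0
    · rw [hx, mul_zero]
    · rw [h hx]
      exact one_mul _

/-- The element of the torus that is `-1` in the `i`-th coordinate and `1` elsewhere. -/
def reflection (i : Fin 2) : QTorus 2 := Pi.mulSingle i (-1)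

lemma neg_one_ne_one : (-1 : Metric.sphere (0 : ℍ[ℝ]) 1) ≠ 1 := by
  intro h
  have h1 : (-1 : ℍ[ℝ]) = 1 := congrArg Subtype.val h
  have h2 := congrArg (fun x : ℍ[ℝ] => x.re) h1
  norm_num at h2

lemma apply_eq_zero_of_forall_smul {x : QSphere} {i : Fin 2}
    (h : ∀ q : QTorus 2, (∀ j, j ≠ i → q j = 1) → q • x = x) : x.1 i = 0 := by
  by_contra hx
  have h1 := (smul_eq_self_iff _ _).1
    (h (reflection i) fun j hj => Pi.mulSingle_eq_of_ne hj _) i hx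
  rw [reflection, Pi.mulSingle_eq_same] at h1
  exact neg_one_ne_one h1

lemma smul_eq_self_iff_of_apply_eq_zero {x : QSphere} {i : Fin 2} (hx : x.1 i = 0) (q : QTorus 2) :
    q • x = x ↔ ∀ j, j ≠ i → q j = 1 := by
  rw [smul_eq_self_iff]
  refine forall_congr' fun j => ?_
  have : x.1 j ≠ 0 ↔ j ≠ i := by
    constructor
    · rintro h rfl
      exact h hx
    · intro hj h0
      obtain ⟨k, hk⟩ := x.exists_ne_zero
      have : k = i ∨ k = j := by omega
      rcases this with rfl | rfl
      · exact hk hx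
      · exact hk h0
  rw [this]

/-- Radial projection to the unit sphere. -/
def normalize (a : Fin 2 → ℍ[ℝ]) (ha : a ≠ 0) : QSphere :=
  ⟨fun i => (√(‖a 0‖ ^ 2 + ‖a 1‖ ^ 2))⁻¹ • a i, by
    have h1 : ‖a 0‖ ^ 2 + ‖a 1‖ ^ 2 ≠ 0 := by
      intro h
      have h0 : ‖a 0‖ = 0 := by nlinarith [sq_nonneg ‖a 0‖, sq_nonneg ‖a 1‖]
      have h1 : ‖a 1‖ = 0 := by nlinarith [sq_nonneg ‖a 0‖, sq_nonneg ‖a 1‖]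
      refine ha (funext fun i => ?_)
      fin_cases i
      · exact norm_eq_zero.1 h0
      · exact norm_eq_zero.1 h1
    have h2 : 0 ≤ ‖a 0‖ ^ 2 + ‖a 1‖ ^ 2 := by positivity
    simp only [norm_smul, norm_inv, Real.norm_eq_abs, mul_pow, inv_pow, sq_abs, Real.sq_sqrt h2]
    rw [← mul_add, inv_mul_cancel₀ h1]⟩

lemma normalize_apply {a : Fin 2 → ℍ[ℝ]} (ha : a ≠ 0) (i : Fin 2) :
    (normalize a ha).1 i = (√(‖a 0‖ ^ 2 + ‖a 1‖ ^ 2))⁻¹ • a i := rfl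

lemma sqrt_pos {a : Fin 2 → ℍ[ℝ]} (ha : a ≠ 0) : 0 < √(‖a 0‖ ^ 2 + ‖a 1‖ ^ 2) := by
  refine lt_of_le_of_ne (Real.sqrt_nonneg _) fun h => ?_
  obtain ⟨i, hi⟩ := (normalize a ha).exists_ne_zero
  rw [normalize_apply, ← h, inv_zero, zero_smul] at hi
  exact hi rfl

lemma normalize_apply_eq_zero {a : Fin 2 → ℍ[ℝ]} (ha : a ≠ 0) (i : Fin 2) :
    (normalize a ha).1 i = 0 ↔ a i = 0 := by
  rw [normalize_apply, smul_eq_zero, inv_eq_zero, or_iff_right (sqrt_pos ha).ne']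

lemma normalize_val (x : QSphere) (hx : x.1 ≠ 0) : normalize x.1 hx = x := by
  refine Subtype.ext (funext fun i => ?_)
  rw [normalize_apply, x.2, Real.sqrt_one, inv_one, one_smul]

/-- Radial projection of a nowhere vanishing map. -/
def normalizeMap {X : Type*} [TopologicalSpace X] (F : C(X, Fin 2 → ℍ[ℝ])) (hF : ∀ x, F x ≠ 0) :
    C(X, QSphere) :=
  ⟨fun x => normalize (F x) (hF x), by
    refine Continuous.subtype_mk (continuous_pi fun i => ?_) _
    refine Continuous.smul (Continuous.inv₀ (by fun_prop) fun x => (sqrt_pos (hF x)).ne') ?_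
    fun_prop⟩

lemma exists_mul_eq {x y : ℍ[ℝ]} (h : ‖x‖ = ‖y‖) :
    ∃ a : Metric.sphere (0 : ℍ[ℝ]) 1, (a : ℍ[ℝ]) * x = y := by
  by_cases hx : x = 0
  · subst hx
    rw [norm_zero] at h
    exact ⟨1, by rw [mul_zero, norm_eq_zero.1 h.symm]⟩
  · refine ⟨⟨y * x⁻¹, ?_⟩, ?_⟩
    · rw [mem_sphere_zero_iff_norm, norm_mul, norm_inv, ← h,
        mul_inv_cancel₀ (norm_ne_zero_iff.2 hx)]
    · change y * x⁻¹ * x = y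
      rw [inv_mul_cancel_right₀ hx]

/-! ### Sections of the orbit map -/

/-- The coefficients of the segment from the second to the first coordinate axis. -/
def coeff (t : I) : Fin 2 → ℝ := ![t, 1 - t]

lemma exists_coeff_ne_zero (t : I) : ∃ i, coeff t i ≠ 0 := by
  by_contra! h
  have h0 : (t : ℝ) = 0 := h 0
  have h1 : 1 - (t : ℝ) = 0 := h 1
  linarith

lemma coeff_nonneg (t : I) (i : Fin 2) : 0 ≤ coeff t i := by
  fin_cases i
  · exact t.2.1
  · exact sub_nonneg.2 t.2.2

lemma continuous_coeff (i : Fin 2) : Continuous fun t => coeff t i := by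
  fin_cases i
  · exact continuous_subtype_val
  · exact continuous_const.sub continuous_subtype_val

/-- The segment from `(0, u₁)` to `(u₀, 0)`. -/
def segmentMap (u : Fin 2 → ℍ[ℝ]) : C(I, Fin 2 → ℍ[ℝ]) :=
  ⟨fun t i => coeff t i • u i, continuous_pi fun i => (continuous_coeff i).smul continuous_const⟩

lemma segmentMap_ne_zero {u : Fin 2 → ℍ[ℝ]} (hu : ∀ i, u i ≠ 0) (t : I) : segmentMap u t ≠ 0 := by
  intro h
  obtain ⟨i, hi⟩ := exists_coeff_ne_zero t
  rcases smul_eq_zero.1 (congrFun h i) with h | h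
  · exact hi h
  · exact hu i h

/-- The section of the orbit map given by a segment. -/
def sectionMap (u : Fin 2 → ℍ[ℝ]) (hu : ∀ i, u i ≠ 0) : C(I, QSphere) :=
  normalizeMap (segmentMap u) (segmentMap_ne_zero hu)

variable {u : Fin 2 → ℍ[ℝ]} (hu : ∀ i, u i ≠ 0)

lemma sectionMap_apply_eq_zero (t : I) (i : Fin 2) :
    (sectionMap u hu t).1 i = 0 ↔ coeff t i = 0 := by
  change (normalize _ (segmentMap_ne_zero hu t)).1 i = 0 ↔ _
  rw [normalize_apply_eq_zero]
  change coeff t i • u i = 0 ↔ _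
  rw [smul_eq_zero, or_iff_left (hu i)]

/-- The action preserves the norms of both coordinates, and their ratio determines the parameter. -/
lemma eq_of_smul_sectionMap {a : QTorus 2} {t t' : I}
    (h : a • sectionMap u hu t = sectionMap u hu t') : t = t' := by
  have key : ∀ i, ‖(sectionMap u hu t).1 i‖ = ‖(sectionMap u hu t').1 i‖ := fun i => by
    rw [← h, smul_apply, norm_mul, mem_sphere_zero_iff_norm.1 (a i).2, one_mul]
  obtain ⟨N, hN, hNt⟩ : ∃ N : ℝ, 0 < N ∧ ∀ i, ‖(sectionMap u hu t).1 i‖ = N * coeff t i * ‖u i‖ := by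
    refine ⟨_, inv_pos.2 (sqrt_pos (segmentMap_ne_zero hu t)), fun i => ?_⟩
    change ‖_ • (coeff t i • u i)‖ = _
    rw [norm_smul, norm_smul, Real.norm_of_nonneg (coeff_nonneg t i),
      Real.norm_of_nonneg (inv_nonneg.2 (Real.sqrt_nonneg _)), mul_assoc]
  obtain ⟨N', hN', hNt'⟩ : ∃ N : ℝ, 0 < N ∧
      ∀ i, ‖(sectionMap u hu t').1 i‖ = N * coeff t' i * ‖u i‖ := by
    refine ⟨_, inv_pos.2 (sqrt_pos (segmentMap_ne_zero hu t')), fun i => ?_⟩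
    change ‖_ • (coeff t' i • u i)‖ = _
    rw [norm_smul, norm_smul, Real.norm_of_nonneg (coeff_nonneg t' i),
      Real.norm_of_nonneg (inv_nonneg.2 (Real.sqrt_nonneg _)), mul_assoc]
  have h1 : ∀ i, N * coeff t i = N' * coeff t' i := fun i => by
    have := key i
    rw [hNt, hNt'] at this
    exact mul_right_cancel₀ (norm_ne_zero_iff.2 (hu i)) this
  have h2 : N * t = N' * t' := h1 0
  have h3 : N * (1 - t) = N' * (1 - t') := h1 1
  have h4 : N = N' := by linarith
  rw [h4] at h2
  exact Subtype.ext (mul_left_cancel₀ hN'.ne' h2)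

/-- The orbit map of the sphere, as a parameter on the section. -/
def param (u : Fin 2 → ℍ[ℝ]) (x : QSphere) : ℝ :=
  (‖x.1 0‖ / ‖u 0‖) / (‖x.1 0‖ / ‖u 0‖ + ‖x.1 1‖ / ‖u 1‖)

include hu

lemma param_denom_pos (x : QSphere) : 0 < ‖x.1 0‖ / ‖u 0‖ + ‖x.1 1‖ / ‖u 1‖ := by
  have h0 := norm_pos_iff.2 (hu 0)
  have h1 := norm_pos_iff.2 (hu 1)
  obtain ⟨i, hi⟩ := x.exists_ne_zero
  have hi' := norm_pos_iff.2 hi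
  fin_cases i
  · exact add_pos_of_pos_of_nonneg (div_pos hi' h0) (by positivity)
  · exact add_pos_of_nonneg_of_pos (by positivity) (div_pos hi' h1)

lemma param_mem (x : QSphere) : param u x ∈ I := by
  have h := param_denom_pos hu x
  refine ⟨by unfold param; positivity, ?_⟩
  rw [param, div_le_one h]
  exact le_add_of_nonneg_right (by positivity)

lemma continuous_param : Continuous (param u) := by
  have h0 := (continuous_coord 0).norm.div_const ‖u 0‖
  have h1 := (continuous_coord 1).norm.div_const ‖u 1‖
  exact h0.div (h0.add h1) fun x => (param_denom_pos hu x).ne'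

/-- The parameter is chosen so that the two coordinate norms agree; quaternions of equal norm differ
by a unit factor on the left. -/
lemma exists_smul_sectionMap (x : QSphere) :
    ∃ a : QTorus 2, a • sectionMap u hu ⟨param u x, param_mem hu x⟩ = x := by
  set t : I := ⟨param u x, param_mem hu x⟩ with ht
  set D := ‖x.1 0‖ / ‖u 0‖ + ‖x.1 1‖ / ‖u 1‖ with hD
  have hDpos : 0 < D := param_denom_pos hu x
  have hc : ∀ i, coeff t i * ‖u i‖ = D⁻¹ * ‖x.1 i‖ := by
    have h0 := norm_ne_zero_iff.2 (hu 0)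
    have h1 := norm_ne_zero_iff.2 (hu 1)
    have ht0 : (t : ℝ) = (‖x.1 0‖ / ‖u 0‖) / D := rfl
    have hD1 : 1 - (‖x.1 0‖ / ‖u 0‖) / D = (‖x.1 1‖ / ‖u 1‖) / D := by
      rw [eq_div_iff hDpos.ne', sub_mul, div_mul_cancel₀ _ hDpos.ne', hD]
      ring
    intro i
    fin_cases i
    · change (t : ℝ) * ‖u 0‖ = D⁻¹ * ‖x.1 0‖
      rw [ht0]
      field_simp
    · change (1 - (t : ℝ)) * ‖u 1‖ = D⁻¹ * ‖x.1 1‖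
      rw [ht0, hD1]
      field_simp
  have hn : ∀ i, ‖segmentMap u t i‖ = D⁻¹ * ‖x.1 i‖ := fun i => by
    change ‖coeff t i • u i‖ = _
    rw [norm_smul, Real.norm_of_nonneg (coeff_nonneg t i), hc]
  have hs : √(‖segmentMap u t 0‖ ^ 2 + ‖segmentMap u t 1‖ ^ 2) = D⁻¹ := by
    rw [hn, hn, mul_pow, mul_pow, ← mul_add, x.2, mul_one, Real.sqrt_sq (inv_nonneg.2 hDpos.le)]
  have key : ∀ i, ‖(sectionMap u hu t).1 i‖ = ‖x.1 i‖ := fun i => by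
    change ‖(√(‖segmentMap u t 0‖ ^ 2 + ‖segmentMap u t 1‖ ^ 2))⁻¹ • segmentMap u t i‖ = _
    rw [hs, norm_smul, hn, inv_inv, Real.norm_of_nonneg hDpos.le, mul_inv_cancel_left₀ hDpos.ne']
  choose a ha using fun i => exists_mul_eq (key i)
  exact ⟨a, Subtype.ext (funext ha)⟩

omit hu

instance : PreconnectedSpace QSphere := by
  have hu : ∀ i : Fin 2, (1 : Fin 2 → ℍ[ℝ]) i ≠ 0 := fun i => one_ne_zero
  have h1 : IsPreconnected (Metric.sphere (0 : ℍ[ℝ]) 1) := by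
    refine isPreconnected_sphere ?_ _ _
    rw [← Module.finrank_eq_rank, Quaternion.finrank_eq_four]
    norm_num
  have : PreconnectedSpace (Metric.sphere (0 : ℍ[ℝ]) 1) := isPreconnected_iff_preconnectedSpace.1 h1
  have h2 : Continuous fun p : QTorus 2 × I => p.1 • sectionMap 1 hu p.2 := by fun_prop
  have h3 : Surjective fun p : QTorus 2 × I => p.1 • sectionMap 1 hu p.2 := fun x => by
    obtain ⟨a, ha⟩ := exists_smul_sectionMap hu x
    exact ⟨(a, _), ha⟩
  exact h3.denseRange.preconnectedSpace h2

/-! ### Straightening paths -/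

/-- A path in the sphere whose ends lie on the coordinate axes. -/
def IsAxial (p : C(I, QSphere)) : Prop := ∀ t i, coeff t i = 0 → (p t).1 i = 0

/-- The straight line homotopy. -/
def lineMap (a b : C(I, Fin 2 → ℍ[ℝ])) : C(I × I, Fin 2 → ℍ[ℝ]) :=
  ⟨fun p => (1 - (p.1 : ℝ)) • a p.2 + (p.1 : ℝ) • b p.2, by fun_prop⟩

lemma lineMap_apply (a b : C(I, Fin 2 → ℍ[ℝ])) (τ t : I) (i : Fin 2) :
    lineMap a b (τ, t) i = (1 - (τ : ℝ)) • a t i + (τ : ℝ) • b t i := rfl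

/-- The straight line homotopy, projected to the sphere. -/
def lineHomotopy {a b : C(I, Fin 2 → ℍ[ℝ])} (ha : ∀ t, a t ≠ 0) (hb : ∀ t, b t ≠ 0)
    (hab : ∀ p, lineMap a b p ≠ 0) (ha' : ∀ t i, coeff t i = 0 → a t i = 0)
    (hb' : ∀ t i, coeff t i = 0 → b t i = 0) :
    (normalizeMap a ha).HomotopyWith (normalizeMap b hb) IsAxial where
  toContinuousMap := normalizeMap (lineMap a b) hab
  map_zero_left t := by
    change normalize _ (hab (0, t)) = normalize _ (ha t)
    congr 1
    funext i
    simp [lineMap_apply]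
  map_one_left t := by
    change normalize _ (hab (1, t)) = normalize _ (hb t)
    congr 1
    funext i
    simp [lineMap_apply]
  prop' τ t i h := by
    change (normalize _ (hab (τ, t))).1 i = 0
    rw [normalize_apply_eq_zero, lineMap_apply, ha' t i h, hb' t i h, smul_zero, smul_zero, add_zero]

/-- The lines through 0 and a smooth curve sweep out the smooth image of a plane, which cannot fill
the 4-dimensional ℍ. -/
lemma exists_forall_smul_ne {d : ℝ → ℍ[ℝ]} (hd : ContDiff ℝ 1 d) : ∃ v, ∀ μ t : ℝ, μ • d t ≠ v := by
  have h1 : ContDiff ℝ 1 fun p : ℝ × ℝ => p.1 • d p.2 :=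
    contDiff_fst.smul (hd.comp contDiff_snd)
  have h2 := h1.dense_compl_range_of_finrank_lt_finrank (by
    rw [Quaternion.finrank_eq_four, Module.finrank_prod, Module.finrank_self]
    norm_num)
  obtain ⟨v, hv⟩ := h2.nonempty
  exact ⟨v, fun μ t h => hv ⟨(μ, t), h⟩⟩

/-- Two straight line homotopies in ℍ² minus the origin: first to a smooth path with the same axial
ends, then to a segment whose directions `u i` avoid all lines through the smooth coordinate curves.
-/
theorem exists_homotopyWith_sectionMap (δ : C(I, QSphere)) (hδ : IsAxial δ) :
    ∃ (u : Fin 2 → ℍ[ℝ]) (hu : ∀ i, u i ≠ 0),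
      Nonempty (δ.HomotopyWith (sectionMap u hu) IsAxial) := by
  have happrox : ∀ i : Fin 2, ∃ d : ℝ → ℍ[ℝ], ContDiff ℝ 1 d ∧
      (∀ t : I, ‖d t - (δ t).1 i‖ < 1 / 2) ∧ ∀ t : I, coeff t i = 0 → d t = 0 := by
    intro i
    obtain ⟨d, hd, hdδ, -⟩ := ((continuous_coord i).comp (δ.continuous.comp
      (continuous_projIcc (h := zero_le_one (α := ℝ))))).exists_contDiff_approx 1 (ε := fun _ => 1 / 4) continuous_const
      (fun _ => by norm_num)
    have hdδ' : ∀ t : I, ‖d t - (δ t).1 i‖ < 1 / 4 := fun t => by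
      have := hdδ t
      rwa [comp_apply, comp_apply, projIcc_val, dist_eq_norm] at this
    obtain ⟨t₀, ht₀⟩ : ∃ t₀ : I, ∀ t : I, coeff t i = 0 ↔ t = t₀ := by
      fin_cases i
      · exact ⟨0, fun t => ⟨fun h => Subtype.ext h, fun h => congrArg Subtype.val h⟩⟩
      · refine ⟨1, fun t => ⟨fun h => Subtype.ext ?_, ?_⟩⟩
        · have : 1 - (t : ℝ) = 0 := h
          change (t : ℝ) = 1
          linarith
        · rintro rfl
          change (1 : ℝ) - (1 : ℝ) = 0
          norm_num
    have h0 : (δ t₀).1 i = 0 := hδ _ _ ((ht₀ t₀).2 rfl)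
    have h1 := hdδ' t₀
    rw [h0, sub_zero] at h1
    -- Subtracting the value at the axial end restores exact vanishing there and doubles the error
    -- from 1/4 to 1/2.
    refine ⟨fun t => d t - d t₀, hd.sub contDiff_const, fun t => ?_, fun t ht => ?_⟩
    · have h2 := hdδ' t
      calc ‖d t - d t₀ - (δ t).1 i‖ = ‖(d t - (δ t).1 i) - d t₀‖ := by congr 1; abel
        _ ≤ ‖d t - (δ t).1 i‖ + ‖d t₀‖ := norm_sub_le _ _
        _ < 1 / 2 := by linarith
    · rw [(ht₀ t).1 ht]
      exact sub_self _
  choose d hd hdδ hd0 using happrox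
  choose u hu using fun i => exists_forall_smul_ne (hd i)
  have hu0 : ∀ i, u i ≠ 0 := fun i h => hu i 0 0 (by rw [h, zero_smul])
  let a : C(I, Fin 2 → ℍ[ℝ]) := ⟨fun t => (δ t).1, by fun_prop⟩
  let b : C(I, Fin 2 → ℍ[ℝ]) := ⟨fun t i => d i t, continuous_pi fun i =>
    (hd i).continuous.comp continuous_subtype_val⟩
  have ha : ∀ t, a t ≠ 0 := fun t h => by
    obtain ⟨i, hi⟩ := (δ t).exists_ne_zero
    exact hi (congrFun h i)
  -- At a zero both coordinates of a unit vector would have norm below 1/2.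
  have hab : ∀ p, lineMap a b p ≠ 0 := by
    rintro ⟨τ, t⟩ h
    have h1 : ∀ i, ‖(δ t).1 i‖ < 1 / 2 := fun i => by
      have h2 : (1 - (τ : ℝ)) • (δ t).1 i + (τ : ℝ) • d i t = 0 := congrFun h i
      have h3 : (δ t).1 i = -((τ : ℝ) • (d i t - (δ t).1 i)) := by
        refine eq_neg_of_add_eq_zero_left ?_
        rw [← h2, smul_sub, sub_smul, one_smul]
        abel
      rw [h3, norm_neg, norm_smul, Real.norm_of_nonneg τ.2.1]
      have := hdδ i t
      nlinarith [τ.2.1, τ.2.2, norm_nonneg (d i t - (δ t).1 i)]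
    have := (δ t).2
    nlinarith [h1 0, h1 1, norm_nonneg ((δ t).1 0), norm_nonneg ((δ t).1 1)]
  have hb : ∀ t, b t ≠ 0 := fun t h => by
    refine hab (1, t) (funext fun i => ?_)
    rw [lineMap_apply, h]
    simp
  -- At a zero, a coordinate with nonzero coefficient would exhibit `u i` as a real multiple of `d i
  -- t`.
  have hbs : ∀ p, lineMap b (segmentMap u) p ≠ 0 := by
    rintro ⟨τ, t⟩ h
    by_cases hτ : (τ : ℝ) = 0
    · refine hb t (funext fun i => ?_)
      have := congrFun h i
      rw [lineMap_apply, hτ] at this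
      simpa using this
    obtain ⟨i, hi⟩ := exists_coeff_ne_zero t
    have h1 : (1 - (τ : ℝ)) • d i t + (τ : ℝ) • coeff t i • u i = 0 := congrFun h i
    refine hu i (-((τ : ℝ) * coeff t i)⁻¹ * (1 - τ)) t ?_
    rw [mul_smul, eq_neg_of_add_eq_zero_left h1, smul_neg, neg_smul, neg_neg, smul_smul, smul_smul,
      mul_assoc, inv_mul_cancel₀ (mul_ne_zero hτ hi), one_smul]
  refine ⟨u, hu0, ⟨?_⟩⟩
  have H1 := lineHomotopy ha hb hab hδ fun t i h => hd0 i t h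
  have H2 := lineHomotopy hb (segmentMap_ne_zero hu0) hbs (fun t i h => hd0 i t h) fun t i h => by
    change coeff t i • u i = 0
    rw [h, zero_smul]
  have h3 : normalizeMap a ha = δ := ContinuousMap.ext fun t => normalize_val (δ t) (ha t)
  rw [h3] at H1
  exact H1.trans H2

end QSphere

end

end QuaternionicMA

namespace LocallyLinear

open scoped Quaternion unitInterval
open Set Filter Topology Function QuaternionicMA

/-! ### Equivariant maps determined on a section -/

section Section

variable {G Y Z : Type*} [Group G] [TopologicalSpace G] [CompactSpace G] [TopologicalSpace Y]
  [TopologicalSpace Z] [T2Space Z] [MulAction G Y] [MulAction G Z] [ContinuousSMul G Y]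
  [ContinuousSMul G Z]

/-- An equivariant homotopy is determined by its values on a section of the orbit map. -/
theorem exists_equivariant_homotopy {s : C(I, Z)} (hs : ∀ z, ∃ t, ∃ a : G, a • s t = z)
    (hinj : ∀ (a : G) t t', a • s t = s t' → t = t') (D : C(I × I, Y))
    (hD : ∀ (a : G) τ t, a • s t = s t → a • D (τ, t) = D (τ, t)) :
    ∃ F : C(I × Z, Y), (∀ τ t (a : G), F (τ, a • s t) = a • D (τ, t)) ∧
      ∀ τ, IsEquivariant G fun z => F (τ, z) := by
  let ψ : C(I × (G × I), I × Z) := ⟨fun p => (p.1, p.2.1 • s p.2.2), by fun_prop⟩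
  let K : C(I × (G × I), Y) := ⟨fun p => p.2.1 • D (p.1, p.2.2), by fun_prop⟩
  have hsurj : Surjective ψ := by
    rintro ⟨τ, z⟩
    obtain ⟨t, a, rfl⟩ := hs z
    exact ⟨(τ, a, t), rfl⟩
  have hψ : IsQuotientMap ψ := by
    exact ψ.continuous.isClosedMap.isQuotientMap ψ.continuous hsurj
  have hK : ∀ p p', ψ p = ψ p' → K p = K p' := by
    rintro ⟨τ, a, t⟩ ⟨τ', b, t'⟩ h
    obtain ⟨h1, h2⟩ := Prod.ext_iff.1 h
    change τ = τ' at h1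
    change a • s t = b • s t' at h2
    have h3 : (b⁻¹ * a) • s t = s t' := by rw [mul_smul, h2, inv_smul_smul]
    have h4 := hinj _ _ _ h3
    subst h1 h4
    have h5 := hD _ τ t h3
    rw [mul_smul, inv_smul_eq_iff] at h5
    exact h5
  have hF : ∀ τ t (a : G), hψ.lift K hK (τ, a • s t) = a • D (τ, t) := fun τ t a =>
    DFunLike.congr_fun (hψ.lift_comp K hK) (τ, a, t)
  refine ⟨hψ.lift K hK, hF, fun τ b z => ?_⟩
  obtain ⟨t, a, rfl⟩ := hs z
  dsimp only
  rw [← mul_smul, hF, hF, mul_smul]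

end Section

/-! ### The orbit space over the sphere -/

section Sphere

open QSphere

variable {Z : Type*} [TopologicalSpace Z] [T2Space Z] [CompactSpace Z] [MulAction (QTorus 2) Z]
  [ContinuousSMul (QTorus 2) Z]

lemma surjective_of_homotopic {Z : Type*} [TopologicalSpace Z] [T2Space Z] [CompactSpace Z]
    (d : ℕ) [ChartedSpace (EuclideanSpace ℝ (Fin d)) Z]
    {f : C(Z, QSphere)} {g : C(QSphere, Z)} (hfg : (g.comp f).Homotopic (ContinuousMap.id Z)) {g' : C(QSphere, Z)} (hg' : g.Homotopic g') :
    Surjective g' := by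
  obtain ⟨H⟩ := hfg.symm.trans (hg'.comp (.refl f))
  have h : Surjective (g' ∘ f) := ModTwo.surjective_of_homotopy_id (d := d) H
  exact h.of_comp

lemma coe_ne_zero_one (i : Fin 2) : (1 : Fin 2 → ℍ[ℝ]) i ≠ 0 := one_ne_zero

/-- The end of the standard section on which the `i`-th coordinate vanishes. -/
def endpoint (i : Fin 2) : I := ![0, 1] i

lemma coeff_endpoint (i : Fin 2) : coeff (endpoint i) i = 0 := by
  fin_cases i
  · rfl
  · exact sub_self (1 : ℝ)

lemma coeff_eq_zero_iff {t : I} {i : Fin 2} : coeff t i = 0 ↔ t = endpoint i := by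
  fin_cases i
  · exact ⟨fun h => Subtype.ext h, fun h => congrArg Subtype.val h⟩
  · constructor
    · intro h
      have h1 : 1 - (t : ℝ) = 0 := h
      exact Subtype.ext (show (t : ℝ) = 1 by linarith)
    · rintro rfl
      exact coeff_endpoint 1

set_option synthInstance.maxHeartbeats 200000 in
/-- A compact locally linear `Q²`-manifold that is equivariantly homotopy equivalent to the sphere
has a section of its orbit map with the same isotropy groups as the standard one. -/
theorem exists_section (d : ℕ) [ChartedSpace (EuclideanSpace ℝ (Fin d)) Z]
    (hZ : IsLocallyLinear (QTorus 2) Z) {f : C(Z, QSphere)} (hf : IsEquivariant (QTorus 2) f) {g : C(QSphere, Z)} (hg : IsEquivariant (QTorus 2) g)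
    (hfg : (g.comp f).Homotopic (ContinuousMap.id Z)) :
    ∃ s : C(I, Z), (∀ z, ∃ t, ∃ a : QTorus 2, a • s t = z) ∧
      (∀ (a : QTorus 2) t t', a • s t = s t' → t = t') ∧
      ∀ (a : QTorus 2) t, a • s t = s t ↔ ∀ i, coeff t i ≠ 0 → a i = 1 := by
  have hsurj : ∀ g' : C(QSphere, Z), g.Homotopic g' → Surjective g' :=
    fun g' h => surjective_of_homotopic d hfg h
  have : PreconnectedSpace Z := (hsurj g (.refl g)).denseRange.preconnectedSpace g.continuous
  have hstab : ∀ (a : QTorus 2) z, a • z = z → a • f z = f z := fun a z h => by rw [← hf, h]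
  let x : Fin 2 → QSphere := fun i => sectionMap 1 coe_ne_zero_one (endpoint i)
  have hx : ∀ i, (x i).1 i = 0 := fun i =>
    (sectionMap_apply_eq_zero _ _ i).2 (coeff_endpoint i)
  let y : Fin 2 → Z := fun i => g (x i)
  have hfy : ∀ i, (f (y i)).1 i = 0 := fun i => by
    refine apply_eq_zero_of_forall_smul fun q hq => hstab q _ ?_
    rw [← hg, (smul_eq_self_iff_of_apply_eq_zero (hx i) q).2 hq]
  -- Equivariant maps can only enlarge isotropy; since `x i` and `f (y i)` have the same isotropy
  -- group, that of `y i` is squeezed between them.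
  have hy : ∀ i (q : QTorus 2), q • y i = y i ↔ ∀ j, j ≠ i → q j = 1 := fun i q => by
    constructor
    · intro h
      exact (smul_eq_self_iff_of_apply_eq_zero (hfy i) q).1 (hstab q _ h)
    · intro h
      rw [← hg, (smul_eq_self_iff_of_apply_eq_zero (hx i) q).2 h]
  have hysing : ∀ i, MulAction.stabilizer (QTorus 2) (y i) ≠ ⊥ := fun i h => by
    have h1 : reflection i ∈ MulAction.stabilizer (QTorus 2) (y i) :=
      (hy i _).2 fun j hj => Pi.mulSingle_eq_of_ne hj _
    rw [h, Subgroup.mem_bot, reflection, Pi.mulSingle_eq_one_iff] at h1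
    exact neg_one_ne_one h1
  have hdisj : ∀ z : Z, (f z).1 0 = 0 → (f z).1 1 = 0 → False := fun z h0 h1 => by
    have := (f z).2
    rw [h0, h1] at this
    norm_num at this
  have hxy : ∀ a : QTorus 2, a • y 0 ≠ y 1 := fun a h => by
    refine hdisj (y 1) ?_ (hfy 1)
    rw [← h, hf, QSphere.smul_apply, hfy 0, mul_zero]
  have hregf : ∀ z, (∀ i, (f z).1 i ≠ 0) → MulAction.stabilizer (QTorus 2) z = ⊥ := fun z h => by
    rw [eq_bot_iff]
    intro a ha
    have h1 := (smul_eq_self_iff a (f z)).1 (hstab a z ha)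
    exact Subgroup.mem_bot.2 (funext fun i => h1 i (h i))
  -- Without free points, the preimages of the two axes would be disjoint nonempty closed sets that
  -- cover the connected space `Z`.
  obtain ⟨z₀, hz₀⟩ : ∃ z : Z, MulAction.stabilizer (QTorus 2) z = ⊥ := by
    by_contra! hcon
    have hcl : ∀ i, IsClosed {z : Z | (f z).1 i = 0} := fun i =>
      isClosed_eq ((continuous_coord i).comp f.continuous) continuous_const
    obtain ⟨z, -, h0, h1⟩ := isPreconnected_closed_iff.1 (isPreconnected_univ (α := Z)) _ _
      (hcl 0) (hcl 1) (fun z _ => by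
        by_contra hz
        refine hcon z (hregf z fun i => ?_)
        rw [mem_union, not_or] at hz
        fin_cases i
        · exact hz.1
        · exact hz.2) ⟨y 0, trivial, hfy 0⟩ ⟨y 1, trivial, hfy 1⟩
    exact hdisj z h0 h1
  have hreg : ∀ z : Z, MulAction.stabilizer (QTorus 2) z = ⊥ → ∃ U r c,
      IsOrbitChart (QTorus 2) univ U r c ∧ z ∈ U ∧
        ∀ z' ∈ U, MulAction.stabilizer (QTorus 2) z' = ⊥ := by
    intro z hz
    obtain ⟨k, Φ, hΦ, hΦz⟩ := exists_freeTube hZ hz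
    have hk0 := hΦ.dim_ne_zero (hysing 0)
    -- The sphere has a section parametrized by an interval, so for `k > 1` the map `g` could be
    -- pushed off an orbit, although every map homotopic to it is surjective.
    have hk1 : ¬ 1 < k := fun hk => by
      obtain ⟨g', hg', hns⟩ := hΦ.exists_homotopic_not_surjective hk g hg
        ⟨param 1, continuous_param coe_ne_zero_one⟩
        (s := fun t => sectionMap 1 coe_ne_zero_one (projIcc 0 1 zero_le_one t))
        ((ContinuousMap.continuous _).comp continuous_projIcc) fun x => by
          obtain ⟨a, ha⟩ := exists_smul_sectionMap coe_ne_zero_one x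
          refine ⟨a, ?_⟩
          change a • sectionMap 1 coe_ne_zero_one (projIcc 0 1 zero_le_one (param 1 x)) = x
          rwa [projIcc_of_mem _ (param_mem coe_ne_zero_one x)]
      exact hns (hsurj g' hg')
    obtain rfl : k = 1 := by omega
    refine ⟨_, _, _, hΦ.isOrbitChart, ⟨_, hΦz⟩, ?_⟩
    rintro _ ⟨p, rfl⟩
    exact hΦ.stabilizer p
  have hsing : ∀ z : Z, MulAction.stabilizer (QTorus 2) z ≠ ⊥ →
      z ∈ closure {z : Z | MulAction.stabilizer (QTorus 2) z = ⊥} → _ := fun z hz hz' =>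
    exists_orbitChart_Ici hZ (fun z hz => by
      obtain ⟨U, r, c, h, hU, -⟩ := hreg z hz
      exact ⟨U, r, c, h, hU⟩) hz hz'
  -- The closure of the free part is open: a singular chart contains one singular orbit, and that
  -- orbit lies in the closure if one of its points does.
  have hclopen : closure {z : Z | MulAction.stabilizer (QTorus 2) z = ⊥} = univ := by
    refine IsClopen.eq_univ ⟨isClosed_closure, isOpen_iff_mem_nhds.2 fun z hz => ?_⟩
      ⟨z₀, subset_closure hz₀⟩
    by_cases hzr : MulAction.stabilizer (QTorus 2) z = ⊥
    · obtain ⟨U, r, c, hU, hzU, hUr⟩ := hreg z hzr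
      exact mem_of_superset (hU.isOpen.mem_nhds hzU) fun w hw => subset_closure (hUr w hw)
    · obtain ⟨U, r, c, hU, hzU, hz0, hUr⟩ := hsing z hzr hz
      refine mem_of_superset (hU.isOpen.mem_nhds hzU) fun w hw => ?_
      by_cases hw0 : r w = 0
      · obtain ⟨a, rfl⟩ := (hU.orbit z hzU w hw).1 (hz0.trans hw0.symm)
        exact map_mem_closure (f := fun z : Z => a • z) (by fun_prop) hz
          fun z hz => stabilizer_smul_eq_bot hz a
      · exact subset_closure (hUr w hw hw0)
  obtain ⟨τ, p, q, hpq, hτ, hτp, ⟨b, hτq⟩, hsat, hint⟩ := exists_arc (fun z => by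
    by_cases hz : MulAction.stabilizer (QTorus 2) z = ⊥
    · obtain ⟨U, r, c, h, hU, -⟩ := hreg z hz
      exact Or.inl ⟨hz, U, r, c, h, hU⟩
    · obtain ⟨U, r, c, h, hU, h0, -⟩ := hsing z hz (hclopen ▸ mem_univ z)
      exact Or.inr ⟨U, r, c, h, hU, h0⟩) (hysing 0) (hysing 1) hxy
  have hmem : ∀ t : I, p + t * (q - p) ∈ Icc p q := fun t =>
    ⟨by nlinarith [t.2.1], by nlinarith [t.2.2]⟩
  have hpq' : q - p ≠ 0 := (sub_pos.2 hpq).ne'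
  refine ⟨⟨fun t => τ (p + t * (q - p)), hτ.continuousOn.comp_continuous (by fun_prop) hmem⟩,
    fun z => ?_, fun a t t' h => ?_, fun a t => ?_⟩
  · obtain ⟨t, ht, a, ha⟩ : z ∈ saturation (QTorus 2) τ p q := hsat ▸ mem_univ z
    refine ⟨⟨(t - p) / (q - p), div_nonneg (sub_nonneg.2 ht.1) (sub_pos.2 hpq).le, ?_⟩, a, ?_⟩
    · rw [div_le_one (sub_pos.2 hpq)]
      exact sub_le_sub_right ht.2 p
    · change a • τ (p + (t - p) / (q - p) * (q - p)) = z
      rw [div_mul_cancel₀ _ hpq', add_sub_cancel, ha]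
  · have h1 := hτ.inj _ (hmem t) _ (hmem t') a h
    exact Subtype.ext (mul_right_cancel₀ hpq' (add_left_cancel h1))
  · change a • τ (p + t * (q - p)) = τ (p + t * (q - p)) ↔ _
    have hends : ∀ i, t = endpoint i → ((∀ j, coeff t j ≠ 0 → a j = 1) ↔ ∀ j, j ≠ i → a j = 1) := by
      rintro i rfl
      refine forall_congr' fun j => ?_
      rw [ne_eq, coeff_eq_zero_iff]
      have : endpoint i = endpoint j ↔ i = j := by
        fin_cases i <;> fin_cases j <;> simp [endpoint]
      rw [this, eq_comm]
    by_cases h0 : t = endpoint 0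
    · rw [hends 0 h0, ← hy 0, h0]
      change a • τ (p + (0 : ℝ) * (q - p)) = τ (p + (0 : ℝ) * (q - p)) ↔ _
      rw [zero_mul, add_zero, hτp]
    by_cases h1 : t = endpoint 1
    · rw [hends 1 h1, h1]
      change a • τ (p + (1 : ℝ) * (q - p)) = τ (p + (1 : ℝ) * (q - p)) ↔ _
      rw [one_mul, add_sub_cancel]
      -- The arc ends on the orbit of `y 1`, not necessarily at `y 1`; this is harmless because the
      -- isotropy group is a factor of the torus and hence normal.
      have h2 : a • τ q = τ q ↔ (b * a * b⁻¹) • y 1 = y 1 := by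
        rw [← hτq, mul_smul, mul_smul, inv_smul_smul, smul_left_cancel_iff]
      rw [h2, hy 1]
      refine forall_congr' fun j => imp_congr_right fun _ => ?_
      exact conj_eq_one_iff
    · have hc : ∀ i, coeff t i ≠ 0 := fun i => by
        rw [ne_eq, coeff_eq_zero_iff]
        fin_cases i
        · exact h0
        · exact h1
      have hreg' := hint (p + t * (q - p)) ⟨?_, ?_⟩
      · rw [← MulAction.mem_stabilizer_iff, hreg', Subgroup.mem_bot, funext_iff]
        exact forall_congr' fun i => ⟨fun h _ => h, fun h => h (hc i)⟩
      · have : (t : ℝ) ≠ 0 := hc 0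
        nlinarith [lt_of_le_of_ne t.2.1 this.symm]
      · have : 1 - (t : ℝ) ≠ 0 := hc 1
        nlinarith [lt_of_le_of_ne (sub_nonneg.2 t.2.2) this.symm]

-- The path `f ∘ s` is axial, so it straightens to a standard section through points whose isotropy
-- contains that of `s`; the deformation therefore extends equivariantly to `Z`. The final map
-- carries one section to the other with equal isotropy groups, so it is bijective, and a
-- homeomorphism by compactness.
set_option synthInstance.maxHeartbeats 200000 in
theorem equivariant_rigidity_sphere (d : ℕ) [ChartedSpace (EuclideanSpace ℝ (Fin d)) Z]
    (hZ : IsLocallyLinear (QTorus 2) Z) (f : C(Z, QSphere)) (hf : IsEquivariant (QTorus 2) f)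
    {g : C(QSphere, Z)} (hg : IsEquivariant (QTorus 2) g)
    (hfg : (g.comp f).Homotopic (ContinuousMap.id Z)) :
    ∃ φ : Z ≃ₜ QSphere, IsEquivariant (QTorus 2) φ ∧
      EquivHomotopic (QTorus 2) f (φ : C(Z, QSphere)) := by
  obtain ⟨s, hs, hinj, hstab⟩ := exists_section d hZ hf hg hfg
  obtain ⟨u, hu, ⟨D⟩⟩ := exists_homotopyWith_sectionMap (f.comp s) fun t i ht => by
    refine apply_eq_zero_of_forall_smul fun q hq => ?_
    change q • f (s t) = f (s t)
    rw [← hf, (hstab q t).2 fun j hj => hq j ?_]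
    rintro rfl
    exact hj ht
  have hD : ∀ (a : QTorus 2) τ t, a • s t = s t → a • D (τ, t) = D (τ, t) := by
    intro a τ t h
    rw [smul_eq_self_iff]
    intro i hi
    exact (hstab a t).1 h i fun h0 => hi (D.prop τ t i h0)
  obtain ⟨F, hF, hFe⟩ := exists_equivariant_homotopy (Y := QSphere) hs hinj D.toContinuousMap hD
  have hF1 : ∀ t (a : QTorus 2), F (1, a • s t) = a • sectionMap u hu t := fun t a => by
    rw [hF]
    exact congrArg (a • ·) (D.apply_one t)
  have hhomeo : IsHomeomorph fun z => F (1, z) := by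
    rw [isHomeomorph_iff_continuous_bijective]
    refine ⟨by fun_prop, ?_, fun x => ?_⟩
    · intro z z' h
      obtain ⟨t, a, rfl⟩ := hs z
      obtain ⟨t', b, rfl⟩ := hs z'
      dsimp only at h
      rw [hF1, hF1] at h
      have h1 : (b⁻¹ * a) • sectionMap u hu t = sectionMap u hu t' := by
        rw [mul_smul, h, inv_smul_smul]
      obtain rfl := eq_of_smul_sectionMap hu h1
      rw [smul_eq_self_iff] at h1
      have h2 := (hstab (b⁻¹ * a) t).2 fun i hi =>
        h1 i fun h0 => hi ((sectionMap_apply_eq_zero hu t i).1 h0)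
      rwa [mul_smul, inv_smul_eq_iff] at h2
    · obtain ⟨a, ha⟩ := exists_smul_sectionMap hu x
      exact ⟨a • s _, (hF1 _ _).trans ha⟩
  refine ⟨hhomeo.homeomorph _, hFe 1, ⟨⟨F, fun z => ?_, fun z => rfl⟩, hFe⟩⟩
  obtain ⟨t, a, rfl⟩ := hs z
  refine (hF 0 t a).trans ?_
  rw [hf]
  exact congrArg (a • ·) (D.apply_zero t)

end Sphere

end LocallyLinear

namespace QuaternionicMA

open scoped Quaternion
open Set Filter Topology Function QuaternionicMA

/-! ### Moment-angle manifolds of segments -/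

namespace SimplePolytope

lemma slack_eq {m : ℕ} (P : SimplePolytope 1 m) (i : Fin m) (x : EuclideanSpace ℝ (Fin 1)) :
    P.slack i x = P.normal i 0 * x 0 + P.offset i := by
  simp [slack, PiLp.inner_apply, mul_comm]

lemma normal_ne_zero {m : ℕ} (P : SimplePolytope 1 m) (i : Fin m) : P.normal i 0 ≠ 0 := by
  intro h
  obtain ⟨x, hx, -⟩ := P.irredundant i
  obtain ⟨y, hy⟩ := P.full_dim
  have hx' : P.slack i x = 0 := hx
  have hy' : 0 < P.slack i y := hy i
  rw [slack_eq, h, zero_mul, zero_add] at hx' hy'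
  exact hy'.ne' hx'

/-- Going from the facet `i` to the facet `j` increases the slack of `i` and decreases that of `j`.
-/
lemma normal_mul_normal_neg {m : ℕ} (P : SimplePolytope 1 m) {i j : Fin m} (hij : i ≠ j) :
    P.normal i 0 * P.normal j 0 < 0 := by
  obtain ⟨x, hx, hx'⟩ := P.irredundant i
  obtain ⟨y, hy, hy'⟩ := P.irredundant j
  have h1 : P.slack i x = 0 := hx
  have h2 : P.slack j y = 0 := hy
  have h3 : 0 < P.slack j x := hx' j hij.symm
  have h4 : 0 < P.slack i y := hy' i hij
  rw [slack_eq] at h1 h2 h3 h4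
  have h5 : 0 < P.normal i 0 * (y 0 - x 0) := by linarith
  have h6 : P.normal j 0 * (y 0 - x 0) < 0 := by linarith
  by_contra! hcon
  nlinarith [mul_neg_of_pos_of_neg h5 h6, mul_nonneg hcon (sq_nonneg (y 0 - x 0))]

/-- If no normal opposed the direction `c`, the ray from an interior point in that direction would
stay in the bounded polytope. -/
lemma exists_normal_mul_pos {m : ℕ} (P : SimplePolytope 1 m) {c : ℝ} (hc : c ≠ 0) :
    ∃ i, P.normal i 0 * c < 0 := by
  by_contra! hcon
  obtain ⟨R, hR⟩ := P.bounded.exists_norm_le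
  obtain ⟨x, hx⟩ := P.full_dim
  set T := (|R| + 1 + |x 0|) / |c| with hT
  have hc' : 0 < |c| := abs_pos.2 hc
  have hT0 : 0 ≤ T := by positivity
  have hy : (x + T • EuclideanSpace.single 0 c : EuclideanSpace ℝ (Fin 1)) 0 = x 0 + T * c := by
    simp
  set y := x + T • EuclideanSpace.single 0 c
  have hmem := hR y fun i => by
    have h1 : 0 < P.slack i x := hx i
    change 0 ≤ P.slack i y
    rw [slack_eq] at h1 ⊢
    rw [hy]
    nlinarith [mul_nonneg hT0 (hcon i)]
  have h3 : |x 0 + T * c| ≤ R := by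
    rw [← hy]
    exact (PiLp.norm_apply_le y 0).trans hmem
  have h4 : |T * c| = |R| + 1 + |x 0| := by
    rw [abs_mul, abs_of_nonneg hT0, hT, div_mul_cancel₀ _ hc'.ne']
  have h5 : |T * c| ≤ |x 0 + T * c| + |x 0| := by
    calc |T * c| = |(x 0 + T * c) - x 0| := by rw [add_sub_cancel_left]
      _ ≤ _ := abs_sub _ _
  linarith [le_abs_self R]

/-- Boundedness in both directions gives two facets; a third normal would have to be opposite in
sign to both of the first two. -/
lemma facets_eq_two {m : ℕ} (P : SimplePolytope 1 m) : m = 2 := by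
  obtain ⟨i, hi⟩ := P.exists_normal_mul_pos one_ne_zero
  obtain ⟨j, hj⟩ := P.exists_normal_mul_pos (neg_ne_zero.2 one_ne_zero)
  have hij : i ≠ j := by
    rintro rfl
    linarith
  have huniv : (Finset.univ : Finset (Fin m)) = {i, j} := by
    ext k
    simp only [Finset.mem_univ, Finset.mem_insert, Finset.mem_singleton, true_iff]
    by_contra! hcon
    have h1 := P.normal_mul_normal_neg hcon.1
    have h2 := P.normal_mul_normal_neg hcon.2
    nlinarith
  have := congrArg Finset.card huniv
  rwa [Finset.card_univ, Fintype.card_fin, Finset.card_pair hij] at this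

end SimplePolytope

open SimplePolytope

/-- The normals have opposite signs, so weighting each slack by the size of the other normal cancels
the dependence on `x`. The resulting positive constant is normalized to 1, and square roots make the
weights act on quaternions. -/
lemma exists_weights (P : SimplePolytope 1 2) :
    ∃ k : Fin 2 → ℝ, (∀ i, 0 < k i) ∧ ∀ x, k 0 ^ 2 * P.slack 0 x + k 1 ^ 2 * P.slack 1 x = 1 := by
  set a₀ := P.normal 0 0 with ha₀
  set a₁ := P.normal 1 0 with ha₁
  have ha : a₀ * a₁ < 0 := P.normal_mul_normal_neg (by decide)
  have hc₀ : 0 < |a₁| := abs_pos.2 (P.normal_ne_zero 1)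
  have hc₁ : 0 < |a₀| := abs_pos.2 (P.normal_ne_zero 0)
  set C := |a₁| * P.offset 0 + |a₀| * P.offset 1 with hCdef
  have hsum : ∀ x, |a₁| * P.slack 0 x + |a₀| * P.slack 1 x = C := fun x => by
    rw [slack_eq, slack_eq, ← ha₀, ← ha₁]
    have : |a₁| * a₀ + |a₀| * a₁ = 0 := by
      rcases mul_neg_iff.1 ha with ⟨h0, h1⟩ | ⟨h0, h1⟩
      · rw [abs_of_pos h0, abs_of_neg h1]
        ring
      · rw [abs_of_neg h0, abs_of_pos h1]
        ring
    linear_combination x 0 * this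
  have hC : 0 < C := by
    obtain ⟨x, hx⟩ := P.full_dim
    rw [← hsum x]
    exact add_pos (mul_pos hc₀ (hx 0)) (mul_pos hc₁ (hx 1))
  refine ⟨![√(|a₁| / C), √(|a₀| / C)], fun i => ?_, fun x => ?_⟩
  · fin_cases i
    · exact Real.sqrt_pos.2 (div_pos hc₀ hC)
    · exact Real.sqrt_pos.2 (div_pos hc₁ hC)
  · change √(|a₁| / C) ^ 2 * P.slack 0 x + √(|a₀| / C) ^ 2 * P.slack 1 x = 1
    rw [Real.sq_sqrt (div_pos hc₀ hC).le, Real.sq_sqrt (div_pos hc₁ hC).le, div_mul_eq_mul_div,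
      div_mul_eq_mul_div, ← add_div, hsum, div_self hC.ne']

lemma exists_continuous_slack_eq {m : ℕ} (P : SimplePolytope 1 m) (i : Fin m) :
    ∃ b : ℝ → EuclideanSpace ℝ (Fin 1), Continuous b ∧ (∀ s, P.slack i (b s) = s) ∧
      ∀ x, b (P.slack i x) = x := by
  refine ⟨fun s => ((s - P.offset i) / P.normal i 0) • EuclideanSpace.single 0 1, ?_, fun s => ?_,
    fun x => ?_⟩
  · exact ((continuous_id.sub continuous_const).div_const _).smul continuous_const
  · rw [slack_eq]
    simp only [PiLp.smul_apply, PiLp.single_apply, if_true, smul_eq_mul, mul_one]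
    rw [mul_div_cancel₀ _ (P.normal_ne_zero i), sub_add_cancel]
  · ext j
    obtain rfl := Subsingleton.elim j 0
    simp only [PiLp.smul_apply, PiLp.single_apply, if_true, smul_eq_mul, mul_one]
    rw [slack_eq, add_sub_cancel_right, mul_div_cancel_left₀ _ (P.normal_ne_zero i)]

/-- The moment-angle manifold of a segment is equivariantly homeomorphic to the sphere. -/
theorem exists_homeomorph_sphere (P : SimplePolytope 1 2) :
    ∃ e : MomentAngle P ≃ₜ QSphere, IsEquivariant (QTorus 2) e := by
  obtain ⟨k, hk, hsum⟩ := exists_weights P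
  obtain ⟨b, hb, hb0, hbx⟩ := exists_continuous_slack_eq P 0
  have hnorm : ∀ (t : ℝ) (h : ℍ[ℝ]), ‖t • h‖ ^ 2 = t ^ 2 * ‖h‖ ^ 2 := fun t h => by
    rw [norm_smul, mul_pow, Real.norm_eq_abs, sq_abs]
  -- The first slack already determines the point of the segment; the sphere equation then forces
  -- the second slack to match.
  have hbase : ∀ (y : QSphere) i, ‖(k i)⁻¹ • y.1 i‖ ^ 2 =
      P.slack i (b (‖(k 0)⁻¹ • y.1 0‖ ^ 2)) := fun y i => by
    rcases (by omega : i = 0 ∨ i = 1) with rfl | rfl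
    · rw [hb0]
    · have h1 := hsum (b (‖(k 0)⁻¹ • y.1 0‖ ^ 2))
      have hk0 := (pow_pos (hk 0) 2).ne'
      have hk1 := (pow_pos (hk 1) 2).ne'
      have h2 : k 0 ^ 2 * ‖(k 0)⁻¹ • y.1 0‖ ^ 2 = ‖y.1 0‖ ^ 2 := by
        rw [hnorm, inv_pow, mul_inv_cancel_left₀ hk0]
      rw [hb0, h2] at h1
      rw [hnorm (k 1)⁻¹, inv_pow, inv_mul_eq_iff_eq_mul₀ hk1]
      linear_combination y.2 - h1
  have hto : ∀ z : MomentAngle P, ‖k 0 • z.1.1 0‖ ^ 2 + ‖k 1 • z.1.1 1‖ ^ 2 = 1 := fun z => by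
    rw [hnorm, hnorm, z.2.2, z.2.2, hsum]
  have hcoord : ∀ i, Continuous fun z : MomentAngle P => z.1.1 i := fun i =>
    (continuous_apply i).comp (continuous_fst.comp continuous_subtype_val)
  let F : MomentAngle P → QSphere := fun z => ⟨fun i => k i • z.1.1 i, hto z⟩
  let B : QSphere → MomentAngle P := fun y =>
    ⟨(fun i => (k i)⁻¹ • y.1 i, b (‖(k 0)⁻¹ • y.1 0‖ ^ 2)),
      fun i => (hbase y i).symm.ge.trans' (sq_nonneg _), hbase y⟩
  have hF : Continuous F := by
    refine Continuous.subtype_mk (continuous_pi fun i => ?_) _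
    exact (hcoord i).const_smul (k i)
  have hB : Continuous B := by
    refine Continuous.subtype_mk (Continuous.prodMk (continuous_pi fun i =>
      (QSphere.continuous_coord i).const_smul (k i)⁻¹) ?_) _
    exact hb.comp (((QSphere.continuous_coord 0).const_smul (k 0)⁻¹).norm.pow 2)
  have hBF : ∀ z, B (F z) = z := fun z => by
    refine Subtype.ext (Prod.ext (funext fun i => ?_) ?_)
    · exact inv_smul_smul₀ (hk i).ne' _
    · change b (‖(k 0)⁻¹ • k 0 • z.1.1 0‖ ^ 2) = z.1.2
      rw [inv_smul_smul₀ (hk 0).ne', z.2.2 0, hbx]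
  have hFB : ∀ y, F (B y) = y := fun y =>
    Subtype.ext (funext fun i => smul_inv_smul₀ (hk i).ne' _)
  refine ⟨⟨⟨F, B, hBF, hFB⟩, hF, hB⟩, fun q z => Subtype.ext (funext fun i => ?_)⟩
  exact (mul_smul_comm (k i) (q i : ℍ[ℝ]) (z.1.1 i)).symm

end QuaternionicMA

theorem theorem5p3 {n m : ℕ} (P : SimplePolytope n m)
    -- the quoric quotient of the moment-angle manifold by `K` has dimension 4
    (K : Subgroup (QTorus m)) (hK : IsQuoricQuotient P K 4)
    -- `Z` is a closed topological manifold with a locally linear `Q^m`-action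
    {d : ℕ} {Z : Type*} [TopologicalSpace Z] [T2Space Z] [CompactSpace Z]
    [ChartedSpace (EuclideanSpace ℝ (Fin d)) Z]
    [MulAction (QTorus m) Z] [ContinuousSMul (QTorus m) Z]
    (hZ : IsLocallyLinear (QTorus m) Z)
    (f : C(Z, MomentAngle P)) (hf : IsEquivHomotopyEquiv (QTorus m) f) :
    ∃ φ : Z ≃ₜ MomentAngle P,
      IsEquivariant (QTorus m) φ ∧
      EquivHomotopic (QTorus m) f (φ : C(Z, MomentAngle P)) := by
  obtain ⟨-, -, -, _, _, -, hX⟩ := hK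
  have hn := hX.dim_eq
  -- The dimension 4 of the quotient equals `4 * n`, so the polytope is a segment.
  obtain rfl : n = 1 := by omega
  obtain rfl : m = 2 := P.facets_eq_two
  obtain ⟨e, he⟩ := exists_homeomorph_sphere P
  have he' : IsEquivariant (QTorus 2) e.symm := fun a x => by
    rw [e.symm_apply_eq, he, e.apply_symm_apply]
  obtain ⟨hfe, g, hg, ⟨H, -⟩, -⟩ := hf
  let f' : C(Z, QSphere) := ⟨fun z => e (f z), by fun_prop⟩
  let g' : C(QSphere, Z) := ⟨fun x => g (e.symm x), by fun_prop⟩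
  have hgf : g'.comp f' = g.comp f := ContinuousMap.ext fun z =>
    congrArg g (e.symm_apply_apply (f z))
  obtain ⟨φ, hφ, F, hF⟩ := LocallyLinear.equivariant_rigidity_sphere d hZ f'
    (fun a z => (congrArg e (hfe a z)).trans (he a _)) (g := g')
    (fun a x => (congrArg g (he' a x)).trans (hg a _)) (hgf ▸ ⟨H⟩)
  refine ⟨φ.trans e.symm, fun a z => (congrArg e.symm (hφ a z)).trans (he' a _),
    ⟨⟨⟨fun p => e.symm (F p), by fun_prop⟩, fun z => ?_, fun z => ?_⟩, fun t a z =>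
      (congrArg e.symm (hF t a z)).trans (he' a _)⟩⟩
  · exact (congrArg e.symm (F.apply_zero z)).trans (e.symm_apply_apply (f z))
  · exact congrArg e.symm (F.apply_one z)
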